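/- Notation. For $\mu\in(-1,1)^n$ let $D_\mu$ be the product distribution on $\{-1,1\}^n$ with $\mathbf{E}[x_i]=\mu_i$ for all $i$, i.e. the coordinates are independent and $x_i=1$ with probability $(1+\mu_i)/2$. For $a\in\{0,1\}^n$ put $\phi_{\mu,a}(x)=\prod_{a_i=1}\frac{x_i-\mu_i}{\sqrt{1-\mu_i^2}}$ and, for $h:\{-1,1\}^n\to\mathbb{R}$, let $\hat h_\mu(a)=\mathbf{E}_{x\sim D_\mu}[h(x)\phi_{\mu,a}(x)]$ be the $\mu$-Fourier coefficient. Let $B_d$ be the set of $a\in\{0,1\}^n$ with at most $d$ ones, and $\hat h_\mu(B_d)=(\hat h_\mu(a))_{a\in B_d}$. Write $\|\cdot\|_0$ for the number of non-zero entries and $\|\cdot\|_\infty$ for the maximal absolute value of an entry. A vector is succinctly represented by the list, in any order, of its non-zero entries together with their indices. Theorem. There exists a randomized algorithm PTFapproxProd with the following property. Let $\mu\in(-1,1)^n$, let $f:\{-1,1\}^n\to\{-1,1\}$, let $\gamma>0$, $\delta>0$, let $d\ge 0$ be an integer, and let $\tilde f_\mu(B_d)\in\mathbb{R}^{B_d}$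 satisfy $\|\hat f_\mu(B_d)-\tilde f_\mu(B_d)\|_\infty\le\gamma$ and $\|\tilde f_\mu(B_d)\|_0=O(1/\gamma^2)$. Given $\mu$, $\gamma$, $\delta$, $d$ and the succinctly represented vector $\tilde f_\mu(B_d)$, the algorithm outputs a function $g:\{-1,1\}^n\to[-1,1]$ such that, with probability at least $1-\delta$, $\|\hat f_\mu(B_d)-\hat g_\mu(B_d)\|_\infty\le 5\gamma$. The algorithm runs in time polynomial in $n$, $1/\gamma$ and $\log(1/\delta)$, where for $\delta>1$ the last quantity is read as $0$. Here the algorithm is a single program, independent of the constant in $O(1/\gamma^2)$ (only the polynomial may depend on that constant), for a randomized random-access machine with fair coin flips and with memory for natural numbers (addition, truncated subtraction, comparison) and for real numbers (exact arithmetic, square roots and comparison at unit cost, no rounding). To output $g$ means to leave in memory a representation of $g$ from which a second fixed program of the same machine model computes $g(x)$ for every given $x\in\{-1,1\}^n$ within the same polynomial time bound, whatever the outcomes of its coin flips. -/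

import Mathlib

/-! ### Fourier analysis on the cube `{-1,1}^n` under a product distribution -/

/-- The Boolean cube `{-1,1}^n`; the type `ℤˣ` has exactly the two elements `1` and `-1`. -/
abbrev Cube (n : ℕ) : Type := Fin n → ℤˣ

/-- The `i`-th coordinate of a point of the cube, as a real number. -/
def Cube.coord {n : ℕ} (x : Cube n) (i : Fin n) : ℝ := ((x i : ℤ) : ℝ)

/-- The probability of `x` under the product distribution `D_μ`, in which the coordinates are
independent and `x_i = 1` with probability `(1 + μ_i) / 2`. -/
noncomputable def prodWeight {n : ℕ} (μ : Fin n → ℝ) (x : Cube n) : ℝ :=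
  ∏ i, if x i = 1 then (1 + μ i) / 2 else (1 - μ i) / 2

/-- The expectation of `h` under `D_μ`. -/
noncomputable def prodExp {n : ℕ} (μ : Fin n → ℝ) (h : Cube n → ℝ) : ℝ :=
  ∑ x, prodWeight μ x * h x

/-- The basis function `φ_{μ,a}`; an index `a ∈ {0,1}^n` is given by the set of its ones. -/
noncomputable def prodBasis {n : ℕ} (μ : Fin n → ℝ) (a : Finset (Fin n)) (x : Cube n) : ℝ :=
  ∏ i ∈ a, (x.coord i - μ i) / Real.sqrt (1 - μ i ^ 2)

/-- The `μ`-Fourier coefficient of `h` with index `a`. -/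
noncomputable def fourierCoeffProd {n : ℕ} (μ : Fin n → ℝ) (h : Cube n → ℝ)
    (a : Finset (Fin n)) : ℝ :=
  prodExp μ (fun x => h x * prodBasis μ a x)

/-- The index set `B_d` of the coefficients of degree at most `d`. -/
abbrev LowDeg (n d : ℕ) : Type := {a : Finset (Fin n) // a.card ≤ d}

/-- The number of non-zero entries of a vector of coefficients. -/
noncomputable def sparsity {n d : ℕ} (v : LowDeg n d → ℝ) : ℕ := Nat.card {a // v a ≠ 0}

/-! ### A randomized real RAM

The memory consists of arrays (two indices, cells initially `0`) of natural numbers and of arrays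
of real numbers. The name of an array is fixed in the program, the indices are computed. Natural
numbers can be added, subtracted (truncated at `0`) and compared; real numbers can be added,
subtracted, multiplied, divided and compared, and square roots can be taken, each exactly and at
unit cost. A natural number can be turned into a real number, but there is no conversion of real
numbers to natural numbers (no rounding), and programs hold no real constants. Randomness comes
from fair coin flips. -/

/-- The contents of the memory. -/
structure Mem where
  nat : ℕ → ℕ → ℕ → ℕ
  real : ℕ → ℕ → ℕ → ℝ

/-- Write `v` to cell `[i][j]` of the array `a` of natural numbers. -/
def Mem.setNat (m : Mem) (a i j v : ℕ) : Mem :=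
  { m with nat := fun a' i' j' => if a' = a ∧ i' = i ∧ j' = j then v else m.nat a' i' j' }

/-- Write `v` to cell `[i][j]` of the array `a` of real numbers. -/
noncomputable def Mem.setReal (m : Mem) (a i j : ℕ) (v : ℝ) : Mem :=
  { m with real := fun a' i' j' => if a' = a ∧ i' = i ∧ j' = j then v else m.real a' i' j' }

/-- Expressions of type natural number. -/
inductive NatExpr where
  | lit (k : ℕ)
  | cell (a : ℕ) (i j : NatExpr)
  | add (e e' : NatExpr)
  | sub (e e' : NatExpr)

def NatExpr.eval (m : Mem) : NatExpr → ℕ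
  | lit k => k
  | cell a i j => m.nat a (i.eval m) (j.eval m)
  | add e e' => e.eval m + e'.eval m
  | sub e e' => e.eval m - e'.eval m

/-- Expressions of type real number. -/
inductive RealExpr where
  | ofNat (e : NatExpr)
  | cell (a : ℕ) (i j : NatExpr)
  | add (e e' : RealExpr)
  | sub (e e' : RealExpr)
  | mul (e e' : RealExpr)
  | div (e e' : RealExpr)
  | sqrt (e : RealExpr)

noncomputable def RealExpr.eval (m : Mem) : RealExpr → ℝ
  | ofNat e => (e.eval m : ℝ)
  | cell a i j => m.real a (i.eval m) (j.eval m)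
  | add e e' => e.eval m + e'.eval m
  | sub e e' => e.eval m - e'.eval m
  | mul e e' => e.eval m * e'.eval m
  | div e e' => e.eval m / e'.eval m
  | sqrt e => Real.sqrt (e.eval m)

/-- Tests. -/
inductive Test where
  | ltNat (e e' : NatExpr)
  | ltReal (e e' : RealExpr)
  | neg (b : Test)
  | conj (b b' : Test)

def Test.Holds (m : Mem) : Test → Prop
  | ltNat e e' => e.eval m < e'.eval m
  | ltReal e e' => e.eval m < e'.eval m
  | neg b => ¬ b.Holds m
  | conj b b' => b.Holds m ∧ b'.Holds m

/-- Programs. -/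
inductive Prog where
  | skip
  | setNat (a : ℕ) (i j e : NatExpr)
  | setReal (a : ℕ) (i j : NatExpr) (e : RealExpr)
  | flip (a : ℕ) (i j : NatExpr)
  | seq (p q : Prog)
  | ite (b : Test) (p q : Prog)
  | loop (b : Test) (p : Prog)

/-- A configuration: the stack of the programs that remain to be executed, and the memory. -/
abbrev Cfg : Type := List Prog × Mem

open Classical in
/-- One step of the machine. Its cost is `1`; the expressions in a program have a size that is
fixed with the program, so up to a constant factor this counts single operations. -/
noncomputable def Cfg.step : Cfg → PMF Cfg
  | ([], m) => PMF.pure ([], m)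
  | (Prog.skip :: s, m) => PMF.pure (s, m)
  | (Prog.setNat a i j e :: s, m) =>
      PMF.pure (s, m.setNat a (i.eval m) (j.eval m) (e.eval m))
  | (Prog.setReal a i j e :: s, m) =>
      PMF.pure (s, m.setReal a (i.eval m) (j.eval m) (e.eval m))
  | (Prog.flip a i j :: s, m) =>
      (PMF.uniformOfFintype Bool).map
        (fun c => (s, m.setNat a (i.eval m) (j.eval m) c.toNat))
  | (Prog.seq p q :: s, m) => PMF.pure (p :: q :: s, m)
  | (Prog.ite b p q :: s, m) => PMF.pure (if b.Holds m then (p :: s, m) else (q :: s, m))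
  | (Prog.loop b p :: s, m) =>
      PMF.pure (if b.Holds m then (p :: Prog.loop b p :: s, m) else (s, m))

/-- The distribution of the configuration after `T` steps. A configuration with an empty stack
has halted and does not change any more. -/
noncomputable def Cfg.run : ℕ → Cfg → PMF Cfg
  | 0, c => PMF.pure c
  | T + 1, c => c.step.bind (Cfg.run T)

/-! ### Input and output -/

/-- The initial memory, which holds `n`, `d`, the number `s` of listed coefficients, `γ`, `δ`,
the vector `μ`, and the list of pairs of an index `a j ⊆ [n]` (as a row of `n` bits) and a real
coefficient `v j`. All other cells are `0`. -/
noncomputable def inputMem {n s : ℕ} (d : ℕ) (γ δ : ℝ) (μ : Fin n → ℝ)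
    (a : Fin s → Finset (Fin n)) (v : Fin s → ℝ) : Mem where
  nat := fun r i j =>
    match r, i, j with
    | 0, 0, 0 => n
    | 0, 0, 1 => d
    | 0, 0, 2 => s
    | 1, i, j => if h : i < s ∧ j < n then (if ⟨j, h.2⟩ ∈ a ⟨i, h.1⟩ then 1 else 0) else 0
    | _, _, _ => 0
  real := fun r i j =>
    match r, i, j with
    | 0, 0, 0 => γ
    | 0, 0, 1 => δ
    | 1, 0, j => if h : j < n then μ ⟨j, h⟩ else 0
    | 2, 0, j => if h : j < s then v ⟨j, h⟩ else 0
    | _, _, _ => 0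

/-- Write the point `x` to row `0` of the array `3` of real numbers. -/
noncomputable def Mem.loadPoint {n : ℕ} (m : Mem) (x : Cube n) : Mem :=
  { m with real := fun r i j =>
      if h : r = 3 ∧ i = 0 ∧ j < n then x.coord ⟨j, h.2.2⟩ else m.real r i j }

/-- The memory contents `m` represent the function `g`, through the evaluation program `E`: when
it is started on `m` and any point `x`, the program `E` halts within `T` steps with the value
`g x` in cell `[0][0]` of the array `4` of real numbers, whatever the outcomes of coin flips. -/
def Represents {n : ℕ} (E : Prog) (T : ℕ) (m : Mem) (g : Cube n → ℝ) : Prop :=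
  ∀ x : Cube n, ∀ c ∈ (Cfg.run T ([E], m.loadPoint x)).support,
    c.1 = [] ∧ c.2.real 4 0 0 = g x

/-! ### A program logic for deterministic programs -/

/-! The output is g = clip(G), where clip is the projection to [-1,1] and G is a sum of terms ±γ φ_a
that is built greedily. Progress is measured by the potential E[H(G) - fG], where H (`huber`) is the
primitive of clip. Since clip is 1-Lipschitz and E[φ_a²] = 1, adding cφ_a changes the potential by
at most c(ĝ(a) - f̂(a)) + c²/2 (`potential_add_le`). If ĝ(a) is off by at least γ, the right choice
of c = ±γ lowers the potential by at least γ²/2. The potential starts at 0 and never falls below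
-1/2 (`le_potential`), so at most 1/γ² terms are added, fewer than N = `numTerms γ`.

It remains to find a wrong coefficient. An index with nonzero given coefficient is on the input list
and is tested directly. For every other index the given value is 0, so one has to find the indices
with |ĝ(a)| > 4γ. This is a tree search in the manner of Goldreich-Levin and Kushilevitz-Mansour: a
pair (a, r) stands for all indices that agree with a from coordinate r on. The weight of such a
branch is the expectation of a product of values at two points that share the coordinates below r,
so it can be estimated from samples (`prodExp_pairVal`). It dominates ĝ(b)² for every b in the
branch (`sq_fourierCoeffProd_le`), and by Bessel's inequality the weights on one level sum to at
most 1 (`sum_upperWeight_le`). Hence pruning the light branches loses no large coefficient and keeps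
only O(1/γ²) branches on each level.

The functions φ_a are unbounded as μ_i approaches ±1, but their second moments are 1. Therefore the
estimates use Chebyshev's inequality in groups of samples and a majority vote over the groups. All
samples are drawn before the search and are reused. The dependence of later tests on earlier ones is
harmless, because a union bound covers every clipped sum with fewer than N terms together with every
test. A sample coordinate is obtained by comparing a uniform k-bit fraction with (1 + μ_i)/2, which
misses the probability of each sign by at most 2^(-k).

On the machine all coins are flipped first; everything else is deterministic and is handled by a
small program logic, which relates the memory to an abstract search state. Explicit caps on the
number of terms and on the queue bound the running time for all coin outcomes. On good samples the
invariant `SearchState.Inv` shows that they are never reached. -/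

/-- The deterministic program `p`, started on `m`, ends within `t` steps in a memory that
satisfies `Q`. -/
def Runs (p : Prog) (m : Mem) (t : ℕ) (Q : Mem → Prop) : Prop :=
  ∃ t' ≤ t, ∃ m', Q m' ∧ ∀ T s, Cfg.run (T + t') (p :: s, m) = Cfg.run T (s, m')

/-- `m'` agrees with `m` outside the natural arrays in `A` and the real arrays in `B`. -/
structure Mem.EqOff (A B : List ℕ) (m m' : Mem) : Prop where
  nat : ∀ a, a ∉ A → m'.nat a = m.nat a
  real : ∀ a, a ∉ B → m'.real a = m.real a

namespace Mem

theorem EqOff.refl (A B : List ℕ) (m : Mem) : EqOff A B m m := ⟨fun _ _ => rfl, fun _ _ => rfl⟩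

theorem EqOff.trans {A B : List ℕ} {m m' m'' : Mem} (h : EqOff A B m m') (h' : EqOff A B m' m'') :
    EqOff A B m m'' :=
  ⟨fun a ha => (h'.nat a ha).trans (h.nat a ha), fun a ha => (h'.real a ha).trans (h.real a ha)⟩

theorem EqOff.mono {A B A' B' : List ℕ} {m m' : Mem} (h : EqOff A B m m') (hA : A ⊆ A')
    (hB : B ⊆ B') : EqOff A' B' m m' :=
  ⟨fun a ha => h.nat a fun h' => ha (hA h'), fun a ha => h.real a fun h' => ha (hB h')⟩

@[simp] theorem setNat_real (m : Mem) (a i j v : ℕ) : (m.setNat a i j v).real = m.real := rfl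

@[simp] theorem setReal_nat (m : Mem) (a i j : ℕ) (v : ℝ) : (m.setReal a i j v).nat = m.nat := rfl

theorem setNat_nat (m : Mem) (a i j v a' i' j' : ℕ) : (m.setNat a i j v).nat a' i' j' =
    if a' = a ∧ i' = i ∧ j' = j then v else m.nat a' i' j' := rfl

theorem setReal_real (m : Mem) (a i j : ℕ) (v : ℝ) (a' i' j' : ℕ) :
    (m.setReal a i j v).real a' i' j' =
    if a' = a ∧ i' = i ∧ j' = j then v else m.real a' i' j' := rfl

@[simp] theorem setNat_nat_self (m : Mem) (a i j v : ℕ) : (m.setNat a i j v).nat a i j = v := by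
  simp [setNat_nat]

@[simp] theorem setReal_real_self (m : Mem) (a i j : ℕ) (v : ℝ) :
    (m.setReal a i j v).real a i j = v := by
  simp [setReal_real]

@[simp] theorem setNat_nat_of_ne {m : Mem} {a i j v a' : ℕ} (h : a' ≠ a) :
    (m.setNat a i j v).nat a' = m.nat a' := by
  funext i' j'; simp [setNat_nat, h]

@[simp] theorem setReal_real_of_ne {m : Mem} {a i j a' : ℕ} {v : ℝ} (h : a' ≠ a) :
    (m.setReal a i j v).real a' = m.real a' := by
  funext i' j'; simp [setReal_real, h]

theorem EqOff.setNat {A B : List ℕ} {m m' : Mem} (h : EqOff A B m m') {a : ℕ} (ha : a ∈ A)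
    (i j v : ℕ) : EqOff A B m (m'.setNat a i j v) :=
  ⟨fun b hb => by
    rw [setNat_nat_of_ne (ne_of_mem_of_not_mem ha hb).symm, h.nat b hb], h.real⟩

theorem EqOff.setReal {A B : List ℕ} {m m' : Mem} (h : EqOff A B m m') {a : ℕ} (ha : a ∈ B)
    (i j : ℕ) (v : ℝ) : EqOff A B m (m'.setReal a i j v) :=
  ⟨h.nat, fun b hb => by
    rw [setReal_real_of_ne (ne_of_mem_of_not_mem ha hb).symm, h.real b hb]⟩

end Mem

namespace Runs

variable {p q : Prog} {m : Mem} {t t₁ t₂ : ℕ} {Q Q' : Mem → Prop}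

theorem mono (h : Runs p m t Q) {t' : ℕ} (ht : t ≤ t') (hQ : ∀ m', Q m' → Q' m') :
    Runs p m t' Q' := by
  obtain ⟨u, hu, m', hm', h⟩ := h
  exact ⟨u, hu.trans ht, m', hQ _ hm', h⟩

theorem imp (h : Runs p m t Q) (hQ : ∀ m', Q m' → Q' m') : Runs p m t Q' := h.mono le_rfl hQ

theorem of_le {t' : ℕ} (h : Runs p m t Q) (ht : t ≤ t') : Runs p m t' Q := h.mono ht fun _ h => h

theorem skip (h : Q m) : Runs .skip m 1 Q :=
  ⟨1, le_rfl, m, h, fun T s => by simp [Cfg.run, Cfg.step]⟩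

theorem setNat {a : ℕ} {i j e : NatExpr} (h : Q (m.setNat a (i.eval m) (j.eval m) (e.eval m))) :
    Runs (.setNat a i j e) m 1 Q :=
  ⟨1, le_rfl, _, h, fun T s => by simp [Cfg.run, Cfg.step]⟩

theorem setReal {a : ℕ} {i j : NatExpr} {e : RealExpr}
    (h : Q (m.setReal a (i.eval m) (j.eval m) (e.eval m))) : Runs (.setReal a i j e) m 1 Q :=
  ⟨1, le_rfl, _, h, fun T s => by simp [Cfg.run, Cfg.step]⟩

/-- Runs compose because `Runs` provides an exact step count and an equation for every stack of
remaining programs: the equation for `p` is used with `q` on top of the stack. -/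
theorem seq (h₁ : Runs p m t₁ Q) (h₂ : ∀ m', Q m' → Runs q m' t₂ Q') :
    Runs (.seq p q) m (t₁ + t₂ + 1) Q' := by
  obtain ⟨u₁, hu₁, m₁, hm₁, h₁⟩ := h₁
  obtain ⟨u₂, hu₂, m₂, hm₂, h₂⟩ := h₂ m₁ hm₁
  refine ⟨u₁ + u₂ + 1, by omega, m₂, hm₂, fun T s => ?_⟩
  rw [show T + (u₁ + u₂ + 1) = (T + u₂ + u₁) + 1 by ring]
  simp only [Cfg.run, Cfg.step, PMF.pure_bind]
  rw [h₁, h₂]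

theorem setNat_seq {a : ℕ} {i j e : NatExpr} {v : ℕ} (hv : e.eval m = v)
    (h : Runs q (m.setNat a (i.eval m) (j.eval m) v) t Q) :
    Runs (.seq (.setNat a i j e) q) m (t + 2) Q := by
  subst hv
  exact ((Runs.setNat (Q := fun m' => m' = _) rfl).seq (t₂ := t) fun m' h' => by
    subst h'; exact h).mono (by omega) fun _ h => h

theorem setReal_seq {a : ℕ} {i j : NatExpr} {e : RealExpr} {v : ℝ} (hv : e.eval m = v)
    (h : Runs q (m.setReal a (i.eval m) (j.eval m) v) t Q) :
    Runs (.seq (.setReal a i j e) q) m (t + 2) Q := by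
  subst hv
  exact ((Runs.setReal (Q := fun m' => m' = _) rfl).seq (t₂ := t) fun m' h' => by
    subst h'; exact h).mono (by omega) fun _ h => h

theorem ite {b : Test} (h₁ : b.Holds m → Runs p m t Q) (h₂ : ¬ b.Holds m → Runs q m t Q) :
    Runs (.ite b p q) m (t + 1) Q := by
  by_cases hb : b.Holds m
  · obtain ⟨u, hu, m', hm', h⟩ := h₁ hb
    exact ⟨u + 1, by omega, m', hm', fun T s => by
      rw [← add_assoc]; simp only [Cfg.run, Cfg.step, if_pos hb, PMF.pure_bind, h]⟩
  · obtain ⟨u, hu, m', hm', h⟩ := h₂ hb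
    exact ⟨u + 1, by omega, m', hm', fun T s => by
      rw [← add_assoc]; simp only [Cfg.run, Cfg.step, if_neg hb, PMF.pure_bind, h]⟩

theorem ite_add {b : Test} (h₁ : b.Holds m → Runs p m t₁ Q) (h₂ : ¬ b.Holds m → Runs q m t₂ Q) :
    Runs (.ite b p q) m (t₁ + t₂ + 1) Q :=
  ite (fun hb => (h₁ hb).mono (Nat.le_add_right _ _) fun _ h => h)
    fun hb => (h₂ hb).mono (Nat.le_add_left _ _) fun _ h => h

/-- Loops with an invariant `I` and a variant that is bounded by `V`. -/
theorem loop {b : Test} (I : ℕ → Mem → Prop)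
    (hstep : ∀ k m', I k m' → b.Holds m' → Runs p m' t fun m'' => ∃ k' < k, I k' m'')
    {k : ℕ} (h0 : I k m) :
    Runs (.loop b p) m (k * (t + 1) + 1) fun m' => ¬ b.Holds m' ∧ ∃ k', I k' m' := by
  induction k using Nat.strong_induction_on generalizing m with
  | _ k ih =>
    by_cases hb : b.Holds m
    · obtain ⟨u, hu, m', ⟨k', hk', hm'⟩, h⟩ := hstep k m h0 hb
      obtain ⟨u', hu', m'', hm'', h'⟩ := ih k' hk' hm'
      refine ⟨u + u' + 1, ?_, m'', hm'', fun T s => ?_⟩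
      · have : (k' + 1) * (t + 1) ≤ k * (t + 1) := Nat.mul_le_mul_right _ hk'
        rw [add_mul] at this
        omega
      · rw [show T + (u + u' + 1) = (T + u' + u) + 1 by ring]
        simp only [Cfg.run, Cfg.step, if_pos hb, PMF.pure_bind]
        rw [h, h']
    · exact ⟨1, by omega, m, ⟨hb, k, h0⟩, fun T s => by
        simp only [Cfg.run, Cfg.step, if_neg hb, PMF.pure_bind]⟩

end Runs

/-! ### Program variables and counting loops -/

/-- Natural variables are kept in cell `[0][0]` of an array of their own. -/
abbrev NatExpr.var (a : ℕ) : NatExpr := .cell a (.lit 0) (.lit 0)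

/-- Real variables are kept in cell `[0][0]` of an array of their own. -/
abbrev RealExpr.var (a : ℕ) : RealExpr := .cell a (.lit 0) (.lit 0)

abbrev Prog.assignNat (a : ℕ) (e : NatExpr) : Prog := .setNat a (.lit 0) (.lit 0) e

abbrev Prog.assignReal (a : ℕ) (e : RealExpr) : Prog := .setReal a (.lit 0) (.lit 0) e

abbrev Prog.incr (a : ℕ) : Prog := .assignNat a (.add (.var a) (.lit 1))

/-- The loop `for v < e do p`. -/
def Prog.forLoop (v : ℕ) (e : NatExpr) (p : Prog) : Prog :=
  .seq (.assignNat v (.lit 0)) (.loop (.ltNat (.var v) e) (.seq p (.incr v)))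

/-- The variant is `N - i`. The body must leave the counter alone (`v ∉ A'`), and the bound must
keep its value in every memory that the loop can produce. The invariant `J i` speaks of the memory
whose counter already holds `i`, hence the `setNat` in the hypothesis on the body. The three extra
steps per round are the loop test, the sequencing and the increment. -/
theorem Runs.forLoop {v : ℕ} {e : NatExpr} {p : Prog} {m : Mem} {N t : ℕ} {A B A' : List ℕ}
    (J : ℕ → Mem → Prop) (hv : v ∈ A) (hA' : A' ⊆ A) (hvA' : v ∉ A')
    (he : ∀ m', m.EqOff A B m' → e.eval m' = N) (h0 : J 0 (m.setNat v 0 0 0))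
    (hstep : ∀ i < N, ∀ m', m.EqOff A B m' → m'.nat v 0 0 = i → J i m' →
      Runs p m' t fun m'' => m'.EqOff A' B m'' ∧ J (i + 1) (m''.setNat v 0 0 (i + 1))) :
    Runs (.forLoop v e p) m (N * (t + 3) + 3) fun m' => m.EqOff A B m' ∧ J N m' := by
  have hloop := Runs.loop (m := m.setNat v 0 0 0) (b := .ltNat (.var v) e)
    (p := .seq p (.incr v)) (t := t + 1 + 1) (k := N)
    (fun k m' => m.EqOff A B m' ∧ ∃ i ≤ N, k + i = N ∧ m'.nat v 0 0 = i ∧ J i m')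
    (fun k m' hI hb => by
      obtain ⟨hE, i, hi, hk, hi', hJ⟩ := hI
      simp only [Test.Holds, NatExpr.eval, he m' hE, hi'] at hb
      refine (hstep i hb m' hE hi' hJ).seq fun m'' hm'' => Runs.setNat ?_
      have hi'' : m''.nat v 0 0 = i := by rw [hm''.1.nat v hvA', hi']
      simp only [NatExpr.eval, hi'']
      exact ⟨k - 1, by omega, (hE.trans (hm''.1.mono hA' (fun _ h => h))).setNat hv _ _ _,
        i + 1, hb, by omega, by simp, hm''.2⟩)
    ⟨(Mem.EqOff.refl A B m).setNat hv _ _ _, 0, by omega, by omega, by simp, h0⟩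
  have := Runs.seq (p := .assignNat v (.lit 0)) (m := m) (t₁ := 1)
    (Q := fun m' => m' = m.setNat v 0 0 0) (Runs.setNat (by simp [NatExpr.eval]))
    (q := .loop (.ltNat (.var v) e) (.seq p (.incr v))) (fun m' h => h ▸ hloop)
  refine this.mono (by ring_nf; omega) ?_
  rintro m' ⟨hb, k, hE, i, hi, hk, hi', hJ⟩
  simp only [Test.Holds, NatExpr.eval, he m' hE, hi'] at hb
  obtain rfl : i = N := by omega
  exact ⟨hE, hJ⟩

/-! ### Evaluating basis functions and clipped linear combinations of them -/

/-- Multiply real variable `7` by the factors of the basis function whose index is the given row of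
the array `arr`, at the point in row `0` of array `3`. -/
def basisProg (arr : ℕ) (row : NatExpr) : Prog :=
  .seq (.assignReal 7 (.ofNat (.lit 1)))
    (.forLoop 16 (.var 0)
      (.ite (.ltNat (.lit 0) (.cell arr row (.var 16)))
        (.assignReal 7 (.mul (.var 7)
          (.div (.sub (.cell 3 (.lit 0) (.var 16)) (.cell 1 (.lit 0) (.var 16)))
            (.sqrt (.sub (.ofNat (.lit 1))
              (.mul (.cell 1 (.lit 0) (.var 16)) (.cell 1 (.lit 0) (.var 16))))))))
        .skip))

/-- The set whose indicator vector is row `i` of the array `arr`. -/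
def Mem.rowSet (n : ℕ) (m : Mem) (arr i : ℕ) : Finset (Fin n) :=
  Finset.univ.filter fun j => 0 < m.nat arr i j

theorem Mem.mem_rowSet {n : ℕ} {m : Mem} {arr i : ℕ} {j : Fin n} :
    j ∈ m.rowSet n arr i ↔ 0 < m.nat arr i j := by
  simp [Mem.rowSet]

theorem Mem.rowSet_congr {n : ℕ} {m m' : Mem} {arr i arr' i' : ℕ}
    (h : ∀ j < n, m'.nat arr' i' j = m.nat arr i j) : m'.rowSet n arr' i' = m.rowSet n arr i := by
  ext j; simp [Mem.mem_rowSet, h j j.2]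

/-- The memory holds `n`, `γ` and `μ` where the input puts them. -/
structure Mem.HasParams {n : ℕ} (m : Mem) (γ : ℝ) (μ : Fin n → ℝ) : Prop where
  dim : m.nat 0 0 0 = n
  gam : m.real 0 0 0 = γ
  mu : ∀ j : Fin n, m.real 1 0 j = μ j

theorem Mem.HasParams.congr {n : ℕ} {m m' : Mem} {γ : ℝ} {μ : Fin n → ℝ} (h : m.HasParams γ μ)
    {A B : List ℕ} (hE : m.EqOff A B m') (hA : 0 ∉ A) (hB : 0 ∉ B ∧ 1 ∉ B) : m'.HasParams γ μ :=
  ⟨by rw [hE.nat 0 hA, h.dim], by rw [hE.real 0 hB.1, h.gam], fun j => by rw [hE.real 1 hB.2, h.mu]⟩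

/-- Row `0` of the real array `3` holds the point `x`. -/
def Mem.HasPoint {n : ℕ} (m : Mem) (x : Cube n) : Prop := ∀ j : Fin n, m.real 3 0 j = x.coord j

theorem Mem.HasPoint.congr {n : ℕ} {m m' : Mem} {x : Cube n} (h : m.HasPoint x)
    {A B : List ℕ} (hE : m.EqOff A B m') (hB : 3 ∉ B) : m'.HasPoint x :=
  fun j => by rw [hE.real 3 hB, h]

theorem runs_basisProg {n : ℕ} {m : Mem} {γ : ℝ} {μ : Fin n → ℝ} {x : Cube n} {arr : ℕ}
    {row : NatExpr} (hm : m.HasParams γ μ) (hx : m.HasPoint x) (harr : arr ≠ 16)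
    (hrow : ∀ m', m.EqOff [16] [7] m' → row.eval m' = row.eval m) :
    Runs (basisProg arr row) m (n * 5 + 5) fun m' => m.EqOff [16] [7] m' ∧
      m'.real 7 0 0 = prodBasis μ (m.rowSet n arr (row.eval m)) x := by
  -- Coordinates outside the index contribute the factor 1, so the product over the index becomes a
  -- product over an initial segment, which the loop accumulates.
  set F : ℕ → ℝ := fun j => if 0 < m.nat arr (row.eval m) j then
    (m.real 3 0 j - m.real 1 0 j) / Real.sqrt (1 - m.real 1 0 j ^ 2) else 1 with hF
  have hprod : ∏ j ∈ Finset.range n, F j = prodBasis μ (m.rowSet n arr (row.eval m)) x := by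
    rw [Finset.prod_range, prodBasis, Mem.rowSet, Finset.prod_filter]
    refine Finset.prod_congr rfl fun j _ => ?_
    simp only [hF, hm.mu, hx j]
  have key := Runs.forLoop (v := 16) (e := .var 0) (m := m.setReal 7 0 0 1) (N := n) (A := [16])
    (B := [7]) (A' := []) (t := 2)
    (p := .ite (.ltNat (.lit 0) (.cell arr row (.var 16)))
        (.assignReal 7 (.mul (.var 7)
          (.div (.sub (.cell 3 (.lit 0) (.var 16)) (.cell 1 (.lit 0) (.var 16)))
            (.sqrt (.sub (.ofNat (.lit 1))
              (.mul (.cell 1 (.lit 0) (.var 16)) (.cell 1 (.lit 0) (.var 16))))))))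
        .skip)
    (fun i m' => m'.real 7 0 0 = ∏ j ∈ Finset.range i, F j)
    (by simp) (by simp) (by simp)
    (fun m' h => by simp [NatExpr.eval, h.nat 0 (by simp), hm.dim])
    (by simp)
    (fun i hi m' hE hi' hJ => by
      have hE' : m.EqOff [16] [7] m' :=
        ((Mem.EqOff.refl _ _ m).setReal (by simp) 0 0 1).trans hE
      have hcell : m'.nat arr (row.eval m') i = m.nat arr (row.eval m) i := by
        rw [hrow m' hE', hE'.nat arr (by simpa using harr)]
      refine Runs.ite (fun hb => Runs.setReal ?_) (fun hb => Runs.skip ?_)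
      · simp only [Test.Holds, NatExpr.eval, hi', hcell] at hb
        refine ⟨(Mem.EqOff.refl _ _ _).setReal (by simp) _ _ _, ?_⟩
        simp [RealExpr.eval, NatExpr.eval, hi', hJ, Finset.prod_range_succ, hF, hb,
          hE'.real 3 (by simp), hE'.real 1 (by simp), pow_two]
      · simp only [Test.Holds, NatExpr.eval, hi', hcell] at hb
        refine ⟨Mem.EqOff.refl _ _ _, ?_⟩
        simp [hJ, Finset.prod_range_succ, hF, hb])
  refine (Runs.setReal_seq (v := 1) (by simp [NatExpr.eval, RealExpr.eval]) key).mono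
    (by omega) ?_
  rintro m' ⟨hE, h⟩
  exact ⟨((Mem.EqOff.refl _ _ m).setReal (by simp) 0 0 1).trans hE, h.trans hprod⟩

/-- Projection to `[-1,1]`. -/
noncomputable def clip (s : ℝ) : ℝ := max (-1) (min 1 s)

theorem clip_mem (s : ℝ) : clip s ∈ Set.Icc (-1 : ℝ) 1 :=
  ⟨le_max_left _ _, max_le (by norm_num) (min_le_left _ _)⟩

/-- A sign as a real number. -/
def boolSign (b : Bool) : ℝ := if b then 1 else -1

/-- The clipped linear combination that a list of signed indices, of length `c`, stands for. -/
noncomputable def clippedSum {n : ℕ} (μ : Fin n → ℝ) (γ : ℝ) (c : ℕ)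
    (u : ℕ → Finset (Fin n) × Bool) (x : Cube n) : ℝ :=
  clip (γ * ∑ t ∈ Finset.range c, boolSign (u t).2 * prodBasis μ (u t).1 x)

/-- Evaluate the clipped linear combination in memory at the point in memory. -/
def evalProg : Prog :=
  .seq (.assignReal 8 (.ofNat (.lit 0)))
    (.seq (.forLoop 17 (.var 13) (.seq (basisProg 15 (.var 17))
        (.assignReal 8 (.add (.var 8) (.mul (.cell 6 (.lit 0) (.var 17)) (.var 7))))))
      (.seq (.assignReal 8 (.mul (.var 0) (.var 8)))
        (.ite (.ltReal (.ofNat (.lit 1)) (.var 8)) (.assignReal 4 (.ofNat (.lit 1)))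
          (.ite (.ltReal (.var 8) (.sub (.ofNat (.lit 0)) (.ofNat (.lit 1))))
            (.assignReal 4 (.sub (.ofNat (.lit 0)) (.ofNat (.lit 1))))
            (.assignReal 4 (.var 8))))))

/-- The memory holds the signed indices `u t` for `t < c`. -/
structure Mem.HasSum {n : ℕ} (m : Mem) (c : ℕ) (u : ℕ → Finset (Fin n) × Bool) : Prop where
  count : m.nat 13 0 0 = c
  row : ∀ t < c, m.rowSet n 15 t = (u t).1
  sign : ∀ t < c, m.real 6 0 t = boolSign (u t).2

theorem Mem.HasSum.congr {n : ℕ} {m m' : Mem} {c : ℕ} {u : ℕ → Finset (Fin n) × Bool}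
    (h : m.HasSum c u) {A B : List ℕ} (hE : m.EqOff A B m') (hA : 13 ∉ A ∧ 15 ∉ A) (hB : 6 ∉ B) :
    m'.HasSum c u :=
  ⟨by rw [hE.nat 13 hA.1, h.count],
    fun t ht => by rw [← h.row t ht]; exact Mem.rowSet_congr fun j _ => by rw [hE.nat 15 hA.2],
    fun t ht => by rw [hE.real 6 hB, h.sign t ht]⟩

theorem runs_evalProg {n : ℕ} {m : Mem} {γ : ℝ} {μ : Fin n → ℝ} {x : Cube n} {c : ℕ}
    {u : ℕ → Finset (Fin n) × Bool} (hm : m.HasParams γ μ) (hx : m.HasPoint x)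
    (hu : m.HasSum c u) :
    Runs evalProg m (c * (n * 5 + 10) + 12) fun m' => m.EqOff [16, 17] [4, 7, 8] m' ∧
      m'.real 4 0 0 = clippedSum μ γ c u x := by
  have key := Runs.forLoop (v := 17) (e := .var 13) (m := m.setReal 8 0 0 0) (N := c)
    (A := [16, 17]) (B := [4, 7, 8]) (A' := [16]) (t := n * 5 + 7)
    (p := .seq (basisProg 15 (.var 17))
        (.assignReal 8 (.add (.var 8) (.mul (.cell 6 (.lit 0) (.var 17)) (.var 7)))))
    (fun i m' => m'.real 8 0 0 =
      ∑ t ∈ Finset.range i, boolSign (u t).2 * prodBasis μ (u t).1 x)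
    (by simp) (by simp) (by simp)
    (fun m' h => by simp [NatExpr.eval, h.nat 13 (by simp), hu.count])
    (by simp)
    (fun i hi m' hE hi' hJ => by
      have hE' : m.EqOff [16, 17] [4, 7, 8] m' :=
        ((Mem.EqOff.refl _ _ m).setReal (by simp) 0 0 0).trans hE
      have hu' := hu.congr hE' (by simp) (by simp)
      refine ((runs_basisProg (row := .var 17) (hm.congr hE' (by simp) (by simp))
        (hx.congr hE' (by simp)) (by simp)
        fun m'' h => by simp [NatExpr.eval, h.nat 17]).seq fun m'' h => Runs.setReal ?_)
      obtain ⟨h, h'⟩ := h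
      refine ⟨(h.mono (by simp) (by simp)).setReal (by simp) _ _ _, ?_⟩
      rw [show NatExpr.eval m' (NatExpr.var 17) = i from hi', hu'.row i hi] at h'
      simp [RealExpr.eval, NatExpr.eval, h.nat 17, hi', hJ, Finset.sum_range_succ,
          h.real 8, h.real 6, h', hu'.sign i hi])
  have tail : ∀ m', m.EqOff [16, 17] [4, 7, 8] m' → ∀ s, m'.real 8 0 0 = s →
      Runs (.seq (.assignReal 8 (.mul (.var 0) (.var 8)))
        (.ite (.ltReal (.ofNat (.lit 1)) (.var 8)) (.assignReal 4 (.ofNat (.lit 1)))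
          (.ite (.ltReal (.var 8) (.sub (.ofNat (.lit 0)) (.ofNat (.lit 1))))
            (.assignReal 4 (.sub (.ofNat (.lit 0)) (.ofNat (.lit 1))))
            (.assignReal 4 (.var 8))))) m' 5 fun m'' => m.EqOff [16, 17] [4, 7, 8] m'' ∧
      m''.real 4 0 0 = clip (γ * s) := by
    intro m' hE s hs
    have hg : m'.real 0 0 0 = γ := by rw [hE.real 0 (by simp), hm.gam]
    have hE' := hE.setReal (a := 8) (by simp) 0 0 (γ * s)
    refine Runs.setReal_seq (v := γ * s) (t := 3)
      (by simp [NatExpr.eval, RealExpr.eval, hs, hg]) ?_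
    simp only [NatExpr.eval]
    refine Runs.ite (fun hb => ?_) fun hb => Runs.ite (fun hb' => ?_) fun hb' => ?_
    · refine (Runs.setReal ⟨hE'.setReal (by simp) _ _ _, ?_⟩).mono one_le_two fun _ h => h
      simp only [Test.Holds, NatExpr.eval, RealExpr.eval, Mem.setReal_real_self] at hb ⊢
      rw [clip, min_eq_left (by exact_mod_cast hb.le)]; norm_num
    all_goals
      refine Runs.setReal ⟨hE'.setReal (by simp) _ _ _, ?_⟩
      simp [Test.Holds, NatExpr.eval, RealExpr.eval] at hb hb' ⊢
      rw [clip, min_eq_right hb]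
    · rw [max_eq_left hb'.le]
    · rw [max_eq_right hb']
  refine (Runs.setReal_seq (v := 0) (by simp [NatExpr.eval, RealExpr.eval])
    (key.seq fun m' h => tail m' ?_ _ h.2)).mono (by ring_nf; omega) fun _ h => h
  exact ((Mem.EqOff.refl _ _ m).setReal (by simp) 0 0 0).trans h.1

/-! ### Testing an index against the samples -/

/-- Evaluate the clipped sum times the basis function whose index is the row that natural
variable `31` points to. -/
def valProg : Prog :=
  .seq evalProg (.seq (basisProg 1 (.var 31)) (.assignReal 9 (.mul (.var 4) (.var 7))))

theorem runs_valProg {n : ℕ} {m : Mem} {γ : ℝ} {μ : Fin n → ℝ} {x : Cube n} {c : ℕ}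
    {u : ℕ → Finset (Fin n) × Bool} (hm : m.HasParams γ μ) (hx : m.HasPoint x)
    (hu : m.HasSum c u) :
    Runs valProg m (c * (n * 5 + 10) + 12 + (n * 5 + 7) + 1) fun m' =>
      m.EqOff [16, 17] [4, 7, 8, 9] m' ∧ m'.real 9 0 0 =
        clippedSum μ γ c u x * prodBasis μ (m.rowSet n 1 (m.nat 31 0 0)) x := by
  refine (runs_evalProg hm hx hu).seq fun m' h => ?_
  obtain ⟨hE, h⟩ := h
  refine ((runs_basisProg (arr := 1) (row := .var 31) (hm.congr hE (by simp) (by simp))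
    (hx.congr hE (by simp)) (by simp) fun m'' h => by simp [NatExpr.eval, h.nat 31]).seq (t₂ := 1)
      fun m'' h' => Runs.setReal ?_).mono (by omega) fun _ h => h
  obtain ⟨hE', h'⟩ := h'
  have hrow : m'.rowSet n 1 (NatExpr.eval m' (.var 31)) = m.rowSet n 1 (m.nat 31 0 0) := by
    simp only [NatExpr.eval, hE.nat 31 (by simp)]
    exact Mem.rowSet_congr fun j _ => by rw [hE.nat 1 (by simp)]
  refine ⟨(hE.mono (by simp) (by simp)).trans ((hE'.mono (by simp) (by simp)).setReal
    (by simp) _ _ _), ?_⟩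
  rw [hrow] at h'
  simp [RealExpr.eval, NatExpr.eval, h', hE'.real 4, h]

/-- The point with the coordinates `j < r` of `x` and the other coordinates of `y`. -/
def mixPoint {n : ℕ} (r : ℕ) (y x : Cube n) : Cube n := fun j => if j.1 < r then x j else y j

/-- Row `i` of the real array `5` holds the sample `X i`, for `i < s`. -/
def Mem.HasSamples {n : ℕ} (m : Mem) (s : ℕ) (X : ℕ → Cube n) : Prop :=
  ∀ i < s, ∀ j : Fin n, m.real 5 i j = (X i).coord j

/-- What the memory must hold for the tests. -/
structure Mem.HasTest {n : ℕ} (m : Mem) (γ : ℝ) (μ : Fin n → ℝ) (c : ℕ)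
    (u : ℕ → Finset (Fin n) × Bool) (M R : ℕ) (X : ℕ → Cube n) : Prop where
  params : m.HasParams γ μ
  sum : m.HasSum c u
  size : m.nat 3 0 0 = M
  groups : m.nat 4 0 0 = R
  samples : m.HasSamples (2 * (R * M)) X

theorem Mem.HasTest.congr {n : ℕ} {m m' : Mem} {γ : ℝ} {μ : Fin n → ℝ} {c : ℕ}
    {u : ℕ → Finset (Fin n) × Bool} {M R : ℕ} {X : ℕ → Cube n} (h : m.HasTest γ μ c u M R X)
    {A B : List ℕ} (hE : m.EqOff A B m') (hA : ∀ a ∈ [0, 3, 4, 13, 15], a ∉ A)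
    (hB : ∀ b ∈ [0, 1, 5, 6], b ∉ B) : m'.HasTest γ μ c u M R X where
  params := h.params.congr hE (hA _ (by simp)) ⟨hB _ (by simp), hB _ (by simp)⟩
  sum := h.sum.congr hE ⟨hA _ (by simp), hA _ (by simp)⟩ (hB _ (by simp))
  size := by rw [hE.nat 3 (hA _ (by simp)), h.size]
  groups := by rw [hE.nat 4 (hA _ (by simp)), h.groups]
  samples := fun i hi j => by rw [hE.real 5 (hB _ (by simp)), h.samples i hi j]

abbrev NatExpr.evenRow : NatExpr := .add (.var 21) (.var 21)

abbrev NatExpr.oddRow : NatExpr := .add (.add (.var 21) (.var 21)) (.lit 1)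

/-- Load the first point of the sample pair that natural variable `21` points to. -/
def loadProg : Prog :=
  .forLoop 25 (.var 0) (.setReal 3 (.lit 0) (.var 25) (.cell 5 .evenRow (.var 25)))

/-- Replace the coordinates from natural variable `30` on by those of the second point. -/
def loadMixProg : Prog :=
  .forLoop 25 (.var 0) (.ite (.ltNat (.var 25) (.var 30))
    (.setReal 3 (.lit 0) (.var 25) (.cell 5 .evenRow (.var 25)))
    (.setReal 3 (.lit 0) (.var 25) (.cell 5 .oddRow (.var 25))))

theorem runs_loadProg {n : ℕ} {m : Mem} {x : Cube n} (hn : m.nat 0 0 0 = n)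
    (hx : ∀ j : Fin n, m.real 5 (m.nat 21 0 0 + m.nat 21 0 0) j = x.coord j) :
    Runs loadProg m (n * 4 + 3) fun m' => m.EqOff [25] [3] m' ∧ m'.HasPoint x := by
  refine (Runs.forLoop (A := [25]) (B := [3]) (A' := []) (t := 1) (N := n)
    (fun i m' => ∀ j : Fin n, j.1 < i → m'.real 3 0 j = x.coord j)
    (by simp) (by simp) (by simp) (fun m' h => by simp [NatExpr.eval, h.nat 0, hn])
    (by simp) fun i hi m' hE hi' hJ => Runs.setReal
      ⟨(Mem.EqOff.refl _ _ _).setReal (by simp) _ _ _, fun j hj => ?_⟩).mono (by omega)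
    fun m' h => ⟨h.1, fun j => h.2 j j.2⟩
  have := hx j
  simp only [NatExpr.eval, RealExpr.eval, hE.nat 21 (by simp), hE.real 5 (by simp), hi',
    Mem.setNat_real, Mem.setReal_real]
  split_ifs with h
  · rw [← this, h.2.2]
  · exact hJ j (by simp at h; omega)

theorem runs_loadMixProg {n : ℕ} {m : Mem} {x y : Cube n} (hn : m.nat 0 0 0 = n)
    (hx : ∀ j : Fin n, m.real 5 (m.nat 21 0 0 + m.nat 21 0 0) j = x.coord j)
    (hy : ∀ j : Fin n, m.real 5 (m.nat 21 0 0 + m.nat 21 0 0 + 1) j = y.coord j) :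
    Runs loadMixProg m (n * 5 + 3) fun m' =>
      m.EqOff [25] [3] m' ∧ m'.HasPoint (mixPoint (m.nat 30 0 0) y x) := by
  refine (Runs.forLoop (A := [25]) (B := [3]) (A' := []) (t := 2) (N := n)
    (fun i m' => ∀ j : Fin n, j.1 < i →
      m'.real 3 0 j = Cube.coord (mixPoint (m.nat 30 0 0) y x) j)
    (by simp) (by simp) (by simp) (fun m' h => by simp [NatExpr.eval, h.nat 0, hn])
    (by simp) fun i hi m' hE hi' hJ => Runs.ite (fun hb => Runs.setReal
      ⟨(Mem.EqOff.refl _ _ _).setReal (by simp) _ _ _, fun j hj => ?_⟩) (fun hb => Runs.setReal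
      ⟨(Mem.EqOff.refl _ _ _).setReal (by simp) _ _ _, fun j hj => ?_⟩)).mono (by omega)
    fun m' h => ⟨h.1, fun j => h.2 j j.2⟩
  all_goals
    have h1 := hx j
    have h2 := hy j
    simp only [Test.Holds, NatExpr.eval, RealExpr.eval, hE.nat 21 (by simp), hE.nat 30 (by simp),
      hE.real 5 (by simp), hi', Mem.setNat_real, Mem.setReal_real] at hb ⊢
    split_ifs with h
    swap
    · exact hJ j (by simp at h; omega)
    obtain ⟨-, -, rfl⟩ := h
    simp only [Cube.coord, mixPoint, hb, if_true, if_false] at h1 h2 ⊢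
  · exact h1
  · exact h2

/-- The product of the values at a point and at its mixture with a second point. -/
noncomputable def pairVal {n : ℕ} (μ : Fin n → ℝ) (g : Cube n → ℝ) (a : Finset (Fin n)) (r : ℕ)
    (x y : Cube n) : ℝ :=
  g x * prodBasis μ a x * (g (mixPoint r y x) * prodBasis μ a (mixPoint r y x))

/-- Add the values for the sample pair that natural variable `21` points to. -/
def pairProg : Prog :=
  .seq loadProg (.seq valProg (.seq (.assignReal 15 (.var 9))
    (.seq (.assignReal 11 (.add (.var 11) (.var 9))) (.seq loadMixProg (.seq valProg
      (.seq (.assignReal 10 (.add (.var 10) (.mul (.var 15) (.var 9)))) (.incr 21)))))))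

/-- A bound for the time of `pairProg`. -/
def pairTime (n c : ℕ) : ℕ := 2 * (c * (n * 5 + 10)) + 19 * n + 62

/-- One pair serves both kinds of tests: the first point alone feeds the sum in real variable `11`,
the product over both points the sum in `10`. Real variable `15` keeps the first value, since the
second evaluation overwrites `9`. -/
theorem runs_pairProg {n : ℕ} {m : Mem} {γ : ℝ} {μ : Fin n → ℝ} {c : ℕ}
    {u : ℕ → Finset (Fin n) × Bool} {M R : ℕ} {X : ℕ → Cube n} (h : m.HasTest γ μ c u M R X)
    {p : ℕ} (hp : m.nat 21 0 0 = p) (hp' : p < R * M) {g : Cube n → ℝ} (hg : clippedSum μ γ c u = g)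
    {a : Finset (Fin n)} (ha : m.rowSet n 1 (m.nat 31 0 0) = a) {r : ℕ} (hr : m.nat 30 0 0 = r) :
    Runs pairProg m (pairTime n c) fun m' =>
      m.EqOff [16, 17, 21, 25] [3, 4, 7, 8, 9, 10, 11, 15] m' ∧ m'.nat 21 0 0 = p + 1 ∧
      m'.real 10 0 0 = m.real 10 0 0 + pairVal μ g a r (X (2 * p)) (X (2 * p + 1)) ∧
      m'.real 11 0 0 = m.real 11 0 0 + g (X (2 * p)) * prodBasis μ a (X (2 * p)) := by
  have hx : ∀ j : Fin n, m.real 5 (p + p) j = (X (2 * p)).coord j := fun j => by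
    rw [← two_mul, h.samples _ (by omega)]
  have hy : ∀ j : Fin n, m.real 5 (p + p + 1) j = (X (2 * p + 1)).coord j := fun j => by
    rw [← two_mul, h.samples _ (by omega)]
  have hrow : ∀ {A B : List ℕ} {m' : Mem}, m.EqOff A B m' → 1 ∉ A → 31 ∉ A →
      m'.rowSet n 1 (m'.nat 31 0 0) = a := fun hE h1 h31 => by
    rw [← ha, hE.nat 31 h31]
    exact Mem.rowSet_congr fun j _ => by rw [hE.nat 1 h1]
  apply Runs.of_le
  · apply Runs.seq (runs_loadProg (x := X (2 * p)) h.params.dim (by simpa [hp] using hx))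
    rintro m₁ ⟨hE₁, hx₁⟩
    have t₁ := h.congr hE₁ (by decide) (by decide)
    apply Runs.seq (runs_valProg t₁.params hx₁ t₁.sum)
    rintro m₂ ⟨hE₂, hv₂⟩
    rw [hrow hE₁ (by simp) (by simp), hg] at hv₂
    apply Runs.setReal_seq rfl
    apply Runs.setReal_seq rfl
    simp only [NatExpr.eval, RealExpr.eval]
    set m₃ := Mem.setReal _ 11 0 0 _ with hm₃
    have hE₃ : m.EqOff [16, 17, 25] [3, 4, 7, 8, 9, 11, 15] m₃ :=
      (((hE₁.mono (by simp) (by simp)).trans (hE₂.mono (by simp) (by simp))).setReal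
        (by simp) _ _ _).setReal (by simp) _ _ _
    have h15 : m₃.real 15 0 0 = g (X (2 * p)) * prodBasis μ a (X (2 * p)) := by
      simp [hm₃, hv₂]
    have h11 : m₃.real 11 0 0 = m.real 11 0 0 + g (X (2 * p)) * prodBasis μ a (X (2 * p)) := by
      simp [hm₃, hv₂, hE₂.real 11, hE₁.real 11]
    clear_value m₃
    have t₃ := h.congr hE₃ (by decide) (by decide)
    apply Runs.seq (runs_loadMixProg (x := X (2 * p)) (y := X (2 * p + 1)) t₃.params.dim
      (by simpa [hE₃.nat 21, hp, hE₃.real 5] using hx)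
      (by simpa [hE₃.nat 21, hp, hE₃.real 5] using hy))
    rintro m₄ ⟨hE₄, hx₄⟩
    have t₄ := t₃.congr hE₄ (by decide) (by decide)
    have hE₄' : m.EqOff [16, 17, 25] [3, 4, 7, 8, 9, 11, 15] m₄ :=
      hE₃.trans (hE₄.mono (by simp) (by simp))
    apply Runs.seq (runs_valProg t₄.params hx₄ t₄.sum)
    rintro m₅ ⟨hE₅, hv₅⟩
    rw [hrow hE₄' (by simp) (by simp), hg, hE₃.nat 30 (by simp), hr] at hv₅
    have hE₅' : m.EqOff [16, 17, 25] [3, 4, 7, 8, 9, 11, 15] m₅ :=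
      hE₄'.trans (hE₅.mono (by simp) (by simp))
    apply Runs.setReal_seq rfl
    apply Runs.setNat
    refine ⟨((hE₅'.mono (by simp) (by simp)).setReal (by simp) _ _ _).setNat (by simp) _ _ _,
      ?_, ?_, ?_⟩
    · simp [NatExpr.eval, hE₅'.nat 21, hp]
    · simp [NatExpr.eval, RealExpr.eval, hE₅'.real 10, hE₅.real 15, hE₄.real 15, h15, hv₅, pairVal]
    · simp [NatExpr.eval, RealExpr.eval, hE₅.real 11, hE₄.real 11, h11]
  · simp only [pairTime]; omega

open Classical in
/-- The number of groups `i < R` in which the sum of `F` exceeds `θ`. -/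
noncomputable def countAbove (R M : ℕ) (F : ℕ → ℝ) (θ : ℝ) : ℕ :=
  ((Finset.range R).filter fun i => θ < ∑ k ∈ Finset.range M, F (i * M + k)).card

theorem countAbove_succ (R M : ℕ) (F : ℕ → ℝ) (θ : ℝ) [Decidable
      (θ < ∑ k ∈ Finset.range M, F (R * M + k))] :
    countAbove (R + 1) M F θ = countAbove R M F θ +
      if θ < ∑ k ∈ Finset.range M, F (R * M + k) then 1 else 0 := by
  classical
  simp only [countAbove, Finset.card_filter, Finset.sum_range_succ]
  congr

/-- The values at the first points of the sample pairs. -/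
noncomputable def singleSeq {n : ℕ} (μ : Fin n → ℝ) (g : Cube n → ℝ) (a : Finset (Fin n))
    (X : ℕ → Cube n) (p : ℕ) : ℝ := g (X (2 * p)) * prodBasis μ a (X (2 * p))

/-- The values of the sample pairs. -/
noncomputable def pairSeq {n : ℕ} (μ : Fin n → ℝ) (g : Cube n → ℝ) (a : Finset (Fin n)) (r : ℕ)
    (X : ℕ → Cube n) (p : ℕ) : ℝ := pairVal μ g a r (X (2 * p)) (X (2 * p + 1))

abbrev RealExpr.num (k : ℕ) : RealExpr := .ofNat (.lit k)

/-- Process one group of sample pairs and update the three counters. -/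
def groupProg : Prog :=
  .seq (.assignReal 10 (.num 0)) (.seq (.assignReal 11 (.num 0))
    (.seq (.forLoop 20 (.var 3) pairProg)
      (.seq (.ite (.ltReal (.mul (.mul (.num 12) (.mul (.var 0) (.var 0))) (.ofNat (.var 3)))
          (.var 10)) (.incr 22) .skip)
        (.seq (.ite (.ltReal (.mul (.add (.var 12) (.mul (.num 3) (.var 0))) (.ofNat (.var 3)))
            (.var 11)) (.incr 23) .skip)
          (.ite (.ltReal (.var 11) (.mul (.sub (.var 12) (.mul (.num 3) (.var 0)))
            (.ofNat (.var 3)))) (.incr 24) .skip)))))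

def groupTime (n c M : ℕ) : ℕ := M * (pairTime n c + 3) + 22

theorem runs_ite_incr {b : Test} {v : ℕ} {m : Mem} {k : ℕ} {P : Prop} [Decidable P]
    (hk : m.nat v 0 0 = k) (hb : b.Holds m ↔ P) :
    Runs (.ite b (.incr v) .skip) m 3 fun m' => m.EqOff [v] [] m' ∧
      m'.nat v 0 0 = k + if P then 1 else 0 := by
  refine (Runs.ite_add (fun h => Runs.setNat ⟨?_, ?_⟩) fun h => Runs.skip ⟨Mem.EqOff.refl _ _ _, ?_⟩)
  · exact (Mem.EqOff.refl _ _ _).setNat (by simp) _ _ _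
  · simp [NatExpr.eval, hk, hb.1 h]
  · simp [hk, mt hb.2 h]

/-- Counter `24` counts the sums below the lower threshold. It is phrased as the negated sequence
exceeding the negated threshold, so that `countAbove` describes all three counters. -/
theorem runs_groupProg {n : ℕ} {m : Mem} {γ : ℝ} {μ : Fin n → ℝ} {c : ℕ}
    {u : ℕ → Finset (Fin n) × Bool} {M R : ℕ} {X : ℕ → Cube n} (h : m.HasTest γ μ c u M R X)
    {i : ℕ} (hp : m.nat 21 0 0 = i * M) (hi : i < R) {g : Cube n → ℝ}
    (hg : clippedSum μ γ c u = g) {a : Finset (Fin n)} (ha : m.rowSet n 1 (m.nat 31 0 0) = a)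
    {r : ℕ} (hr : m.nat 30 0 0 = r) {v : ℝ} (hv : m.real 12 0 0 = v)
    (h22 : m.nat 22 0 0 = countAbove i M (pairSeq μ g a r X) (12 * (γ * γ) * M))
    (h23 : m.nat 23 0 0 = countAbove i M (singleSeq μ g a X) ((v + 3 * γ) * M))
    (h24 : m.nat 24 0 0 = countAbove i M (-singleSeq μ g a X) (-((v - 3 * γ) * M))) :
    Runs groupProg m (groupTime n c M) fun m' =>
      m.EqOff [16, 17, 20, 21, 22, 23, 24, 25] [3, 4, 7, 8, 9, 10, 11, 15] m' ∧
      m'.nat 21 0 0 = (i + 1) * M ∧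
      m'.nat 22 0 0 = countAbove (i + 1) M (pairSeq μ g a r X) (12 * (γ * γ) * M) ∧
      m'.nat 23 0 0 = countAbove (i + 1) M (singleSeq μ g a X) ((v + 3 * γ) * M) ∧
      m'.nat 24 0 0 = countAbove (i + 1) M (-singleSeq μ g a X) (-((v - 3 * γ) * M)) := by
  classical
  apply Runs.of_le
  · apply Runs.setReal_seq (v := 0) (by simp [RealExpr.eval, NatExpr.eval])
    apply Runs.setReal_seq (v := 0) (by simp [RealExpr.eval, NatExpr.eval])
    simp only [NatExpr.eval]
    set m₁ := Mem.setReal _ 11 0 0 _ with hm₁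
    have hE₁ : m.EqOff [16, 17, 20, 21, 25] [3, 4, 7, 8, 9, 10, 11, 15] m₁ :=
      ((Mem.EqOff.refl _ _ m).setReal (by simp) _ _ _).setReal (by simp) _ _ _
    have h10 : m₁.real 10 0 0 = 0 := by simp [hm₁]
    have h11 : m₁.real 11 0 0 = 0 := by simp [hm₁]
    have h21 : m₁.nat 21 0 0 = i * M := by simp [hm₁, hp]
    clear_value m₁
    have hloop := Runs.forLoop (v := 20) (e := .var 3) (p := pairProg) (m := m₁) (N := M)
      (A := [16, 17, 20, 21, 25]) (A' := [16, 17, 21, 25]) (B := [3, 4, 7, 8, 9, 10, 11, 15])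
      (t := pairTime n c)
      (fun k m' => m'.nat 21 0 0 = i * M + k ∧
        m'.real 10 0 0 = ∑ k ∈ Finset.range k, pairSeq μ g a r X (i * M + k) ∧
        m'.real 11 0 0 = ∑ k ∈ Finset.range k, singleSeq μ g a X (i * M + k))
      (by simp) (by simp) (by simp)
      (fun m' hE => by simp [NatExpr.eval, hE.nat 3, hE₁.nat 3, h.size])
      (by simp [h10, h11, h21])
      (fun k hk m' hE hk' hJ => by
        have hE' := hE₁.trans hE
        refine (runs_pairProg (h.congr hE' (by decide) (by decide)) hJ.1 ?_ hg (a := a) ?_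
          (r := r) ?_).imp fun m'' h'' => ⟨h''.1, ?_, ?_, ?_⟩
        · calc i * M + k < (i + 1) * M := by rw [add_mul]; omega
            _ ≤ R * M := Nat.mul_le_mul_right _ hi
        · rw [← ha, hE'.nat 31 (by simp)]
          exact Mem.rowSet_congr fun j _ => by rw [hE'.nat 1 (by simp)]
        · rw [hE'.nat 30 (by simp), hr]
        · simp [h''.2.1, add_assoc]
        · simp [h''.2.2.1, hJ.2.1, Finset.sum_range_succ, pairSeq]
        · simp [h''.2.2.2, hJ.2.2, Finset.sum_range_succ, singleSeq])
    apply Runs.seq hloop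
    rintro m₂ ⟨hE₂, h21, h10, h11⟩
    have hE₂' := hE₁.trans hE₂
    have e0 := hE₂'.real 0 (by simp)
    have e12 := hE₂'.real 12 (by simp)
    have e3 := hE₂'.nat 3 (by simp)
    apply Runs.seq (runs_ite_incr (v := 22) (by rw [hE₂'.nat 22 (by simp), h22])
      (P := 12 * (γ * γ) * M < ∑ k ∈ Finset.range M, pairSeq μ g a r X (i * M + k))
      (by simp [Test.Holds, RealExpr.eval, NatExpr.eval, e0, e3, h10, h.size, h.params.gam]))
    rintro m₃ ⟨hE₃, h22'⟩
    apply Runs.seq (runs_ite_incr (v := 23)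
      (by rw [hE₃.nat 23 (by simp), hE₂'.nat 23 (by simp), h23])
      (P := (v + 3 * γ) * M < ∑ k ∈ Finset.range M, singleSeq μ g a X (i * M + k))
      (by simp [Test.Holds, RealExpr.eval, NatExpr.eval, hE₃.real, hE₃.nat 3, e0, e12, e3,
        h11, h.size, h.params.gam, hv]))
    rintro m₄ ⟨hE₄, h23'⟩
    refine (runs_ite_incr (v := 24)
      (k := countAbove i M (-singleSeq μ g a X) (-((v - 3 * γ) * M)))
      (P := -((v - 3 * γ) * M) < ∑ k ∈ Finset.range M, (-singleSeq μ g a X) (i * M + k))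
      ?_ ?_).imp fun m₅ h₅ => ?_
    · rw [hE₄.nat 24 (by simp), hE₃.nat 24 (by simp), hE₂'.nat 24 (by simp), h24]
    · simp [Test.Holds, RealExpr.eval, NatExpr.eval, hE₄.real, hE₃.real, hE₄.nat 3,
        hE₃.nat 3, e0, e12, e3, h11, h.size, h.params.gam, hv]
    · obtain ⟨hE₅, h24'⟩ := h₅
      refine ⟨(((hE₂'.mono (by simp) (by simp)).trans (hE₃.mono (by simp) (by simp))).trans
        (hE₄.mono (by simp) (by simp))).trans (hE₅.mono (by simp) (by simp)), ?_, ?_, ?_, ?_⟩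
      · rw [hE₅.nat 21 (by simp), hE₄.nat 21 (by simp), hE₃.nat 21 (by simp), h21]; ring
      · rw [hE₅.nat 22 (by simp), hE₄.nat 22 (by simp), h22', countAbove_succ]
      · rw [hE₅.nat 23 (by simp), h23', countAbove_succ]
      · rw [h24', countAbove_succ]
  · simp only [groupTime]; omega

/-- Test the row that natural variable `31` points to against all groups of samples. -/
def testProg : Prog :=
  .seq (.assignNat 21 (.lit 0)) (.seq (.assignNat 22 (.lit 0)) (.seq (.assignNat 23 (.lit 0))
    (.seq (.assignNat 24 (.lit 0)) (.forLoop 19 (.var 4) groupProg))))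

def testTime (n c M R : ℕ) : ℕ := R * (groupTime n c M + 3) + 11

theorem runs_testProg {n : ℕ} {m : Mem} {γ : ℝ} {μ : Fin n → ℝ} {c : ℕ}
    {u : ℕ → Finset (Fin n) × Bool} {M R : ℕ} {X : ℕ → Cube n} (h : m.HasTest γ μ c u M R X)
    {g : Cube n → ℝ} (hg : clippedSum μ γ c u = g) {a : Finset (Fin n)}
    (ha : m.rowSet n 1 (m.nat 31 0 0) = a) {r : ℕ} (hr : m.nat 30 0 0 = r) {v : ℝ}
    (hv : m.real 12 0 0 = v) :
    Runs testProg m (testTime n c M R) fun m' =>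
      m.EqOff [16, 17, 19, 20, 21, 22, 23, 24, 25] [3, 4, 7, 8, 9, 10, 11, 15] m' ∧
      m'.nat 22 0 0 = countAbove R M (pairSeq μ g a r X) (12 * (γ * γ) * M) ∧
      m'.nat 23 0 0 = countAbove R M (singleSeq μ g a X) ((v + 3 * γ) * M) ∧
      m'.nat 24 0 0 = countAbove R M (-singleSeq μ g a X) (-((v - 3 * γ) * M)) := by
  apply Runs.of_le
  · apply Runs.setNat_seq (v := 0) rfl
    apply Runs.setNat_seq (v := 0) rfl
    apply Runs.setNat_seq (v := 0) rfl
    apply Runs.setNat_seq (v := 0) rfl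
    simp only [NatExpr.eval]
    set m₁ := Mem.setNat _ 24 0 0 _ with hm₁
    have hE₁ : m.EqOff [16, 17, 19, 20, 21, 22, 23, 24, 25] [3, 4, 7, 8, 9, 10, 11, 15] m₁ :=
      ((((Mem.EqOff.refl _ _ m).setNat (by simp) _ _ _).setNat (by simp) _ _ _).setNat
        (by simp) _ _ _).setNat (by simp) _ _ _
    have h21 : m₁.nat 21 0 0 = 0 := by simp [hm₁]
    have h22 : m₁.nat 22 0 0 = 0 := by simp [hm₁]
    have h23 : m₁.nat 23 0 0 = 0 := by simp [hm₁]
    have h24 : m₁.nat 24 0 0 = 0 := by simp [hm₁]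
    clear_value m₁
    refine (Runs.forLoop (v := 19) (e := .var 4) (p := groupProg) (m := m₁) (N := R)
      (A := [16, 17, 19, 20, 21, 22, 23, 24, 25]) (A' := [16, 17, 20, 21, 22, 23, 24, 25])
      (B := [3, 4, 7, 8, 9, 10, 11, 15]) (t := groupTime n c M)
      (fun i m' => m'.nat 21 0 0 = i * M ∧
        m'.nat 22 0 0 = countAbove i M (pairSeq μ g a r X) (12 * (γ * γ) * M) ∧
        m'.nat 23 0 0 = countAbove i M (singleSeq μ g a X) ((v + 3 * γ) * M) ∧
        m'.nat 24 0 0 = countAbove i M (-singleSeq μ g a X) (-((v - 3 * γ) * M)))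
      (by simp) (by simp) (by simp)
      (fun m' hE => by simp [NatExpr.eval, hE.nat 4, hE₁.nat 4, h.groups])
      (by simp [h21, h22, h23, h24, countAbove])
      (fun i hi m' hE hi' hJ => by
        have hE' := hE₁.trans hE
        refine (runs_groupProg (h.congr hE' (by decide) (by decide)) hJ.1 hi hg (a := a) ?_
          (r := r) ?_ (v := v) ?_ hJ.2.1 hJ.2.2.1 hJ.2.2.2).imp fun m'' h'' => ⟨h''.1, ?_⟩
        · rw [← ha, hE'.nat 31 (by simp)]
          exact Mem.rowSet_congr fun j _ => by rw [hE'.nat 1 (by simp)]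
        · rw [hE'.nat 30 (by simp), hr]
        · rw [hE'.real 12 (by simp), hv]
        · simp [h''.2.1, h''.2.2.1, h''.2.2.2.1, h''.2.2.2.2])).imp
      fun m' h' => ⟨hE₁.trans h'.1, h'.2.2⟩
  · simp only [testTime]; omega

/-! ### The search for an index with a wrong coefficient -/

/-- The state of the search: the signed indices found so far, and a queue of pairs `(a, r)` of
which the coordinates from `r` on have been decided, the first `head` of them processed. -/
structure SearchState (n : ℕ) where
  count : ℕ
  terms : ℕ → Finset (Fin n) × Bool
  head : ℕ
  tail : ℕ
  queue : ℕ → Finset (Fin n) × ℕ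

/-- The parameters of the search. -/
structure SearchParams (n : ℕ) where
  deg : ℕ
  gam : ℝ
  mean : Fin n → ℝ
  len : ℕ
  coeff : ℕ → ℝ
  maxCount : ℕ
  maxTail : ℕ
  groupSize : ℕ
  groups : ℕ
  sample : ℕ → Cube n

/-- Set the indicator of `i` in `a` to `b`. -/
def setBit {n : ℕ} (b : Bool) (a : Finset (Fin n)) (i : ℕ) : Finset (Fin n) :=
  Finset.univ.filter fun j => if j.1 = i then b = true else j ∈ a

/-- The last of the first `s` coefficients that is listed with index `a`. -/
noncomputable def lookupVal {n : ℕ} (q : ℕ → Finset (Fin n) × ℕ) (V : ℕ → ℝ) (a : Finset (Fin n)) :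
    ℕ → ℝ
  | 0 => 0
  | s + 1 => if (q s).1 = a then V s else lookupVal q V a s

namespace SearchState

variable {n : ℕ}

/-- The function that the signed indices found so far stand for. -/
noncomputable def fn (P : SearchParams n) (σ : SearchState n) : Cube n → ℝ :=
  clippedSum P.mean P.gam σ.count σ.terms

/-- A majority vote of the groups. With group means accurate to 4γ² in most groups, the threshold
12γ² accepts every weight above 16γ² and accepts none up to 8γ². -/
def PairTest (P : SearchParams n) (σ : SearchState n) (a : Finset (Fin n)) (r : ℕ) : Prop :=
  P.groups < 2 * countAbove P.groups P.groupSize (pairSeq P.mean (σ.fn P) a r P.sample)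
    (12 * (P.gam * P.gam) * P.groupSize)

/-- With accuracy γ, the threshold `v + 3γ` accepts every coefficient above `v + 4γ`, and acceptance
guarantees more than `v + 2γ`. The margin 2γ leaves γ after the error of the given value `v` is
taken into account. `LowTest` is the mirror image. -/
def HighTest (P : SearchParams n) (σ : SearchState n) (a : Finset (Fin n)) (v : ℝ) : Prop :=
  P.groups < 2 * countAbove P.groups P.groupSize (singleSeq P.mean (σ.fn P) a P.sample)
    ((v + 3 * P.gam) * P.groupSize)

def LowTest (P : SearchParams n) (σ : SearchState n) (a : Finset (Fin n)) (v : ℝ) : Prop :=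
  P.groups < 2 * countAbove P.groups P.groupSize (-singleSeq P.mean (σ.fn P) a P.sample)
    (-((v - 3 * P.gam) * P.groupSize))

/-- Append `(a, r)` to the queue if it passes the test. -/
noncomputable def push (P : SearchParams n) (σ : SearchState n) (a : Finset (Fin n)) (r : ℕ) :
    SearchState n :=
  open Classical in
  if σ.PairTest P a r ∧ σ.tail < P.maxTail then
    { σ with tail := σ.tail + 1, queue := Function.update σ.queue σ.tail (a, r) } else σ

/-- Append a signed index and start the search again. -/
def addTerm (P : SearchParams n) (σ : SearchState n) (a : Finset (Fin n)) (b : Bool) :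
    SearchState n :=
  { count := σ.count + 1, terms := Function.update σ.terms σ.count (a, b), head := 0,
    tail := P.len + 1, queue := σ.queue }

def advance (σ : SearchState n) : SearchState n := { σ with head := σ.head + 1 }

/-- A coefficient that is too high is corrected by a term of sign -1 (`false`), one that is too low
by a term of sign +1 (`true`). -/
noncomputable def stepLeaf (P : SearchParams n) (σ : SearchState n) : SearchState n :=
  let a := (σ.queue σ.head).1
  let v := lookupVal σ.queue P.coeff a P.len
  open Classical in
  if a.card ≤ P.deg ∧ σ.HighTest P a v then σ.addTerm P a false
  else if a.card ≤ P.deg ∧ σ.LowTest P a v then σ.addTerm P a true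
  else σ.advance

noncomputable def pushChild (P : SearchParams n) (b : Bool) (σ : SearchState n) : SearchState n :=
  σ.push P (setBit b (σ.queue σ.head).1 ((σ.queue σ.head).2 - 1)) ((σ.queue σ.head).2 - 1)

noncomputable def stepInner (P : SearchParams n) (σ : SearchState n) : SearchState n :=
  ((σ.pushChild P true).pushChild P false).advance

noncomputable def step (P : SearchParams n) (σ : SearchState n) : SearchState n :=
  if 0 < (σ.queue σ.head).2 then σ.stepInner P else σ.stepLeaf P

/-- The memory holds the parameters and the state. -/
structure Holds (P : SearchParams n) (σ : SearchState n) (m : Mem) : Prop where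
  test : m.HasTest P.gam P.mean σ.count σ.terms P.groupSize P.groups P.sample
  deg : m.nat 0 0 1 = P.deg
  len : m.nat 0 0 2 = P.len
  maxCount : m.nat 2 0 0 = P.maxCount
  maxTail : m.nat 9 0 0 = P.maxTail
  coeff : ∀ j < P.len, m.real 2 0 j = P.coeff j
  head : m.nat 11 0 0 = σ.head
  tail : m.nat 12 0 0 = σ.tail
  row : ∀ i < σ.tail, m.rowSet n 1 i = (σ.queue i).1
  rem : ∀ i < σ.tail, m.nat 14 0 i = (σ.queue i).2
  le_tail : P.len + 1 ≤ σ.tail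

theorem Holds.congr {P : SearchParams n} {σ : SearchState n} {m m' : Mem} (h : σ.Holds P m)
    {A B : List ℕ} (hE : m.EqOff A B m') (hA : ∀ a ∈ [0, 1, 2, 3, 4, 9, 11, 12, 13, 14, 15], a ∉ A)
    (hB : ∀ b ∈ [0, 1, 2, 5, 6], b ∉ B) : σ.Holds P m' where
  test := h.test.congr hE (fun a ha => hA a (by revert a; decide))
    (fun a ha => hB a (by revert a; decide))
  deg := by rw [hE.nat 0 (hA _ (by simp)), h.deg]
  len := by rw [hE.nat 0 (hA _ (by simp)), h.len]
  maxCount := by rw [hE.nat 2 (hA _ (by simp)), h.maxCount]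
  maxTail := by rw [hE.nat 9 (hA _ (by simp)), h.maxTail]
  coeff := fun j hj => by rw [hE.real 2 (hB _ (by simp)), h.coeff j hj]
  head := by rw [hE.nat 11 (hA _ (by simp)), h.head]
  tail := by rw [hE.nat 12 (hA _ (by simp)), h.tail]
  row := fun i hi => by
    rw [← h.row i hi]; exact Mem.rowSet_congr fun j _ => by rw [hE.nat 1 (hA _ (by simp))]
  rem := fun i hi => by rw [hE.nat 14 (hA _ (by simp)), h.rem i hi]
  le_tail := h.le_tail

end SearchState

/-! ### Programs that process one item of the queue -/

/-- Write a child of the first unprocessed item behind the queue, test it, and append it if it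
passes. -/
def childProg (b : ℕ) : Prog :=
  .seq (.assignNat 31 (.var 12))
    (.seq (.assignNat 30 (.sub (.cell 14 (.lit 0) (.var 11)) (.lit 1)))
      (.seq (.forLoop 28 (.var 0)
          (.ite (.conj (.neg (.ltNat (.var 28) (.var 30))) (.neg (.ltNat (.var 30) (.var 28))))
            (.setNat 1 (.var 12) (.var 28) (.lit b))
            (.setNat 1 (.var 12) (.var 28) (.cell 1 (.var 11) (.var 28)))))
        (.seq testProg
          (.ite (.conj (.ltNat (.var 4) (.add (.var 22) (.var 22))) (.ltNat (.var 12) (.var 9)))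
            (.seq (.setNat 14 (.lit 0) (.var 12) (.var 30)) (.incr 12)) .skip))))

def childTime (n c M R : ℕ) : ℕ := n * 5 + testTime n c M R + 20

-- The candidate is written to row `tail` before it is tested. A rejected candidate may stay there,
-- because `Holds` constrains only the rows below `tail`.
open SearchState in
theorem runs_childProg {n : ℕ} {P : SearchParams n} {σ : SearchState n} {m : Mem}
    (h : σ.Holds P m) (hlt : σ.head < σ.tail) (b : Bool) :
    Runs (childProg b.toNat) m (childTime n σ.count P.groupSize P.groups)
      fun m' => (σ.pushChild P b).Holds P m' := by
  classical
  set a := (σ.queue σ.head).1 with ha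
  set r := (σ.queue σ.head).2 - 1 with hr
  have hrow := h.row _ hlt
  have hrem := h.rem _ hlt
  apply Runs.of_le
  · apply Runs.setNat_seq (v := σ.tail) (by simp [NatExpr.eval, h.tail])
    apply Runs.setNat_seq (v := r) (by simp [NatExpr.eval, h.head, hrem, hr])
    simp only [NatExpr.eval]
    set m₁ := Mem.setNat _ 30 0 0 _ with hm₁
    have hE₁ : m.EqOff [28, 30, 31] [] m₁ :=
      ((Mem.EqOff.refl _ _ m).setNat (by simp) _ _ _).setNat (by simp) _ _ _
    have h31 : m₁.nat 31 0 0 = σ.tail := by simp [hm₁]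
    have h30 : m₁.nat 30 0 0 = r := by simp [hm₁]
    clear_value m₁
    have h₁ := h.congr hE₁ (by decide) (by decide)
    apply Runs.seq (Runs.forLoop (v := 28) (N := n) (m := m₁) (t := 2)
      (A := [1, 28]) (A' := [1]) (B := [])
      (fun k m' => (∀ i, i ≠ σ.tail → m'.nat 1 i = m₁.nat 1 i) ∧
        ∀ j < k, m'.nat 1 σ.tail j = if j = r then b.toNat else m₁.nat 1 σ.head j)
      (by simp) (by simp) (by simp)
      (fun m' hE => by simp [NatExpr.eval, hE.nat 0, h₁.test.params.dim])
      (by simp) (fun k hk m' hE hk' hJ => by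
        have e30 : m'.nat 30 0 0 = r := by rw [hE.nat 30 (by simp), h30]
        have e12 : m'.nat 12 0 0 = σ.tail := by rw [hE.nat 12 (by simp), h₁.tail]
        have e11 : m'.nat 11 0 0 = σ.head := by rw [hE.nat 11 (by simp), h₁.head]
        refine Runs.ite (fun hb => Runs.setNat ?_) (fun hb => Runs.setNat ?_)
        all_goals
          simp only [Test.Holds, NatExpr.eval, hk', e30, not_lt, e12] at hb ⊢
          refine ⟨(Mem.EqOff.refl _ _ _).setNat (by simp) _ _ _, fun i hi => ?_, fun j hj => ?_⟩
          · funext j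
            rw [Mem.setNat_nat_of_ne (by simp), Mem.setNat_nat, if_neg (by simp [hi]), hJ.1 i hi]
          · rw [Mem.setNat_nat_of_ne (by simp), Mem.setNat_nat]
            rcases Nat.lt_succ_iff_lt_or_eq.1 hj with hj | rfl
            · rw [if_neg (by omega), hJ.2 j hj]
            · first
              | rw [if_pos ⟨rfl, rfl, rfl⟩, if_pos (by omega)]
              | rw [if_pos ⟨rfl, rfl, rfl⟩, if_neg (by omega), e11, hJ.1 _ (by omega)]))
    rintro m₂ ⟨hE₂, hold, hnew⟩
    have hE₂' : m₁.EqOff [1, 28] [] m₂ := hE₂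
    have e14 := hE₂.nat 14 (by simp)
    have h₂ : σ.Holds P m₂ :=
      { test := h₁.test.congr hE₂ (by decide) (by decide)
        deg := by rw [hE₂.nat 0 (by simp), h₁.deg]
        len := by rw [hE₂.nat 0 (by simp), h₁.len]
        maxCount := by rw [hE₂.nat 2 (by simp), h₁.maxCount]
        maxTail := by rw [hE₂.nat 9 (by simp), h₁.maxTail]
        coeff := fun j hj => by rw [hE₂.real 2 (by simp), h₁.coeff j hj]
        head := by rw [hE₂.nat 11 (by simp), h₁.head]
        tail := by rw [hE₂.nat 12 (by simp), h₁.tail]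
        row := fun i hi => by
          rw [← h₁.row i hi]; exact Mem.rowSet_congr fun j _ => by rw [hold i (by omega)]
        rem := fun i hi => by rw [e14, h₁.rem i hi]
        le_tail := h.le_tail }
    have hchild : m₂.rowSet n 1 σ.tail = setBit b a r := by
      ext j
      rw [Mem.mem_rowSet, hnew j j.2]
      simp only [setBit, Finset.mem_filter, Finset.mem_univ, true_and]
      split_ifs with hj
      · cases b <;> simp
      · rw [ha, ← h₁.row _ hlt, Mem.mem_rowSet]
    apply Runs.seq (runs_testProg h₂.test (g := σ.fn P) rfl (a := setBit b a r) (r := r) (v := _)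
      (by rw [hE₂.nat 31 (by simp), h31, hchild]) (by rw [hE₂.nat 30 (by simp), h30]) rfl)
    rintro m₃ ⟨hE₃, h22, -, -⟩
    have h₃ := h₂.congr hE₃ (by decide) (by decide)
    have e22 : m₃.nat 4 0 0 < m₃.nat 22 0 0 + m₃.nat 22 0 0 ↔ σ.PairTest P (setBit b a r) r := by
      rw [h22, h₃.test.groups, PairTest, two_mul]
    have e30 : m₃.nat 30 0 0 = r := by rw [hE₃.nat 30 (by simp), hE₂.nat 30 (by simp), h30]
    have hchild₃ : m₃.rowSet n 1 σ.tail = setBit b a r := by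
      rw [← hchild]; exact Mem.rowSet_congr fun j _ => by rw [hE₃.nat 1 (by simp)]
    refine Runs.ite_add (t₁ := 3) (t₂ := 1) (fun hb => ?_) (fun hb => Runs.skip ?_)
    all_goals simp only [Test.Holds, NatExpr.eval, e22, h₃.tail, h₃.maxTail] at hb
    · refine Runs.setNat_seq (v := r) e30 (Runs.setNat ?_)
      simp only [NatExpr.eval, h₃.tail]
      rw [pushChild, push, if_pos hb]
      have hE₄ := ((Mem.EqOff.refl [14, 12] [] m₃).setNat (a := 14) (by simp) 0 σ.tail r).setNat
        (a := 12) (by simp) 0 0 ((m₃.setNat 14 0 σ.tail r).nat 12 0 0 + 1)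
      exact
      { test := h₃.test.congr hE₄ (by decide) (by decide)
        deg := by rw [hE₄.nat 0 (by simp), h₃.deg]
        len := by rw [hE₄.nat 0 (by simp), h₃.len]
        maxCount := by rw [hE₄.nat 2 (by simp), h₃.maxCount]
        maxTail := by rw [hE₄.nat 9 (by simp), h₃.maxTail]
        coeff := fun j hj => by rw [hE₄.real 2 (by simp), h₃.coeff j hj]
        head := by rw [hE₄.nat 11 (by simp), h₃.head]
        tail := by simp [h₃.tail]
        row := fun i hi => by
          rw [Mem.rowSet_congr (m := m₃) (arr := 1) (i := i) fun j _ => by rw [hE₄.nat 1 (by simp)]]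
          simp only [Function.update_apply]
          split_ifs with hi'
          · rw [hi', hchild₃]
          · rw [h₃.row i (by simp at hi; omega)]
        rem := fun i hi => by
          rw [Mem.setNat_nat_of_ne (by simp), Mem.setNat_nat]
          simp only [Function.update_apply, true_and]
          split_ifs with hi'
          · rfl
          · rw [h₃.rem i (by simp at hi; omega)]
        le_tail := by have := h.le_tail; simp only; omega }
    · rw [pushChild, push, if_neg hb]
      exact h₃
  · simp only [childTime]; omega

/-- Copy the listed coefficient of the first unprocessed item to real variable `12`, and its degree
to natural variable `29`. -/
def lookupProg : Prog :=
  .seq (.assignReal 12 (.num 0)) (.seq (.assignNat 29 (.lit 0))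
    (.seq (.forLoop 28 (.var 0)
        (.ite (.ltNat (.lit 0) (.cell 1 (.var 11) (.var 28))) (.incr 29) .skip))
      (.forLoop 27 (.cell 0 (.lit 0) (.lit 2))
        (.seq (.assignNat 26 (.lit 0))
          (.seq (.forLoop 28 (.var 0)
              (.ite (.ltNat (.lit 0) (.cell 1 (.var 11) (.var 28)))
                (.ite (.ltNat (.lit 0) (.cell 1 (.var 27) (.var 28))) .skip
                  (.assignNat 26 (.lit 1)))
                (.ite (.ltNat (.lit 0) (.cell 1 (.var 27) (.var 28)))
                  (.assignNat 26 (.lit 1)) .skip)))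
            (.ite (.ltNat (.var 26) (.lit 1)) (.assignReal 12 (.cell 2 (.lit 0) (.var 27)))
              .skip))))))

def lookupTime (n s : ℕ) : ℕ := n * 6 + 3 + (s * (n * 6 + 9 + 3) + 3) + 5

open SearchState in
theorem runs_lookupProg {n : ℕ} {P : SearchParams n} {σ : SearchState n} {m : Mem}
    (h : σ.Holds P m) (hlt : σ.head < σ.tail) :
    Runs lookupProg m (lookupTime n P.len) fun m' => m.EqOff [26, 27, 28, 29] [12] m' ∧
      m'.nat 29 0 0 = (σ.queue σ.head).1.card ∧
      m'.real 12 0 0 = lookupVal σ.queue P.coeff (σ.queue σ.head).1 P.len := by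
  classical
  set a := (σ.queue σ.head).1 with ha
  have hmem : ∀ j : Fin n, 0 < m.nat 1 σ.head j ↔ j ∈ a := fun j => by
    rw [ha, ← h.row _ hlt, Mem.mem_rowSet]
  apply Runs.of_le
  · apply Runs.setReal_seq (v := 0) (by simp [RealExpr.eval, NatExpr.eval])
    apply Runs.setNat_seq (v := 0) rfl
    simp only [NatExpr.eval]
    set m₁ := Mem.setNat _ 29 0 0 _ with hm₁
    have hE₁ : m.EqOff [26, 27, 28, 29] [12] m₁ :=
      ((Mem.EqOff.refl _ _ m).setReal (by simp) _ _ _).setNat (by simp) _ _ _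
    have h29 : m₁.nat 29 0 0 = 0 := by simp [hm₁]
    have h12 : m₁.real 12 0 0 = 0 := by simp [hm₁]
    clear_value m₁
    have h₁ := h.congr hE₁ (by decide) (by decide)
    apply Runs.seq (Runs.forLoop (v := 28) (N := n) (m := m₁) (t := 1 + 1 + 1)
      (A := [28, 29]) (A' := [29]) (B := [])
      (fun k m' => m'.nat 29 0 0 = ∑ j ∈ Finset.range k, if 0 < m₁.nat 1 σ.head j then 1 else 0)
      (by simp) (by simp) (by simp)
      (fun m' hE => by simp [NatExpr.eval, hE.nat 0, h₁.test.params.dim])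
      (by simp [h29]) (fun k hk m' hE hk' hJ => by
        have e11 : m'.nat 11 0 0 = σ.head := by rw [hE.nat 11 (by simp), h₁.head]
        refine (runs_ite_incr hJ (P := 0 < m₁.nat 1 σ.head k) ?_).imp fun m'' h'' => ⟨h''.1, ?_⟩
        · simp [Test.Holds, NatExpr.eval, e11, hk', hE.nat 1]
        · rw [Mem.setNat_nat_of_ne (by simp), h''.2, Finset.sum_range_succ]))
    rintro m₂ ⟨hE₂, h29⟩
    have h₂ := h₁.congr hE₂ (by decide) (by decide)
    have hcard : m₂.nat 29 0 0 = a.card := by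
      rw [h29, Finset.sum_range, ← Finset.card_filter]
      congr 1
      ext j
      simp only [Finset.mem_filter, Finset.mem_univ, true_and, ← hmem j, hE₁.nat 1 (by simp)]
    have e12 : m₂.real 12 0 0 = 0 := by rw [hE₂.real 12 (by simp), h12]
    refine (Runs.forLoop (v := 27) (N := P.len) (m := m₂)
      (t := n * 6 + 9)
      (A := [26, 27, 28]) (A' := [26, 28]) (B := [12])
      (fun s m' => m'.real 12 0 0 = lookupVal σ.queue P.coeff a s)
      (by simp) (by simp) (by simp)
      (fun m' hE => by simp [NatExpr.eval, hE.nat 0, h₂.len])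
      (by simp [e12, lookupVal]) (fun s hs m' hE hs' hJ => ?_)).imp fun m' h' =>
        ⟨((hE₁.trans (hE₂.mono (by simp) (by simp))).trans (h'.1.mono (by simp) (by simp))),
          by rw [h'.1.nat 29 (by simp), hcard], h'.2⟩
    have h' := h₂.congr hE (by decide) (by decide)
    have hs_lt : s < σ.tail := by have := h.le_tail; omega
    have hsmem : ∀ j : Fin n, 0 < m'.nat 1 s j ↔ j ∈ (σ.queue s).1 := fun j => by
      rw [← h'.row _ hs_lt, Mem.mem_rowSet]
    have hmem' : ∀ j : Fin n, 0 < m'.nat 1 σ.head j ↔ j ∈ a := fun j => by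
      rw [ha, ← h'.row _ hlt, Mem.mem_rowSet]
    apply Runs.of_le
    · apply Runs.setNat_seq (v := 0) rfl
      simp only [NatExpr.eval]
      set m₃ := Mem.setNat _ 26 0 0 _ with hm₃
      have hE₃' : m'.EqOff [26] [] m₃ := (Mem.EqOff.refl _ _ _).setNat (by simp) _ _ _
      have hE₃ : m'.EqOff [26, 28] [12] m₃ := hE₃'.mono (by simp) (by simp)
      have h26 : m₃.nat 26 0 0 = 0 := by simp [hm₃]
      clear_value m₃
      apply Runs.seq (Runs.forLoop (v := 28) (N := n) (m := m₃) (t := 3)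
        (A := [26, 28]) (A' := [26]) (B := [])
        -- Natural variable `26` is a mismatch flag: it stays 0 as long as the two rows agree on the
        -- coordinates compared so far.
        (fun k m₄ => m₄.nat 26 0 0 < 1 ↔
          ∀ j < k, (0 < m'.nat 1 σ.head j ↔ 0 < m'.nat 1 s j))
        (by simp) (by simp) (by simp)
        (fun m₄ hE₄ => by simp [NatExpr.eval, hE₄.nat 0, hE₃.nat 0, h'.test.params.dim])
        (by simp [h26]) (fun k hk m₄ hE₄ hk' hJ₄ => ?_))
      · rintro m₅ ⟨hE₅, h26⟩
        have hE₅' : m'.EqOff [26, 28] [12] m₅ := hE₃.trans (hE₅.mono (by simp) (by simp))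
        have hiff : m₅.nat 26 0 0 < 1 ↔ (σ.queue s).1 = a := by
          rw [h26, Finset.ext_iff]
          refine ⟨fun H j => by rw [← hsmem, ← hmem', H j j.2], fun H j hj => ?_⟩
          rw [hmem' ⟨j, hj⟩, hsmem ⟨j, hj⟩, H]
        refine Runs.ite_add (fun hb => Runs.setReal ?_) (fun hb => Runs.skip ?_)
        all_goals simp only [Test.Holds, NatExpr.eval, hiff] at hb
        · refine ⟨hE₅'.setReal (by simp) _ _ _, ?_⟩
          simp [RealExpr.eval, NatExpr.eval, lookupVal, hb, hE₅'.real 2, hE₅'.nat 27, hs',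
            h'.coeff s hs]
        · refine ⟨hE₅', ?_⟩
          simp only [Mem.setNat_real]
          rw [hE₅.real 12 (by simp), hE₃'.real 12 (by simp), hJ, lookupVal, if_neg hb]
      · have hE₄' : m'.EqOff [26, 28] [12] m₄ := hE₃.trans (hE₄.mono (by simp) (by simp))
        have e11 : m₄.nat 11 0 0 = σ.head := by rw [hE₄'.nat 11 (by simp), h'.head]
        have e27 : m₄.nat 27 0 0 = s := by rw [hE₄'.nat 27 (by simp), hs']
        refine Runs.ite (t := 2) (fun hb => Runs.ite (fun hb' => ?_) (fun hb' => ?_))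
          (fun hb => Runs.ite (fun hb' => ?_) (fun hb' => ?_))
        all_goals
          simp only [Test.Holds, NatExpr.eval, e11, e27, hk', hE₄'.nat 1 (by simp)] at hb hb'
        · refine Runs.skip ⟨Mem.EqOff.refl _ _ _, ?_⟩
          rw [Mem.setNat_nat_of_ne (by simp), hJ₄, Nat.forall_lt_succ_right]
          exact (and_iff_left (iff_of_true hb hb')).symm
        · refine Runs.setNat ⟨(Mem.EqOff.refl _ _ _).setNat (by simp) _ _ _, ?_⟩
          rw [Mem.setNat_nat_of_ne (by simp)]
          simp only [NatExpr.eval, Mem.setNat_nat_self, lt_irrefl, false_iff]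
          exact fun H => hb' ((H k k.lt_succ_self).1 hb)
        · refine Runs.setNat ⟨(Mem.EqOff.refl _ _ _).setNat (by simp) _ _ _, ?_⟩
          rw [Mem.setNat_nat_of_ne (by simp)]
          simp only [NatExpr.eval, Mem.setNat_nat_self, lt_irrefl, false_iff]
          exact fun H => hb ((H k k.lt_succ_self).2 hb')
        · refine Runs.skip ⟨Mem.EqOff.refl _ _ _, ?_⟩
          rw [Mem.setNat_nat_of_ne (by simp), hJ₄, Nat.forall_lt_succ_right]
          exact (and_iff_left (iff_of_false hb hb')).symm
    · omega
  · simp only [lookupTime]; omega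

/-- Append the first unprocessed item to the signed indices and start the search again. -/
def addProg (sgn : RealExpr) : Prog :=
  .seq (.forLoop 28 (.var 0) (.setNat 15 (.var 13) (.var 28) (.cell 1 (.var 11) (.var 28))))
    (.seq (.setReal 6 (.lit 0) (.var 13) sgn)
      (.seq (.incr 13) (.seq (.assignNat 11 (.lit 0))
        (.assignNat 12 (.add (.cell 0 (.lit 0) (.lit 2)) (.lit 1))))))

open SearchState in
theorem runs_addProg {n : ℕ} {P : SearchParams n} {σ : SearchState n} {m : Mem}
    (h : σ.Holds P m) (hlt : σ.head < σ.tail) {e : RealExpr} {b : Bool}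
    (he : ∀ m, e.eval m = boolSign b) :
    Runs (addProg e) m (n * 4 + 11)
      fun m' => (σ.addTerm P (σ.queue σ.head).1 b).Holds P m' := by
  apply Runs.of_le
  · apply Runs.seq (Runs.forLoop (v := 28) (N := n) (m := m) (t := 1)
      (A := [15, 28]) (A' := [15]) (B := [])
      (fun k m' => (∀ i, i ≠ σ.count → m'.nat 15 i = m.nat 15 i) ∧
        ∀ j < k, m'.nat 15 σ.count j = m.nat 1 σ.head j)
      (by simp) (by simp) (by simp)
      (fun m' hE => by simp [NatExpr.eval, hE.nat 0, h.test.params.dim])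
      (by simp) (fun k hk m' hE hk' hJ => by
        have e13 : m'.nat 13 0 0 = σ.count := by rw [hE.nat 13 (by simp), h.test.sum.count]
        have e11 : m'.nat 11 0 0 = σ.head := by rw [hE.nat 11 (by simp), h.head]
        refine Runs.setNat ?_
        simp only [NatExpr.eval, hk', e13, e11]
        refine ⟨(Mem.EqOff.refl _ _ _).setNat (by simp) _ _ _, fun i hi => ?_, fun j hj => ?_⟩
        · funext j
          rw [Mem.setNat_nat_of_ne (by simp), Mem.setNat_nat, if_neg (by simp [hi]), hJ.1 i hi]
        · rw [Mem.setNat_nat_of_ne (by simp), Mem.setNat_nat]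
          rcases Nat.lt_succ_iff_lt_or_eq.1 hj with hj | rfl
          · rw [if_neg (by omega), hJ.2 j hj]
          · rw [if_pos ⟨rfl, rfl, rfl⟩, hE.nat 1 (by simp)]))
    rintro m₁ ⟨hE₁, hold, hnew⟩
    have e13 : m₁.nat 13 0 0 = σ.count := by rw [hE₁.nat 13 (by simp), h.test.sum.count]
    have elen : m₁.nat 0 0 2 = P.len := by rw [hE₁.nat 0 (by simp), h.len]
    apply Runs.setReal_seq (he _)
    apply Runs.setNat_seq (v := σ.count + 1) (by simp [NatExpr.eval, e13])
    apply Runs.setNat_seq (v := 0) rfl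
    apply Runs.setNat
    simp only [NatExpr.eval, e13]
    set m₂ := Mem.setNat _ 12 0 0 _ with hm₂
    have hE₂ : m₁.EqOff [13, 11, 12] [6] m₂ :=
      ((((Mem.EqOff.refl _ _ _).setReal (by simp) _ _ _).setNat (by simp) _ _ _).setNat
        (by simp) _ _ _).setNat (by simp) _ _ _
    have hE : m.EqOff [11, 12, 13, 15, 28] [6] m₂ :=
      (hE₁.mono (by simp) (by simp)).trans (hE₂.mono (by simp) (by simp))
    have h15 : m₂.nat 15 = m₁.nat 15 := hE₂.nat 15 (by simp)
    have h6 : ∀ i, m₂.real 6 0 i = if i = σ.count then boolSign b else m₁.real 6 0 i := fun i => by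
      simp [hm₂, Mem.setReal_real]
    have h11 : m₂.nat 11 0 0 = 0 := by simp [hm₂]
    have h12 : m₂.nat 12 0 0 = P.len + 1 := by simp [hm₂, elen]
    have h13 : m₂.nat 13 0 0 = σ.count + 1 := by simp [hm₂]
    clear_value m₂
    have hle := h.le_tail
    exact
    { test :=
      { params := h.test.params.congr hE (by simp) (by simp)
        size := by rw [hE.nat 3 (by simp), h.test.size]
        groups := by rw [hE.nat 4 (by simp), h.test.groups]
        samples := fun i hi j => by rw [hE.real 5 (by simp), h.test.samples i hi j]
        sum :=
        { count := h13
          row := fun t ht => by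
            simp only [addTerm, Function.update_apply]
            split_ifs with ht'
            · rw [ht', ← h.row _ hlt]
              exact Mem.rowSet_congr fun j hj => by rw [h15, hnew j hj]
            · rw [← h.test.sum.row t (by simp [addTerm] at ht; omega)]
              exact Mem.rowSet_congr fun j hj => by rw [h15, hold t ht']
          sign := fun t ht => by
            rw [h6]
            simp only [addTerm, Function.update_apply]
            split_ifs with ht'
            · rfl
            · rw [hE₁.real 6 (by simp), h.test.sum.sign t (by simp [addTerm] at ht; omega)] } }
      deg := by rw [hE.nat 0 (by simp), h.deg]
      len := by rw [hE.nat 0 (by simp), h.len]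
      maxCount := by rw [hE.nat 2 (by simp), h.maxCount]
      maxTail := by rw [hE.nat 9 (by simp), h.maxTail]
      coeff := fun j hj => by rw [hE.real 2 (by simp), h.coeff j hj]
      head := h11
      tail := h12
      row := fun i hi => by
        rw [addTerm, ← h.row i (by simp [addTerm] at hi; omega)]
        exact Mem.rowSet_congr fun j _ => by rw [hE.nat 1 (by simp)]
      rem := fun i hi => by
        rw [hE.nat 14 (by simp), h.rem i (by simp [addTerm] at hi; omega), addTerm]
      le_tail := le_rfl }
  · omega

/-- Process an item with no undecided coordinates. -/
def leafProg : Prog :=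
  .seq lookupProg (.seq (.assignNat 31 (.var 11)) (.seq (.assignNat 30 (.lit 0))
    (.seq testProg
      (.ite (.conj (.neg (.ltNat (.cell 0 (.lit 0) (.lit 1)) (.var 29)))
          (.ltNat (.var 4) (.add (.var 23) (.var 23))))
        (addProg (.sub (.num 0) (.num 1)))
        (.ite (.conj (.neg (.ltNat (.cell 0 (.lit 0) (.lit 1)) (.var 29)))
            (.ltNat (.var 4) (.add (.var 24) (.var 24))))
          (addProg (.num 1)) (.incr 11))))))

def leafTime (n s c M R : ℕ) : ℕ := lookupTime n s + testTime n c M R + 8 * n + 32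

open SearchState in
theorem runs_leafProg {n : ℕ} {P : SearchParams n} {σ : SearchState n} {m : Mem}
    (h : σ.Holds P m) (hlt : σ.head < σ.tail) :
    Runs leafProg m (leafTime n P.len σ.count P.groupSize P.groups)
      fun m' => (σ.stepLeaf P).Holds P m' := by
  classical
  apply Runs.of_le
  · apply Runs.seq (runs_lookupProg h hlt)
    rintro m₁ ⟨hE₁, h29, h12⟩
    have h₁ := h.congr hE₁ (by decide) (by decide)
    apply Runs.setNat_seq (v := σ.head) (by simp [NatExpr.eval, h₁.head])
    -- The value 0 for the split position is arbitrary: it affects only the pair counter, which a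
    -- leaf ignores.
    apply Runs.setNat_seq (v := 0) rfl
    simp only [NatExpr.eval]
    set m₂ := Mem.setNat _ 30 0 0 _ with hm₂
    have hE₂ : m₁.EqOff [30, 31] [] m₂ :=
      ((Mem.EqOff.refl _ _ _).setNat (by simp) _ _ _).setNat (by simp) _ _ _
    have h30 : m₂.nat 30 0 0 = 0 := by simp [hm₂]
    have h31 : m₂.nat 31 0 0 = σ.head := by simp [hm₂]
    clear_value m₂
    have h₂ := h₁.congr hE₂ (by decide) (by decide)
    apply Runs.seq (runs_testProg h₂.test (g := σ.fn P) rfl (a := (σ.queue σ.head).1) (r := 0)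
      (v := lookupVal σ.queue P.coeff (σ.queue σ.head).1 P.len)
      (by rw [h31, h₂.row _ hlt]) h30 (by rw [hE₂.real 12 (by simp), h12]))
    rintro m₃ ⟨hE₃, -, h23, h24⟩
    have h₃ := h₂.congr hE₃ (by decide) (by decide)
    have e29 : m₃.nat 29 0 0 = (σ.queue σ.head).1.card := by
      rw [hE₃.nat 29 (by simp), hE₂.nat 29 (by simp), h29]
    have hH : Test.Holds m₃ (.conj (.neg (.ltNat (.cell 0 (.lit 0) (.lit 1)) (.var 29)))
        (.ltNat (.var 4) (.add (.var 23) (.var 23)))) ↔ (σ.queue σ.head).1.card ≤ P.deg ∧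
        σ.HighTest P (σ.queue σ.head).1
          (lookupVal σ.queue P.coeff (σ.queue σ.head).1 P.len) := by
      simp only [Test.Holds, NatExpr.eval, not_lt, h₃.deg, e29, h23, h₃.test.groups, HighTest,
        two_mul]
    have hL : Test.Holds m₃ (.conj (.neg (.ltNat (.cell 0 (.lit 0) (.lit 1)) (.var 29)))
        (.ltNat (.var 4) (.add (.var 24) (.var 24)))) ↔ (σ.queue σ.head).1.card ≤ P.deg ∧
        σ.LowTest P (σ.queue σ.head).1
          (lookupVal σ.queue P.coeff (σ.queue σ.head).1 P.len) := by
      simp only [Test.Holds, NatExpr.eval, not_lt, h₃.deg, e29, h24, h₃.test.groups, LowTest,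
        two_mul]
    rw [stepLeaf]
    refine Runs.ite_add (t₁ := n * 4 + 11) (t₂ := n * 4 + 11 + 1 + 1) (fun hb => ?_)
      (fun hb => Runs.ite_add (t₁ := n * 4 + 11) (t₂ := 1) (fun hb' => ?_) fun hb' => ?_)
    · rw [if_pos (hH.1 hb)]
      exact runs_addProg h₃ hlt fun m => by simp [RealExpr.eval, NatExpr.eval, boolSign]
    · rw [if_neg (mt hH.2 hb), if_pos (hL.1 hb')]
      exact runs_addProg h₃ hlt fun m => by simp [RealExpr.eval, NatExpr.eval, boolSign]
    · rw [if_neg (mt hH.2 hb), if_neg (mt hL.2 hb')]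
      refine Runs.setNat ?_
      have hE₄ := (Mem.EqOff.refl [11] [] m₃).setNat (a := 11) (by simp) 0 0 (σ.head + 1)
      simp only [NatExpr.eval, h₃.head]
      exact
      { test := h₃.test.congr hE₄ (by decide) (by decide)
        deg := h₃.deg
        len := h₃.len
        maxCount := h₃.maxCount
        maxTail := h₃.maxTail
        coeff := h₃.coeff
        head := by simp [advance]
        tail := h₃.tail
        row := h₃.row
        rem := h₃.rem
        le_tail := h₃.le_tail }
  · simp only [leafTime]; omega

/-- Process an item with undecided coordinates. -/
def innerProg : Prog := .seq (childProg 1) (.seq (childProg 0) (.incr 11))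

/-! ### Termination of the search -/

namespace SearchState

variable {n : ℕ}

theorem push_head (P : SearchParams n) (σ : SearchState n) (a : Finset (Fin n)) (r : ℕ) :
    (σ.push P a r).head = σ.head := by unfold push; split_ifs <;> rfl

theorem push_count (P : SearchParams n) (σ : SearchState n) (a : Finset (Fin n)) (r : ℕ) :
    (σ.push P a r).count = σ.count := by unfold push; split_ifs <;> rfl

theorem le_push_tail (P : SearchParams n) (σ : SearchState n) (a : Finset (Fin n)) (r : ℕ) :
    σ.tail ≤ (σ.push P a r).tail := by unfold push; split_ifs <;> simp

theorem push_tail_le {P : SearchParams n} {σ : SearchState n} (h : σ.tail ≤ P.maxTail)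
    (a : Finset (Fin n)) (r : ℕ) : (σ.push P a r).tail ≤ P.maxTail := by
  unfold push
  split_ifs with h'
  exacts [h'.2, h]

theorem push_queue_of_lt (P : SearchParams n) {σ : SearchState n} (a : Finset (Fin n)) (r : ℕ)
    {i : ℕ} (h : i < σ.tail) : (σ.push P a r).queue i = σ.queue i := by
  unfold push; split_ifs
  · simp [Function.update_of_ne h.ne]
  · rfl

/-- The condition under which the search goes on. -/
def Active (P : SearchParams n) (σ : SearchState n) : Prop :=
  σ.head < σ.tail ∧ σ.count < P.maxCount

def Reaches (P : SearchParams n) : SearchState n → SearchState n → Prop :=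
  Relation.ReflTransGen fun σ σ' => σ.Active P ∧ σ' = σ.step P

/-- A bound for the number of steps from `σ` on. -/
def fuel (P : SearchParams n) (σ : SearchState n) : ℕ :=
  (P.maxCount - σ.count) * (P.maxTail + 1) + (P.maxTail - σ.head)

theorem step_tail_le {P : SearchParams n} {σ : SearchState n} (h : σ.tail ≤ P.maxTail)
    (hP : P.len + 1 ≤ P.maxTail) : (σ.step P).tail ≤ P.maxTail := by
  unfold step
  split_ifs
  · exact push_tail_le (push_tail_le h _ _) _ _
  · simp only [stepLeaf]
    split_ifs
    exacts [hP, hP, h]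

/-- The measure is lexicographic. A new term lowers the first summand by `maxTail + 1`, which
outweighs the reset of `head` to 0; any other step raises `head`, which is still below `maxTail`. -/
theorem fuel_step_lt {P : SearchParams n} {σ : SearchState n} (h : σ.tail ≤ P.maxTail)
    (hσ : σ.Active P) : (σ.step P).fuel P < σ.fuel P := by
  obtain ⟨h1, h2⟩ := hσ
  obtain ⟨k, hk⟩ := Nat.exists_eq_add_of_lt h2
  unfold step
  split_ifs
  · simp only [stepInner, advance, pushChild, fuel, push_head, push_count]
    omega
  · simp only [stepLeaf]
    split_ifs
    · simp only [addTerm, fuel, hk]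
      rw [show σ.count + k + 1 - σ.count = k + 1 by omega,
        show σ.count + k + 1 - (σ.count + 1) = k by omega, add_mul]
      omega
    · simp only [addTerm, fuel, hk]
      rw [show σ.count + k + 1 - σ.count = k + 1 by omega,
        show σ.count + k + 1 - (σ.count + 1) = k by omega, add_mul]
      omega
    · simp only [advance, fuel]
      omega

end SearchState

open SearchState in
theorem runs_innerProg {n : ℕ} {P : SearchParams n} {σ : SearchState n} {m : Mem}
    (h : σ.Holds P m) (hlt : σ.head < σ.tail) :
    Runs innerProg m (2 * childTime n σ.count P.groupSize P.groups + 3)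
      fun m' => (σ.stepInner P).Holds P m' := by
  apply Runs.of_le
  · apply Runs.seq (runs_childProg h hlt true)
    intro m₁ h₁
    have hlt₁ : (σ.pushChild P true).head < (σ.pushChild P true).tail := by
      rw [pushChild, push_head]; exact hlt.trans_le (le_push_tail _ _ _ _)
    apply Runs.seq (runs_childProg h₁ hlt₁ false)
    intro m₂ h₂
    refine Runs.setNat ?_
    simp only [NatExpr.eval, h₂.head]
    have hE := (Mem.EqOff.refl [11] [] m₂).setNat (a := 11) (by simp) 0 0
      (((σ.pushChild P true).pushChild P false).head + 1)
    exact
    { test := h₂.test.congr hE (by decide) (by decide)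
      deg := h₂.deg
      len := h₂.len
      maxCount := h₂.maxCount
      maxTail := h₂.maxTail
      coeff := h₂.coeff
      head := by simp [stepInner, advance]
      tail := h₂.tail
      row := h₂.row
      rem := h₂.rem
      le_tail := h₂.le_tail }
  · rw [show (σ.pushChild P true).count = σ.count from push_count _ _ _ _]
    omega

/-- Process items until there are none left, or there are too many signed indices. -/
def searchProg : Prog :=
  .loop (.conj (.ltNat (.var 11) (.var 12)) (.ltNat (.var 13) (.var 2)))
    (.ite (.ltNat (.lit 0) (.cell 14 (.lit 0) (.var 11))) innerProg leafProg)

def stepTime (n s N M R : ℕ) : ℕ := 2 * childTime n N M R + 3 + leafTime n s N M R + 1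

theorem testTime_mono {n c c' M R : ℕ} (h : c ≤ c') : testTime n c M R ≤ testTime n c' M R := by
  unfold testTime groupTime pairTime
  gcongr

open SearchState in
theorem runs_stepProg {n : ℕ} {P : SearchParams n} {σ : SearchState n} {m : Mem}
    (h : σ.Holds P m) (hσ : σ.Active P) :
    Runs (.ite (.ltNat (.lit 0) (.cell 14 (.lit 0) (.var 11))) innerProg leafProg) m
      (stepTime n P.len P.maxCount P.groupSize P.groups) fun m' => (σ.step P).Holds P m' := by
  have htime := testTime_mono (n := n) (M := P.groupSize) (R := P.groups) hσ.2.le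
  refine (Runs.ite_add (fun hb => ?_) fun hb => ?_)
  all_goals
    simp only [Test.Holds, NatExpr.eval, h.head, h.rem _ hσ.1] at hb
    rw [step]
  · rw [if_pos hb]
    exact (runs_innerProg h hσ.1).of_le (by unfold childTime; omega)
  · rw [if_neg hb]
    exact (runs_leafProg h hσ.1).of_le (by unfold leafTime; omega)

open SearchState in
theorem runs_searchProg {n : ℕ} {P : SearchParams n} {σ : SearchState n} {m : Mem}
    (h : σ.Holds P m) (htail : σ.tail ≤ P.maxTail) (hP : P.len + 1 ≤ P.maxTail) :
    Runs searchProg m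
      (σ.fuel P * (stepTime n P.len P.maxCount P.groupSize P.groups + 1) + 1) fun m' =>
        ∃ σ', σ.Reaches P σ' ∧ ¬ σ'.Active P ∧ σ'.Holds P m' := by
  have hact : ∀ {σ : SearchState n} {m : Mem}, σ.Holds P m → (Test.Holds m
      (.conj (.ltNat (.var 11) (.var 12)) (.ltNat (.var 13) (.var 2))) ↔ σ.Active P) := by
    intro σ m h
    simp only [Test.Holds, NatExpr.eval, h.head, h.tail, h.maxCount, h.test.sum.count, Active]
  refine (Runs.loop (fun k m' => ∃ σ', σ.Reaches P σ' ∧ σ'.Holds P m' ∧ σ'.tail ≤ P.maxTail ∧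
    k = σ'.fuel P) ?_ ⟨σ, .refl, h, htail, rfl⟩).imp ?_
  · rintro k m' ⟨σ', hr, hm', ht, rfl⟩ hb
    rw [hact hm'] at hb
    exact (runs_stepProg hm' hb).imp fun m'' hm'' => ⟨_, fuel_step_lt ht hb, _,
      hr.tail ⟨hb, rfl⟩, hm'', step_tail_le ht hP, rfl⟩
  · rintro m' ⟨hb, k, σ', hr, hm', -, -⟩
    rw [hact hm'] at hb
    exact ⟨σ', hr, hb, hm'⟩

/-! ### Preparation: parameters, coin flips, samples -/

/-- Set `v` to the value of `e`, rounded up. -/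
def ceilProg (v : ℕ) (e : RealExpr) : Prog :=
  .seq (.assignNat v (.lit 0)) (.loop (.ltReal (.ofNat (.var v)) e) (.incr v))

/-- Without a rounding operation the ceiling is found by counting up. The time is linear in the
value, which is affordable for polynomially bounded parameters. -/
theorem runs_ceilProg {v : ℕ} {e : RealExpr} {m : Mem} {x : ℝ}
    (he : ∀ m', m.EqOff [v] [] m' → e.eval m' = x) :
    Runs (ceilProg v e) m (⌈x⌉₊ * 2 + 3) fun m' =>
      m.EqOff [v] [] m' ∧ m'.nat v 0 0 = ⌈x⌉₊ := by
  apply Runs.of_le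
  · apply Runs.setNat_seq (v := 0) rfl
    refine (Runs.loop (t := 1) (k := ⌈x⌉₊)
      (fun k m' => m.EqOff [v] [] m' ∧ ∃ i, k + i = ⌈x⌉₊ ∧ m'.nat v 0 0 = i) ?_ ?_).imp ?_
    · rintro k m' ⟨hE, i, hk, hi⟩ hb
      simp only [Test.Holds, RealExpr.eval, NatExpr.eval, hi, he m' hE] at hb
      have := Nat.lt_ceil.2 hb
      refine Runs.setNat ⟨k - 1, by omega, hE.setNat (by simp) _ _ _, i + 1, by omega, ?_⟩
      simp [NatExpr.eval, hi]
    · exact ⟨(Mem.EqOff.refl _ _ _).setNat (by simp) _ _ _, 0, rfl, by simp [NatExpr.eval]⟩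
    · rintro m' ⟨hb, k, hE, i, hk, hi⟩
      simp only [Test.Holds, RealExpr.eval, NatExpr.eval, hi, he m' hE, not_lt] at hb
      have := Nat.ceil_le.2 hb
      exact ⟨hE, by omega⟩
  · omega

/-- Set natural variable `6` to the binary logarithm of `1/δ`, rounded up. -/
def logProg : Prog :=
  .seq (.assignNat 6 (.lit 0)) (.seq (.assignReal 14 (.cell 0 (.lit 0) (.lit 1)))
    (.loop (.ltReal (.var 14) (.num 1))
      (.seq (.assignReal 14 (.add (.var 14) (.var 14))) (.incr 6))))

/-- The binary logarithm of `1/δ`, rounded up. -/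
noncomputable def logBound (δ : ℝ) : ℕ := ⌈Real.logb 2 (1 / δ)⌉₊

/-- The form in which the machine meets the logarithm: δ is doubled until it reaches 1. For δ ≥ 1 no
doubling takes place. -/
theorem lt_logBound {δ : ℝ} (hδ : 0 < δ) (i : ℕ) : i < logBound δ ↔ 2 ^ i * δ < 1 := by
  rw [logBound, Nat.lt_ceil, Real.lt_logb_iff_rpow_lt (by norm_num) (by positivity),
    Real.rpow_natCast, lt_div_iff₀ hδ]

theorem runs_logProg {m : Mem} {δ : ℝ} (hδ : 0 < δ) (hm : m.real 0 0 1 = δ) :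
    Runs logProg m (logBound δ * 4 + 5) fun m' =>
      m.EqOff [6] [14] m' ∧ m'.nat 6 0 0 = logBound δ := by
  apply Runs.of_le
  · apply Runs.setNat_seq (v := 0) rfl
    apply Runs.setReal_seq (v := δ) (by simp [RealExpr.eval, NatExpr.eval, hm])
    refine (Runs.loop (t := 3) (k := logBound δ)
      (fun k m' => m.EqOff [6] [14] m' ∧ ∃ i, k + i = logBound δ ∧ m'.nat 6 0 0 = i ∧
        m'.real 14 0 0 = 2 ^ i * δ) ?_ ?_).imp ?_
    · rintro k m' ⟨hE, i, hk, hi, hq⟩ hb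
      simp only [Test.Holds, RealExpr.eval, NatExpr.eval, hq, Nat.cast_one] at hb
      have := (lt_logBound hδ i).2 hb
      refine Runs.setReal_seq (v := 2 ^ (i + 1) * δ) ?_ (Runs.setNat ⟨k - 1, by omega,
        (hE.setReal (by simp) _ _ _).setNat (by simp) _ _ _, i + 1, by omega, ?_, ?_⟩)
      · simp only [RealExpr.eval, NatExpr.eval, hq]; ring
      · simp [NatExpr.eval, hi]
      · simp [NatExpr.eval]
    · exact ⟨((Mem.EqOff.refl _ _ _).setNat (by simp) _ _ _).setReal (by simp) _ _ _, 0,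
        by omega, by simp [NatExpr.eval], by simp [NatExpr.eval]⟩
    · rintro m' ⟨hb, k, hE, i, hk, hi, hq⟩
      simp only [Test.Holds, RealExpr.eval, NatExpr.eval, hq, Nat.cast_one, ← lt_logBound hδ] at hb
      exact ⟨hE, by omega⟩
  · omega

/-- The maximal number of signed indices. -/
noncomputable def numTerms (γ : ℝ) : ℕ := ⌈1 / (γ * γ)⌉₊ + 1

/-- The number of sample pairs in a group. -/
noncomputable def numPairs (γ : ℝ) : ℕ := 16 * numTerms γ * numTerms γ

/-- The number of groups of sample pairs. -/
noncomputable def numGroups (n : ℕ) (γ δ : ℝ) : ℕ :=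
  (n + 2) * numTerms γ + 2 * n + 2 + logBound δ

/-- The number of sample points. -/
noncomputable def numRows (n : ℕ) (γ δ : ℝ) : ℕ := 2 * (numGroups n γ δ * numPairs γ)

/-- The number of coin flips for one coordinate of a sample point. -/
noncomputable def numBits (n : ℕ) (γ δ : ℝ) : ℕ := logBound δ + 2 + numRows n γ δ * n

/-- The number of all coin flips. -/
noncomputable def numFlips (n : ℕ) (γ δ : ℝ) : ℕ := numRows n γ δ * n * numBits n γ δ

/-- A bound for the length of the queue. -/
noncomputable def queueBound (n s : ℕ) (γ : ℝ) : ℕ := s + 2 + n * numTerms γ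

abbrev RealExpr.natVar (a : ℕ) : RealExpr := .ofNat (.var a)

/-- Compute the parameters. -/
def setupProg : Prog :=
  .seq (ceilProg 2 (.div (.num 1) (.mul (.var 0) (.var 0)))) (.seq (.incr 2)
    (.seq (ceilProg 3 (.mul (.mul (.num 16) (.natVar 2)) (.natVar 2))) (.seq logProg
      (.seq (ceilProg 4 (.add (.mul (.add (.natVar 0) (.num 2)) (.natVar 2))
          (.add (.mul (.num 2) (.natVar 0)) (.add (.num 2) (.natVar 6)))))
        (.seq (ceilProg 32 (.mul (.num 2) (.mul (.natVar 4) (.natVar 3))))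
          (.seq (ceilProg 7 (.add (.add (.natVar 6) (.num 2)) (.mul (.natVar 32) (.natVar 0))))
            (.seq (ceilProg 8 (.mul (.mul (.natVar 32) (.natVar 0)) (.natVar 7)))
              (ceilProg 9 (.add (.ofNat (.add (.cell 0 (.lit 0) (.lit 2)) (.lit 2)))
                (.mul (.natVar 0) (.natVar 2)))))))))))

noncomputable def setupTime (n s : ℕ) (γ δ : ℝ) : ℕ :=
  2 * numTerms γ + 2 * numPairs γ + 4 * logBound δ + 2 * numGroups n γ δ + 2 * numRows n γ δ +
    2 * numBits n γ δ + 2 * numFlips n γ δ + 2 * queueBound n s γ + 60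

/-- The memory holds the parameters. -/
structure Mem.HasSetup (n s : ℕ) (γ δ : ℝ) (m : Mem) : Prop where
  terms : m.nat 2 0 0 = numTerms γ
  pairs : m.nat 3 0 0 = numPairs γ
  groups : m.nat 4 0 0 = numGroups n γ δ
  rows : m.nat 32 0 0 = numRows n γ δ
  bits : m.nat 7 0 0 = numBits n γ δ
  flips : m.nat 8 0 0 = numFlips n γ δ
  queue : m.nat 9 0 0 = queueBound n s γ

/-- Natural expressions have no multiplication. Products are therefore formed in the reals and
brought back by counting; the ceiling of an integer is that integer. -/
theorem runs_setupProg {m : Mem} {n s : ℕ} {γ δ : ℝ} (hδ : 0 < δ) (hn : m.nat 0 0 0 = n)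
    (hs : m.nat 0 0 2 = s) (hγ : m.real 0 0 0 = γ) (hm : m.real 0 0 1 = δ) :
    Runs setupProg m (setupTime n s γ δ) fun m' =>
      m.EqOff [2, 3, 4, 6, 7, 8, 9, 32] [14] m' ∧ m'.HasSetup n s γ δ := by
  have ceil_eq : ∀ {x : ℝ} {k : ℕ}, x = k → ⌈x⌉₊ = k := fun h => by rw [h, Nat.ceil_natCast]
  apply Runs.of_le
  · apply Runs.seq (runs_ceilProg (x := 1 / (γ * γ)) fun m' h => by
      simp [RealExpr.eval, NatExpr.eval, h.real 0, hγ])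
    rintro m₁ ⟨E₁, h₁⟩
    apply Runs.setNat_seq (v := numTerms γ) (by simp [NatExpr.eval, h₁, numTerms])
    simp only [NatExpr.eval]
    have E₁' : m.EqOff [2] [] (m₁.setNat 2 0 0 (numTerms γ)) := E₁.setNat (by simp) _ _ _
    have h₁' : (m₁.setNat 2 0 0 (numTerms γ)).nat 2 0 0 = numTerms γ := by simp
    generalize m₁.setNat 2 0 0 (numTerms γ) = m₂ at E₁' h₁'
    apply Runs.seq (runs_ceilProg (x := (numPairs γ : ℕ)) fun m' h => by
      simp [RealExpr.eval, NatExpr.eval, h.nat 2, h₁', numPairs])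
    rintro m₃ ⟨E₃, h₃⟩
    rw [Nat.ceil_natCast] at h₃
    have F₃ := (E₁'.mono (B' := [14]) (A' := [2, 3, 4, 6, 7, 8, 9, 32]) (by simp)
      (by simp)).trans (E₃.mono (by simp) (by simp))
    apply Runs.seq (runs_logProg hδ (by rw [F₃.real 0 (by simp), hm]))
    rintro m₄ ⟨E₄, h₄⟩
    have F₄ := F₃.trans (E₄.mono (by simp) (by simp))
    apply Runs.seq (runs_ceilProg (x := (numGroups n γ δ : ℕ)) fun m' h => by
      simp [RealExpr.eval, NatExpr.eval, h.nat 0, h.nat 2, h.nat 6, F₄.nat 0, hn, E₄.nat 2,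
        E₃.nat 2, h₁', h₄, numGroups]
      ring)
    rintro m₅ ⟨E₅, h₅⟩
    rw [Nat.ceil_natCast] at h₅
    have F₅ := F₄.trans (E₅.mono (by simp) (by simp))
    apply Runs.seq (runs_ceilProg (x := (numRows n γ δ : ℕ)) fun m' h => by
      simp [RealExpr.eval, NatExpr.eval, h.nat 4, h.nat 3, h₅, E₅.nat 3, E₄.nat 3, h₃, numRows])
    rintro m₆ ⟨E₆, h₆⟩
    rw [Nat.ceil_natCast] at h₆
    have F₆ := F₅.trans (E₆.mono (by simp) (by simp))
    apply Runs.seq (runs_ceilProg (x := (numBits n γ δ : ℕ)) fun m' h => by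
      simp [RealExpr.eval, NatExpr.eval, h.nat 6, h.nat 32, h.nat 0, F₆.nat 0, hn, h₆, E₆.nat 6,
        E₅.nat 6, h₄, numBits])
    rintro m₇ ⟨E₇, h₇⟩
    rw [Nat.ceil_natCast] at h₇
    have F₇ := F₆.trans (E₇.mono (by simp) (by simp))
    apply Runs.seq (runs_ceilProg (x := (numFlips n γ δ : ℕ)) fun m' h => by
      simp [RealExpr.eval, NatExpr.eval, h.nat 7, h.nat 32, h.nat 0, F₇.nat 0, hn, h₇, E₇.nat 32,
        h₆, numFlips])
    rintro m₈ ⟨E₈, h₈⟩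
    rw [Nat.ceil_natCast] at h₈
    have F₈ := F₇.trans (E₈.mono (by simp) (by simp))
    refine (runs_ceilProg (x := (queueBound n s γ : ℕ)) fun m' h => ?_).imp ?_
    · simp [RealExpr.eval, NatExpr.eval, h.nat 2, h.nat 0, F₈.nat 0, hn, hs, E₈.nat 2, E₇.nat 2,
        E₆.nat 2, E₅.nat 2, E₄.nat 2, E₃.nat 2, h₁', queueBound]
    rintro m₉ ⟨E₉, h₉⟩
    rw [Nat.ceil_natCast] at h₉
    exact ⟨F₈.trans (E₉.mono (by simp) (by simp)),
      by rw [E₉.nat 2 (by simp), E₈.nat 2 (by simp), E₇.nat 2 (by simp), E₆.nat 2 (by simp),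
        E₅.nat 2 (by simp), E₄.nat 2 (by simp), E₃.nat 2 (by simp), h₁'],
      by rw [E₉.nat 3 (by simp), E₈.nat 3 (by simp), E₇.nat 3 (by simp), E₆.nat 3 (by simp),
        E₅.nat 3 (by simp), E₄.nat 3 (by simp), h₃],
      by rw [E₉.nat 4 (by simp), E₈.nat 4 (by simp), E₇.nat 4 (by simp), E₆.nat 4 (by simp), h₅],
      by rw [E₉.nat 32 (by simp), E₈.nat 32 (by simp), E₇.nat 32 (by simp), h₆],
      by rw [E₉.nat 7 (by simp), E₈.nat 7 (by simp), h₇],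
      by rw [E₉.nat 8 (by simp), h₈], h₉⟩
  · simp only [Nat.ceil_natCast, setupTime]
    have : ⌈1 / (γ * γ)⌉₊ ≤ numTerms γ := Nat.le_succ _
    omega

/-! ### Coin flips and their conversion to samples -/

/-- Flip all coins. -/
def flipProg : Prog := .forLoop 10 (.var 8) (.flip 5 (.lit 0) (.var 10))

/-- Splits off the first coin, so that one round of the flip loop can be peeled off in an induction.
-/
theorem bind_uniform_succ {α : Type*} (r : ℕ) (f : (Fin (r + 1) → Bool) → PMF α) :
    (PMF.uniformOfFintype (Fin (r + 1) → Bool)).bind f = (PMF.uniformOfFintype Bool).bind fun b =>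
      (PMF.uniformOfFintype (Fin r → Bool)).bind fun ω => f (Fin.cons b ω) := by
  ext x
  simp only [PMF.bind_apply, PMF.uniformOfFintype_apply, tsum_fintype, ← Finset.mul_sum]
  rw [← (Fin.consEquiv fun _ : Fin (r + 1) => Bool).sum_comp, Fintype.sum_prod_type, ← mul_assoc]
  congr 1
  rw [← ENNReal.mul_inv (by simp) (by simp)]
  simp [pow_succ, mul_comm]

/-- The only random part of the program. Its number of steps does not depend on the outcomes (four
per round, one for the exit), so the resulting distribution is exactly a mixture over uniform bit
strings `ω` of the deterministic continuations from `F ω`. -/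
theorem run_flip_loop (B : ℕ) (r : ℕ) : ∀ (i : ℕ) (m : Mem), i + r = B → m.nat 8 0 0 = B →
    m.nat 10 0 0 = i → ∃ F : (Fin r → Bool) → Mem,
      (∀ ω, m.EqOff [5, 10] [] (F ω) ∧ (∀ j < i, (F ω).nat 5 0 j = m.nat 5 0 j) ∧
        ∀ t : Fin r, (F ω).nat 5 0 (i + t) = (ω t).toNat) ∧
      ∀ T s, Cfg.run (T + (4 * r + 1))
        (.loop (.ltNat (.var 10) (.var 8)) (.seq (.flip 5 (.lit 0) (.var 10)) (.incr 10)) :: s, m) =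
          (PMF.uniformOfFintype (Fin r → Bool)).bind fun ω => Cfg.run T (s, F ω) := by
  induction r with
  | zero =>
    intro i m hi h8 h10
    refine ⟨fun _ => m, fun ω => ⟨.refl _ _ _, fun _ _ => rfl, fun t => t.elim0⟩, fun T s => ?_⟩
    have hb : ¬ (Test.ltNat (.var 10) (.var 8)).Holds m := by
      simp [Test.Holds, NatExpr.eval, h8, h10]; omega
    simp only [Cfg.run, Cfg.step, if_neg hb, PMF.pure_bind, PMF.bind_const]
  | succ r ih =>
    intro i m hi h8 h10
    have hb : (Test.ltNat (.var 10) (.var 8)).Holds m := by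
      simp [Test.Holds, NatExpr.eval, h8, h10]; omega
    set m' : Bool → Mem := fun b => (m.setNat 5 0 i b.toNat).setNat 10 0 0 (i + 1) with hm'
    have hE : ∀ b, m.EqOff [5, 10] [] (m' b) := fun b =>
      ((Mem.EqOff.refl _ _ _).setNat (by simp) _ _ _).setNat (by simp) _ _ _
    have key := fun b => ih (i + 1) (m' b) (by omega) (by rw [(hE b).nat 8 (by simp), h8])
      (by simp [hm'])
    choose F hF hrun using key
    refine ⟨fun ω => F (ω 0) (Fin.tail ω), fun ω => ⟨(hE _).trans (hF _ _).1, fun j hj => ?_,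
      fun t => ?_⟩, fun T s => ?_⟩
    · rw [(hF _ _).2.1 j (by omega)]
      simp [hm', Mem.setNat_nat]
      omega
    · refine Fin.cases ?_ (fun t => ?_) t
      · rw [(hF _ _).2.1 _ (by simp)]
        simp [hm', Mem.setNat_nat]
      · have := (hF (ω 0) (Fin.tail ω)).2.2 t
        rw [show i + 1 + (t : ℕ) = i + ((t.succ : Fin (r + 1)) : ℕ) by simp; ring] at this
        rw [this, Fin.tail]
    · rw [bind_uniform_succ, show T + (4 * (r + 1) + 1) = T + (4 * r + 1) + 1 + 1 + 1 + 1 by ring]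
      replace hrun := fun b => hrun b T s
      generalize T + (4 * r + 1) = U at hrun ⊢
      simp only [Cfg.run, Cfg.step, if_pos hb, PMF.pure_bind, PMF.bind_map]
      congr 1
      funext b
      simp only [Function.comp, PMF.pure_bind, Fin.cons_zero, Fin.tail_cons]
      rw [← hrun b]
      simp [hm', NatExpr.eval, h10]

theorem run_flipProg {m : Mem} {B : ℕ} (h8 : m.nat 8 0 0 = B) : ∃ F : (Fin B → Bool) → Mem,
    (∀ ω, m.EqOff [5, 10] [] (F ω) ∧ ∀ t : Fin B, (F ω).nat 5 0 t = (ω t).toNat) ∧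
      ∀ T s, Cfg.run (T + (4 * B + 3)) (flipProg :: s, m) =
        (PMF.uniformOfFintype (Fin B → Bool)).bind fun ω => Cfg.run T (s, F ω) := by
  obtain ⟨F, hF, hrun⟩ := run_flip_loop B B 0 (m.setNat 10 0 0 0) (by simp) (by simp [h8])
    (by simp)
  refine ⟨F, fun ω => ⟨((Mem.EqOff.refl _ _ m).setNat (a := 10) (by simp) 0 0 0).trans
    (hF ω).1,
    fun t => by simpa using (hF ω).2.2 t⟩, fun T s => ?_⟩
  rw [← hrun, show T + (4 * B + 3) = T + (4 * B + 1) + 1 + 1 by ring]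
  generalize T + (4 * B + 1) = U
  simp only [Cfg.run, Cfg.step, flipProg, Prog.forLoop, PMF.pure_bind, NatExpr.eval]

/-- The number in `[0,1)` with the binary digits `β (k-1), …, β 0`. -/
noncomputable def binFrac (β : ℕ → ℕ) : ℕ → ℝ
  | 0 => 0
  | k + 1 => (binFrac β k + β k) / 2

theorem binFrac_congr {β β' : ℕ → ℕ} {k : ℕ} (h : ∀ b < k, β b = β' b) :
    binFrac β k = binFrac β' k := by
  induction k with
  | zero => rfl
  | succ k ih => rw [binFrac, binFrac, ih fun b hb => h b (by omega), h k (by omega)]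

/-- The sign with expectation about `x` that a uniform number `y` in `[0,1)` stands for. -/
noncomputable def roundSign (y x : ℝ) : ℤˣ := open Classical in if y < (1 + x) / 2 then 1 else -1

/-- The sample points that the coin flips stand for, with `k` coins for each coordinate. -/
noncomputable def samplePoint {n : ℕ} (μ : Fin n → ℝ) (k : ℕ) (ω : ℕ → ℕ) (i : ℕ) : Cube n :=
  fun j => roundSign (binFrac (fun b => ω ((i * n + j) * k + b)) k) (μ j)

/-- Convert the coin flips to sample points. -/
def sampleProg : Prog :=
  .seq (.assignNat 21 (.lit 0)) (.forLoop 19 (.var 32) (.forLoop 20 (.var 0)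
    (.seq (.assignReal 13 (.num 0)) (.seq
      (.forLoop 28 (.var 7) (.seq
        (.assignReal 13 (.div (.add (.var 13) (.ofNat (.cell 5 (.lit 0) (.var 21)))) (.num 2)))
        (.incr 21)))
      (.ite (.ltReal (.var 13) (.div (.add (.num 1) (.cell 1 (.lit 0) (.var 20))) (.num 2)))
        (.setReal 5 (.var 19) (.var 20) (.num 1))
        (.setReal 5 (.var 19) (.var 20) (.sub (.num 0) (.num 1))))))))

def sampleTime (n k rows : ℕ) : ℕ := rows * (n * (k * 6 + 9 + 3) + 3 + 3) + 5

theorem runs_sampleProg {n : ℕ} {m : Mem} {γ : ℝ} {μ : Fin n → ℝ} {k rows : ℕ}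
    (hm : m.HasParams γ μ) (hk : m.nat 7 0 0 = k) (hr : m.nat 32 0 0 = rows) :
    Runs sampleProg m (sampleTime n k rows) fun m' => m.EqOff [19, 20, 21, 28] [5, 13] m' ∧
      m'.HasSamples rows (samplePoint μ k fun q => m.nat 5 0 q) := by
  set X := samplePoint μ k fun q => m.nat 5 0 q with hX
  apply Runs.of_le
  · apply Runs.setNat_seq (v := 0) rfl
    simp only [NatExpr.eval]
    have E₁ := (Mem.EqOff.refl [19, 20, 21, 28] [5, 13] m).setNat (a := 21) (by simp) 0 0 0
    have h21 : (m.setNat 21 0 0 0).nat 21 0 0 = 0 := by simp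
    generalize m.setNat 21 0 0 0 = m₁ at E₁ h21
    refine (Runs.forLoop (v := 19) (N := rows) (t := n * (k * 6 + 9 + 3) + 3)
      (A := [19, 20, 21, 28]) (A' := [20, 21, 28]) (B := [5, 13])
      (fun i m' => m'.nat 21 0 0 = i * n * k ∧ m'.HasSamples i X)
      (by simp) (by simp) (by simp)
      (fun m' hE => by simp [NatExpr.eval, hE.nat 32, E₁.nat 32, hr])
      ⟨by simp [h21], fun i hi => by omega⟩ (fun i hi m₂ E₂ hi₂ hJ₂ => ?_)).imp
        fun m' h => ⟨E₁.trans h.1, h.2.2⟩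
    have E₂' := E₁.trans E₂
    refine ((Runs.forLoop (v := 20) (N := n) (t := k * 6 + 9)
      (A := [20, 21, 28]) (A' := [21, 28]) (B := [5, 13])
      -- Natural variable `21` is the position of the next unused coin. It runs through the coins
      -- once, so each coordinate of each sample gets its own block of `k` coins.
      (fun j m' => m'.nat 21 0 0 = (i * n + j) * k ∧ m'.HasSamples i X ∧
        ∀ j' : Fin n, j'.1 < j → m'.real 5 i j' = (X i).coord j')
      (by simp) (by simp) (by simp)
      (fun m' hE => by simp [NatExpr.eval, hE.nat 0, E₂'.nat 0, hm.dim])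
      ⟨by simp [hJ₂.1], hJ₂.2, by simp⟩ (fun j hj m₃ E₃ hj₃ hJ₃ => ?_)).of_le
        (by omega)).imp ?_
    · have E₃' := E₂'.trans (E₃.mono (by simp) (by simp))
      have hm₃ := hm.congr E₃' (by simp) (by simp)
      set U := binFrac (fun b => m.nat 5 0 ((i * n + j) * k + b)) with hU
      apply Runs.of_le
      · apply Runs.setReal_seq (v := 0) (by simp [NatExpr.eval, RealExpr.eval])
        simp only [NatExpr.eval]
        have E₄ := (Mem.EqOff.refl [21, 28] [13] m₃).setReal (a := 13) (by simp) 0 0 0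
        have h13 : (m₃.setReal 13 0 0 0).real 13 0 0 = 0 := by simp
        have h21 : (m₃.setReal 13 0 0 0).nat 21 0 0 = (i * n + j) * k := by simp [hJ₃.1]
        generalize m₃.setReal 13 0 0 0 = m₄ at E₄ h13 h21
        apply Runs.seq (Runs.forLoop (v := 28) (N := k) (t := 3)
          (A := [21, 28]) (A' := [21]) (B := [13])
          (fun b m' => m'.nat 21 0 0 = (i * n + j) * k + b ∧ m'.real 13 0 0 = U b)
          (by simp) (by simp) (by simp)
          (fun m' hE => by simp [NatExpr.eval, hE.nat 7, E₄.nat 7, E₃'.nat 7, hk])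
          ⟨by simp [h21], by simp [h13, hU, binFrac]⟩
          (fun b hb m₅ E₅ hb₅ hJ₅ => ?_))
        · rintro m₆ ⟨E₆, h21', h13⟩
          have E₆' : m₃.EqOff [21, 28] [13] m₆ := E₄.trans E₆
          have hX' : (X i) ⟨j, hj⟩ = roundSign (U k) (m₃.real 1 0 j) := by
            rw [hm₃.mu ⟨j, hj⟩, hX, samplePoint]
          have h19 : m₆.nat 19 0 0 = i := by rw [E₆'.nat 19 (by simp), E₃.nat 19 (by simp), hi₂]
          have h20 : m₆.nat 20 0 0 = j := by rw [E₆'.nat 20 (by simp), hj₃]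
          have fin : ∀ v : ℝ, v = (X i).coord ⟨j, hj⟩ →
              m₃.EqOff [21, 28] [5, 13] (m₆.setReal 5 i j v) ∧
              ((m₆.setReal 5 i j v).setNat 20 0 0 (j + 1)).HasSamples i X ∧
              ∀ j' : Fin n, j'.1 < j + 1 →
                ((m₆.setReal 5 i j v).setNat 20 0 0 (j + 1)).real 5 i j' = (X i).coord j' := by
            intro v hv
            refine ⟨(E₆'.mono (by simp) (by simp)).setReal (by simp) _ _ _, fun i' hi' j' => ?_,
              fun j' hj' => ?_⟩
            · simp only [Mem.setNat_real, Mem.setReal_real, E₆'.real 5 (by simp)]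
              rw [if_neg (by omega), hJ₃.2.1 i' hi']
            · simp only [Mem.setNat_real, Mem.setReal_real, E₆'.real 5 (by simp)]
              split_ifs with h
              · rw [hv]; congr 1; exact Fin.ext h.2.2.symm
              · exact hJ₃.2.2 j' (by simp at h; omega)
          have h21 : m₆.nat 21 0 0 = (i * n + (j + 1)) * k := by rw [h21']; ring
          refine Runs.ite (t := 1) (fun hb => Runs.setReal ?_) (fun hb => Runs.setReal ?_)
          all_goals
            simp only [Test.Holds, RealExpr.eval, NatExpr.eval, h19, h20, h13,
              E₆'.real 1 (by simp)] at hb ⊢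
            simp only [Nat.cast_one, Nat.cast_zero, Nat.cast_ofNat, zero_sub] at hb ⊢
          · obtain ⟨h1, h2⟩ := fin 1 (by
              rw [Cube.coord, hX', roundSign, if_pos hb]; norm_num)
            exact ⟨h1, h21, h2⟩
          · obtain ⟨h1, h2⟩ := fin (-1) (by
              rw [Cube.coord, hX', roundSign, if_neg hb]; norm_num)
            exact ⟨h1, h21, h2⟩
        · have h5 : m₅.nat 5 0 ((i * n + j) * k + b) = m.nat 5 0 ((i * n + j) * k + b) := by
            rw [E₅.nat 5 (by simp), E₄.nat 5 (by simp), E₃'.nat 5 (by simp)]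
          refine (Runs.setReal_seq (v := U (b + 1)) ?_ (Runs.setNat
            ⟨((Mem.EqOff.refl _ _ _).setReal (by simp) _ _ _).setNat (by simp) _ _ _, ?_, ?_⟩))
          · simp [RealExpr.eval, NatExpr.eval, hJ₅.1, hJ₅.2, h5, hU, binFrac]
          · simp [NatExpr.eval, hJ₅.1]; ring
          · simp [NatExpr.eval]
      · omega
    · rintro m' ⟨hE, h21, hs, hrow⟩
      refine ⟨hE, by rw [Mem.setNat_nat_of_ne (by simp), h21]; ring, fun i' hi' j => ?_⟩
      rcases Nat.lt_succ_iff_lt_or_eq.1 hi' with h | rfl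
      · exact hs i' h j
      · exact hrow j j.2
  · simp only [sampleTime]; omega

/-- The algorithm: a bounded function with about the given low-degree coefficients is built by
repeatedly searching for an index with a wrong coefficient and correcting it. -/
def approxProg : Prog :=
  .seq setupProg (.seq flipProg (.seq sampleProg
    (.seq (.assignNat 12 (.add (.cell 0 (.lit 0) (.lit 2)) (.lit 1)))
      (.seq (.setNat 14 (.lit 0) (.cell 0 (.lit 0) (.lit 2)) (.var 0)) searchProg))))

/-- The coin flips as natural numbers. -/
def flipSeq {B : ℕ} (ω : Fin B → Bool) (q : ℕ) : ℕ := if h : q < B then (ω ⟨q, h⟩).toNat else 0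

/-- The parameters of the search for the given input and coin flips. -/
noncomputable def searchParams {n s : ℕ} (d : ℕ) (γ δ : ℝ) (μ : Fin n → ℝ) (v : Fin s → ℝ)
    (ω : Fin (numFlips n γ δ) → Bool) : SearchParams n where
  deg := d
  gam := γ
  mean := μ
  len := s
  coeff := fun j => if h : j < s then v ⟨j, h⟩ else 0
  maxCount := numTerms γ
  maxTail := queueBound n s γ
  groupSize := numPairs γ
  groups := numGroups n γ δ
  sample := samplePoint μ (numBits n γ δ) (flipSeq ω)

/-- The state in which the search starts. -/
def initState {n s : ℕ} (a : Fin s → Finset (Fin n)) : SearchState n where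
  count := 0
  terms := fun _ => (∅, true)
  head := 0
  tail := s + 1
  queue := fun i => (if h : i < s then a ⟨i, h⟩ else ∅, if i = s then n else 0)

/-- Only the first `rows * n * k` coins matter. This identifies samples made from the memory with
samples made from `flipSeq ω`, which is 0 beyond the coins. -/
theorem samplePoint_congr {n : ℕ} (μ : Fin n → ℝ) {k rows i : ℕ} {ω ω' : ℕ → ℕ}
    (h : ∀ q < rows * n * k, ω q = ω' q) (hi : i < rows) :
    samplePoint μ k ω i = samplePoint μ k ω' i := by
  funext j
  simp only [samplePoint]
  congr 1
  refine binFrac_congr fun b hb => h _ ?_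
  calc (i * n + j) * k + b < (i * n + j) * k + k := by omega
    _ = (i * n + j + 1) * k := by ring
    _ ≤ (i * n + n) * k := Nat.mul_le_mul_right _ (by omega)
    _ = (i + 1) * n * k := by ring
    _ ≤ rows * n * k := Nat.mul_le_mul_right _ (Nat.mul_le_mul_right _ hi)

noncomputable def searchTime (n s : ℕ) (γ δ : ℝ) : ℕ :=
  sampleTime n (numBits n γ δ) (numRows n γ δ) +
    ((numTerms γ * (queueBound n s γ + 1) + queueBound n s γ) *
      (stepTime n s (numTerms γ) (numPairs γ) (numGroups n γ δ) + 1) + 1) + 5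

noncomputable def approxTime (n s : ℕ) (γ δ : ℝ) : ℕ :=
  setupTime n s γ δ + (4 * numFlips n γ δ + 3) + searchTime n s γ δ + 2

theorem run_eq_pure (T : ℕ) (m : Mem) : Cfg.run T ([], m) = PMF.pure ([], m) := by
  induction T with
  | zero => rfl
  | succ T ih => simp only [Cfg.run, Cfg.step, PMF.pure_bind, ih]

theorem run_seq_cons (T : ℕ) (p q : Prog) (s : List Prog) (m : Mem) :
    Cfg.run (T + 1) (.seq p q :: s, m) = Cfg.run T (p :: q :: s, m) := by
  simp only [Cfg.run, Cfg.step, PMF.pure_bind]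

theorem Runs.run_eq {p : Prog} {m : Mem} {t : ℕ} {Q : Mem → Prop} (h : Runs p m t Q) :
    ∃ m', Q m' ∧ ∀ T ≥ t, Cfg.run T ([p], m) = PMF.pure ([], m') := by
  obtain ⟨u, hu, m', hm', h⟩ := h
  refine ⟨m', hm', fun T hT => ?_⟩
  rw [show T = (T - u) + u by omega, h, run_eq_pure]

theorem Runs.run_seq {p q : Prog} {m : Mem} {t : ℕ} {Q : Mem → Prop} (h : Runs p m t Q) :
    ∃ m', Q m' ∧ ∃ u ≤ t + 1, ∀ T, Cfg.run (T + u) ([.seq p q], m) = Cfg.run T ([q], m') := by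
  obtain ⟨u, hu, m', hm', h⟩ := h
  refine ⟨m', hm', u + 1, by omega, fun T => ?_⟩
  rw [← add_assoc]
  simp only [Cfg.run, Cfg.step, PMF.pure_bind, h]

/-- Once the coins are fixed, the rest of the run is deterministic and ends with a halted search. So
the output distribution is the image of the uniform distribution on bit strings under `G`. -/
theorem run_approxProg {n s : ℕ} (d : ℕ) (γ δ : ℝ) (hδ : 0 < δ) (μ : Fin n → ℝ)
    (a : Fin s → Finset (Fin n)) (v : Fin s → ℝ) :
    ∃ G : (Fin (numFlips n γ δ) → Bool) → Mem,
      (∀ ω, ∃ σ, (initState a).Reaches (searchParams d γ δ μ v ω) σ ∧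
        ¬ σ.Active (searchParams d γ δ μ v ω) ∧ σ.Holds (searchParams d γ δ μ v ω) (G ω)) ∧
      ∀ T ≥ approxTime n s γ δ, Cfg.run T ([approxProg], inputMem d γ δ μ a v) =
        (PMF.uniformOfFintype (Fin (numFlips n γ δ) → Bool)).map fun ω => ([], G ω) := by
  set m := inputMem d γ δ μ a v with hm
  have hn : m.nat 0 0 0 = n := rfl
  have hd : m.nat 0 0 1 = d := rfl
  have hs : m.nat 0 0 2 = s := rfl
  have hγ : m.real 0 0 0 = γ := rfl
  have hδ' : m.real 0 0 1 = δ := rfl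
  have hμ : ∀ j : Fin n, m.real 1 0 j = μ j := fun j => by simp [hm, inputMem]
  have hv : ∀ j (hj : j < s), m.real 2 0 j = v ⟨j, hj⟩ := fun j hj => by simp [hm, inputMem, hj]
  have ha : ∀ i (hi : i < s), m.rowSet n 1 i = a ⟨i, hi⟩ := fun i hi => by
    ext j
    simp [Mem.mem_rowSet, hm, inputMem, hi]
    split_ifs <;> simp_all
  -- Row `s`, right behind the list, is the root of the search. Its empty set needs no writing,
  -- since unused cells are 0.
  have ha' : m.rowSet n 1 s = ∅ := by
    ext j
    simp [Mem.mem_rowSet, hm, inputMem]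
  have h11 : m.nat 11 0 0 = 0 := rfl
  have h13 : m.nat 13 0 0 = 0 := rfl
  -- For the same reason the listed indices start with no undecided coordinates, that is, as leaves.
  have h14 : ∀ i, m.nat 14 0 i = 0 := fun i => rfl
  obtain ⟨m₁, ⟨E₁, S₁⟩, u, hu, hrun₁⟩ := (runs_setupProg hδ hn hs hγ hδ').run_seq
    (q := .seq flipProg (.seq sampleProg
    (.seq (.assignNat 12 (.add (.cell 0 (.lit 0) (.lit 2)) (.lit 1)))
      (.seq (.setNat 14 (.lit 0) (.cell 0 (.lit 0) (.lit 2)) (.var 0)) searchProg))))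
  obtain ⟨F, hF, hrun₂⟩ := run_flipProg S₁.flips
  have key : ∀ ω, Runs (.seq sampleProg
      (.seq (.assignNat 12 (.add (.cell 0 (.lit 0) (.lit 2)) (.lit 1)))
        (.seq (.setNat 14 (.lit 0) (.cell 0 (.lit 0) (.lit 2)) (.var 0)) searchProg)))
      (F ω) (searchTime n s γ δ) fun m' => ∃ σ,
        (initState a).Reaches (searchParams d γ δ μ v ω) σ ∧
        ¬ σ.Active (searchParams d γ δ μ v ω) ∧ σ.Holds (searchParams d γ δ μ v ω) m' := by
    intro ω
    obtain ⟨E₂, hω⟩ := hF ω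
    have E₂' : m.EqOff [2, 3, 4, 5, 6, 7, 8, 9, 10, 32] [14] (F ω) :=
      (E₁.mono (by simp) (by simp)).trans (E₂.mono (by simp) (by simp))
    have hpar : (F ω).HasParams γ μ := ⟨by rw [E₂'.nat 0 (by simp), hn],
      by rw [E₂'.real 0 (by simp), hγ], fun j => by rw [E₂'.real 1 (by simp), hμ]⟩
    apply Runs.of_le
    · apply Runs.seq (runs_sampleProg hpar (by rw [E₂.nat 7 (by simp), S₁.bits])
        (by rw [E₂.nat 32 (by simp), S₁.rows]))
      rintro m₂ ⟨E₃, hsamp⟩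
      have E₃' : m.EqOff [2, 3, 4, 5, 6, 7, 8, 9, 10, 19, 20, 21, 28, 32] [5, 13, 14] m₂ :=
        (E₂'.mono (by simp) (by simp)).trans (E₃.mono (by simp) (by simp))
      apply Runs.setNat_seq (v := s + 1) (by simp [NatExpr.eval, E₃'.nat 0, hs])
      apply Runs.setNat_seq (v := n) (by simp [NatExpr.eval, E₃'.nat 0, hn])
      simp only [NatExpr.eval]
      have e2 : (m₂.setNat 12 0 0 (s + 1)).nat 0 0 2 = s := by
        rw [Mem.setNat_nat_of_ne (by simp), E₃'.nat 0 (by simp), hs]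
      rw [e2]
      have E₄ := ((Mem.EqOff.refl [12, 14] [] m₂).setNat (a := 12) (by simp) 0 0 (s + 1)).setNat
        (a := 14) (by simp) 0 s n
      have h12 : ((m₂.setNat 12 0 0 (s + 1)).setNat 14 0 s n).nat 12 0 0 = s + 1 := by simp
      have h14' : ∀ i, ((m₂.setNat 12 0 0 (s + 1)).setNat 14 0 s n).nat 14 0 i =
          if i = s then n else 0 := fun i => by
        simp [Mem.setNat_nat, E₃'.nat 14, h14]
      generalize (m₂.setNat 12 0 0 (s + 1)).setNat 14 0 s n = m₃ at E₄ h12 h14'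
      have E₄' : m.EqOff [2, 3, 4, 5, 6, 7, 8, 9, 10, 12, 14, 19, 20, 21, 28, 32] [5, 13, 14] m₃ :=
        (E₃'.mono (by simp) (by simp)).trans (E₄.mono (by simp) (by simp))
      have hB : numFlips n γ δ = numRows n γ δ * n * numBits n γ δ := rfl
      have holds : (initState a).Holds (searchParams d γ δ μ v ω) m₃ :=
      { test :=
        { params := (hpar.congr E₃ (by simp) (by simp)).congr E₄ (by simp) (by simp)
          sum := ⟨by rw [E₄'.nat 13 (by simp), h13]; rfl, fun t ht => absurd ht (Nat.not_lt_zero t),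
            fun t ht => absurd ht (Nat.not_lt_zero t)⟩
          size := by
            rw [E₄.nat 3 (by simp), E₃.nat 3 (by simp), E₂.nat 3 (by simp), S₁.pairs]; rfl
          groups := by
            rw [E₄.nat 4 (by simp), E₃.nat 4 (by simp), E₂.nat 4 (by simp), S₁.groups]; rfl
          samples := fun i hi j => by
            rw [E₄.real 5 (by simp), hsamp i hi j]
            simp only [searchParams]
            rw [samplePoint_congr μ (fun q hq => ?_) hi]
            rw [flipSeq, dif_pos (hB ▸ hq)]
            exact hω ⟨q, hB ▸ hq⟩ }
        deg := by rw [E₄'.nat 0 (by simp), hd]; rfl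
        len := by rw [E₄'.nat 0 (by simp), hs]; rfl
        maxCount := by
          rw [E₄.nat 2 (by simp), E₃.nat 2 (by simp), E₂.nat 2 (by simp), S₁.terms]; rfl
        maxTail := by
          rw [E₄.nat 9 (by simp), E₃.nat 9 (by simp), E₂.nat 9 (by simp), S₁.queue]; rfl
        coeff := fun j (hj : j < s) => by
          rw [E₄'.real 2 (by simp), hv j hj]; simp [searchParams, hj]
        head := by rw [E₄'.nat 11 (by simp), h11]; rfl
        tail := h12
        row := fun i hi => by
          rw [Mem.rowSet_congr (m := m) (arr := 1) (i := i) fun j _ => by rw [E₄'.nat 1 (by simp)]]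
          simp only [initState] at hi ⊢
          split_ifs with h
          · exact ha i h
          · rw [show i = s by omega, ha']
        rem := fun i hi => h14' i
        le_tail := le_rfl }
      exact runs_searchProg holds (by simp only [searchParams, initState, queueBound]; omega)
        (by simp only [searchParams, queueBound]; omega)
    · simp only [SearchState.fuel, searchParams, initState, searchTime, Nat.sub_zero]
      omega
  choose G hG hrun₃ using fun ω => (key ω).run_eq
  refine ⟨G, hG, fun T hT => ?_⟩
  have hT' : T = (T - u - 1 - (4 * numFlips n γ δ + 3)) + (4 * numFlips n γ δ + 3) + 1 + u := by
    unfold approxTime at hT; omega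
  rw [hT', approxProg, hrun₁, run_seq_cons, hrun₂]
  refine congrArg _ (funext fun ω => ?_)
  rw [hrun₃ ω _ (by unfold approxTime at hT; omega)]
  rfl

/-! ### Fourier analysis under a product distribution -/

section Fourier

variable {n : ℕ} {μ : Fin n → ℝ}

/-- The weight of one coordinate. -/
noncomputable def coordWeight (μ : Fin n → ℝ) (i : Fin n) (s : ℤˣ) : ℝ :=
  if s = 1 then (1 + μ i) / 2 else (1 - μ i) / 2

theorem sum_units_int {M : Type*} [AddCommMonoid M] (f : ℤˣ → M) : ∑ s, f s = f 1 + f (-1) := by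
  rw [UnitsInt.univ, Finset.sum_pair (by decide)]

/-- Independence of the coordinates: expanding the product of the one-coordinate sums gives the sum
over the cube. -/
theorem prodExp_prod (μ : Fin n → ℝ) (f : Fin n → ℤˣ → ℝ) :
    prodExp μ (fun x => ∏ i, f i (x i)) = ∏ i, ∑ s, coordWeight μ i s * f i s := by
  rw [Finset.prod_univ_sum, Fintype.piFinset_univ]
  simp only [prodExp, prodWeight, coordWeight, Finset.prod_mul_distrib]

theorem prodWeight_nonneg (hμ : ∀ i, μ i ∈ Set.Ioo (-1 : ℝ) 1) (x : Cube n) :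
    0 ≤ prodWeight μ x := by
  refine Finset.prod_nonneg fun i _ => ?_
  obtain ⟨h1, h2⟩ := hμ i
  split_ifs <;> linarith

theorem sum_coordWeight (μ : Fin n → ℝ) (i : Fin n) : ∑ s, coordWeight μ i s = 1 := by
  rw [sum_units_int]; simp [coordWeight]; ring

theorem sum_prodWeight (μ : Fin n → ℝ) : ∑ x, prodWeight μ x = 1 := by
  have := prodExp_prod μ fun _ _ => 1
  simpa only [prodExp, mul_one, sum_coordWeight, Finset.prod_const_one] using this

theorem prodExp_const (μ : Fin n → ℝ) (c : ℝ) : prodExp μ (fun _ => c) = c := by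
  rw [prodExp, ← Finset.sum_mul, sum_prodWeight, one_mul]

theorem prodExp_add (μ : Fin n → ℝ) (f g : Cube n → ℝ) :
    prodExp μ (fun x => f x + g x) = prodExp μ f + prodExp μ g := by
  simp only [prodExp, mul_add, Finset.sum_add_distrib]

theorem prodExp_sub (μ : Fin n → ℝ) (f g : Cube n → ℝ) :
    prodExp μ (fun x => f x - g x) = prodExp μ f - prodExp μ g := by
  simp only [prodExp, mul_sub, Finset.sum_sub_distrib]

theorem prodExp_const_mul (μ : Fin n → ℝ) (c : ℝ) (f : Cube n → ℝ) :
    prodExp μ (fun x => c * f x) = c * prodExp μ f := by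
  simp only [prodExp, Finset.mul_sum]
  exact Finset.sum_congr rfl fun x _ => by ring

theorem prodExp_mul_const (μ : Fin n → ℝ) (c : ℝ) (f : Cube n → ℝ) :
    prodExp μ (fun x => f x * c) = prodExp μ f * c := by
  simp only [mul_comm _ c, prodExp_const_mul]

theorem prodExp_sum {ι : Type*} (s : Finset ι) (μ : Fin n → ℝ) (f : ι → Cube n → ℝ) :
    prodExp μ (fun x => ∑ i ∈ s, f i x) = ∑ i ∈ s, prodExp μ (f i) := by
  simp only [prodExp, Finset.mul_sum]
  exact Finset.sum_comm

theorem prodExp_mono (hμ : ∀ i, μ i ∈ Set.Ioo (-1 : ℝ) 1) {f g : Cube n → ℝ}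
    (h : ∀ x, f x ≤ g x) : prodExp μ f ≤ prodExp μ g :=
  Finset.sum_le_sum fun x _ => mul_le_mul_of_nonneg_left (h x) (prodWeight_nonneg hμ x)

theorem prodExp_nonneg (hμ : ∀ i, μ i ∈ Set.Ioo (-1 : ℝ) 1) {f : Cube n → ℝ}
    (h : ∀ x, 0 ≤ f x) : 0 ≤ prodExp μ f :=
  Finset.sum_nonneg fun x _ => mul_nonneg (prodWeight_nonneg hμ x) (h x)

/-- Cauchy-Schwarz, with the nonnegative weights distributed over the two factors. -/
theorem sq_prodExp_mul_le (hμ : ∀ i, μ i ∈ Set.Ioo (-1 : ℝ) 1) (f g : Cube n → ℝ) :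
    prodExp μ (fun x => f x * g x) ^ 2 ≤
      prodExp μ (fun x => f x ^ 2) * prodExp μ (fun x => g x ^ 2) := by
  refine Finset.sum_sq_le_sum_mul_sum_of_sq_le_mul _
    (fun x _ => mul_nonneg (prodWeight_nonneg hμ x) (sq_nonneg _))
    (fun x _ => mul_nonneg (prodWeight_nonneg hμ x) (sq_nonneg _)) fun x _ => le_of_eq (by ring)

/-- The basis function of one coordinate. -/
noncomputable def coordBasis (μ : Fin n → ℝ) (i : Fin n) (s : ℤˣ) : ℝ :=
  (((s : ℤ) : ℝ) - μ i) / Real.sqrt (1 - μ i ^ 2)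

theorem prodBasis_eq (μ : Fin n → ℝ) (a : Finset (Fin n)) (x : Cube n) :
    prodBasis μ a x = ∏ i, if i ∈ a then coordBasis μ i (x i) else 1 := by
  rw [Finset.prod_ite_mem, Finset.univ_inter]
  rfl

theorem sum_coordBasis (μ : Fin n → ℝ) (i : Fin n) :
    ∑ s, coordWeight μ i s * coordBasis μ i s = 0 := by
  rw [sum_units_int]; simp [coordWeight, coordBasis, show (-1 : ℤˣ) ≠ 1 by decide]; ring

theorem sum_coordBasis_sq (hμ : ∀ i, μ i ∈ Set.Ioo (-1 : ℝ) 1) (i : Fin n) :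
    ∑ s, coordWeight μ i s * (coordBasis μ i s * coordBasis μ i s) = 1 := by
  obtain ⟨h1, h2⟩ := hμ i
  have h : 0 < 1 - μ i ^ 2 := by nlinarith
  rw [sum_units_int]
  simp only [coordWeight, coordBasis, div_mul_div_comm, Real.mul_self_sqrt h.le,
    show (-1 : ℤˣ) ≠ 1 by decide, if_true, if_false]
  field_simp
  push_cast
  ring

/-- The expectation factors over the coordinates. A coordinate that lies in exactly one of the two
indices contributes the mean 0 of its basis function; every other one contributes 1. -/
theorem prodExp_basis_mul_basis (hμ : ∀ i, μ i ∈ Set.Ioo (-1 : ℝ) 1) (a b : Finset (Fin n)) :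
    prodExp μ (fun x => prodBasis μ a x * prodBasis μ b x) = if a = b then 1 else 0 := by
  have := prodExp_prod μ fun i s => (if i ∈ a then coordBasis μ i s else 1) *
    (if i ∈ b then coordBasis μ i s else 1)
  simp only [prodBasis_eq, ← Finset.prod_mul_distrib]
  rw [this]
  split_ifs with hab
  · subst hab
    refine Finset.prod_eq_one fun i _ => ?_
    split_ifs
    · exact sum_coordBasis_sq hμ i
    · simpa using sum_coordWeight μ i
  · obtain ⟨i, hi⟩ : ∃ i, ¬ (i ∈ a ↔ i ∈ b) := by
      by_contra! h; exact hab (Finset.ext h)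
    refine Finset.prod_eq_zero (Finset.mem_univ i) ?_
    have := sum_coordBasis μ i
    by_cases ha : i ∈ a <;> by_cases hb : i ∈ b <;> simp_all

theorem prodExp_basis_sq (hμ : ∀ i, μ i ∈ Set.Ioo (-1 : ℝ) 1) (a : Finset (Fin n)) :
    prodExp μ (fun x => prodBasis μ a x ^ 2) = 1 := by
  simpa [pow_two] using prodExp_basis_mul_basis hμ a a

/-- Bessel's inequality. -/
theorem sum_fourierCoeffProd_sq_le (hμ : ∀ i, μ i ∈ Set.Ioo (-1 : ℝ) 1) (h : Cube n → ℝ) :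
    ∑ a, fourierCoeffProd μ h a ^ 2 ≤ prodExp μ (fun x => h x ^ 2) := by
  -- The mean square distance from `h` to its Fourier expansion, computed by orthonormality; it is
  -- nonnegative.
  have key : prodExp μ (fun x => (h x - ∑ a, fourierCoeffProd μ h a * prodBasis μ a x) ^ 2) =
      prodExp μ (fun x => h x ^ 2) - ∑ a, fourierCoeffProd μ h a ^ 2 := by
    have h1 : prodExp μ (fun x => h x * ∑ a, fourierCoeffProd μ h a * prodBasis μ a x) =
        ∑ a, fourierCoeffProd μ h a ^ 2 := by
      simp only [Finset.mul_sum, prodExp_sum]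
      refine Finset.sum_congr rfl fun a _ => ?_
      rw [pow_two]
      nth_rw 3 [fourierCoeffProd]
      rw [← prodExp_const_mul]
      congr 1; funext x; ring
    have h2 : prodExp μ (fun x => (∑ a, fourierCoeffProd μ h a * prodBasis μ a x) *
        ∑ a, fourierCoeffProd μ h a * prodBasis μ a x) = ∑ a, fourierCoeffProd μ h a ^ 2 := by
      simp only [Finset.sum_mul_sum, prodExp_sum]
      refine Finset.sum_congr rfl fun a _ => ?_
      have : ∀ b, prodExp μ (fun x => fourierCoeffProd μ h a * prodBasis μ a x *
          (fourierCoeffProd μ h b * prodBasis μ b x)) =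
          if a = b then fourierCoeffProd μ h a * fourierCoeffProd μ h b else 0 := fun b => by
        rw [← mul_ite_zero, ← mul_boole, ← mul_assoc, ← prodExp_basis_mul_basis hμ,
          ← prodExp_const_mul]
        congr 1; funext x; ring
      simp [this, pow_two]
    have : (fun x => (h x - ∑ a, fourierCoeffProd μ h a * prodBasis μ a x) ^ 2) = fun x =>
        h x ^ 2 - 2 * (h x * ∑ a, fourierCoeffProd μ h a * prodBasis μ a x) +
        (∑ a, fourierCoeffProd μ h a * prodBasis μ a x) *
        ∑ a, fourierCoeffProd μ h a * prodBasis μ a x := by funext x; ring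
    rw [this, prodExp_add, prodExp_sub, prodExp_const_mul, h1, h2]
    ring
  linarith [prodExp_nonneg hμ (f := fun x =>
    (h x - ∑ a, fourierCoeffProd μ h a * prodBasis μ a x) ^ 2) fun x => sq_nonneg _]

theorem prodWeight_mixPoint_mul (μ : Fin n → ℝ) (r : ℕ) (x y : Cube n) :
    prodWeight μ (mixPoint r y x) * prodWeight μ (mixPoint r x y) =
      prodWeight μ y * prodWeight μ x := by
  simp only [prodWeight, ← Finset.prod_mul_distrib, mixPoint]
  refine Finset.prod_congr rfl fun i _ => ?_
  by_cases h : i.1 < r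
  · simp only [h, if_true]; ring
  · simp only [h, if_false]

theorem mixPoint_mixPoint (r : ℕ) (x y : Cube n) :
    mixPoint r (mixPoint r y x) (mixPoint r x y) = y := by
  funext i; simp only [mixPoint]; split_ifs <;> rfl

/-- The mixture of two independent points has the same distribution. -/
theorem prodExp_mixPoint (μ : Fin n → ℝ) (r : ℕ) (F : Cube n → Cube n → ℝ) :
    prodExp μ (fun x => prodExp μ fun y => F (mixPoint r y x) (mixPoint r x y)) =
      prodExp μ (fun x => prodExp μ fun y => F y x) := by
  simp only [prodExp, Finset.mul_sum]
  rw [← Fintype.sum_prod_type', ← Fintype.sum_prod_type']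
  -- Exchanging the coordinates below `r` between two points is an involution that preserves the
  -- product of their weights.
  let e : Cube n × Cube n → Cube n × Cube n := fun p =>
    (mixPoint r p.1 p.2, mixPoint r p.2 p.1)
  have he : Function.Involutive e := fun p =>
    Prod.ext (mixPoint_mixPoint r p.2 p.1) (mixPoint_mixPoint r p.1 p.2)
  rw [← he.bijective.sum_comp]
  refine Finset.sum_congr rfl fun p _ => ?_
  simp only [e, ← mul_assoc]
  rw [mul_comm (prodWeight μ (mixPoint r p.1 p.2)), prodWeight_mixPoint_mul,
    mixPoint_mixPoint, mixPoint_mixPoint]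
  ring_nf

end Fourier

/-! ### Branch weights and their estimation from pairs of points -/

section Pairs

variable {n : ℕ} {μ : Fin n → ℝ}

theorem prodBasis_mixPoint_of_le {r : ℕ} {a : Finset (Fin n)} (ha : ∀ j ∈ a, r ≤ j.1)
    (y x : Cube n) : prodBasis μ a (mixPoint r y x) = prodBasis μ a y :=
  Finset.prod_congr rfl fun j hj => by
    simp [Cube.coord, mixPoint, not_lt.2 (ha j hj)]

theorem prodBasis_mixPoint_of_lt {r : ℕ} {a : Finset (Fin n)} (ha : ∀ j ∈ a, j.1 < r)
    (y x : Cube n) : prodBasis μ a (mixPoint r y x) = prodBasis μ a x :=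
  Finset.prod_congr rfl fun j hj => by
    simp [Cube.coord, mixPoint, ha j hj]

theorem mixPoint_mixPoint_right (r : ℕ) (y y' z : Cube n) :
    mixPoint r y (mixPoint r y' z) = mixPoint r y z := by
  funext i; simp only [mixPoint]; split_ifs <;> rfl

theorem prodExp_resample (μ : Fin n → ℝ) (r : ℕ) (F : Cube n → ℝ) :
    prodExp μ (fun z => prodExp μ fun y => F (mixPoint r y z)) = prodExp μ F := by
  rw [prodExp_mixPoint μ r fun y _ => F y, prodExp_const]

/-- The indices in `a` that are at least `r`. -/
def upper (r : ℕ) (a : Finset (Fin n)) : Finset (Fin n) := a.filter fun j => r ≤ j.1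

/-- The sum of the squares of the coefficients whose index agrees with `a` from `r` on. -/
noncomputable def upperWeight (μ : Fin n → ℝ) (g : Cube n → ℝ) (a : Finset (Fin n)) (r : ℕ) : ℝ :=
  prodExp μ fun z => (prodExp μ fun y => g (mixPoint r y z) * prodBasis μ a y) ^ 2

/-- Given the shared coordinates `z` below `r`, the two factors of `pairVal` are independent with
the same mean, so the conditional expectation of their product is a square. Since `a` lies above
`r`, its basis function does not see `z`. -/
theorem prodExp_pairVal (g : Cube n → ℝ) {a : Finset (Fin n)} {r : ℕ} (ha : ∀ j ∈ a, r ≤ j.1) :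
    prodExp μ (fun x => prodExp μ fun y => pairVal μ g a r x y) = upperWeight μ g a r := by
  rw [← prodExp_resample μ r, upperWeight]
  refine congrArg _ (funext fun z => ?_)
  simp only [pairVal, prodBasis_mixPoint_of_le ha, mixPoint_mixPoint_right, prodExp_const_mul,
    prodExp_mul_const, pow_two]

/-- As `|g| ≤ 1`, what remains is the product of φ_a² at two independent points. The bound does not
depend on μ, although `pairVal` has no such pointwise bound; it is what Chebyshev's inequality
needs. -/
theorem prodExp_pairVal_sq_le (hμ : ∀ i, μ i ∈ Set.Ioo (-1 : ℝ) 1) {g : Cube n → ℝ}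
    (hg : ∀ x, g x ∈ Set.Icc (-1 : ℝ) 1) {a : Finset (Fin n)} {r : ℕ} (ha : ∀ j ∈ a, r ≤ j.1) :
    prodExp μ (fun x => prodExp μ fun y => pairVal μ g a r x y ^ 2) ≤ 1 := by
  have hg' : ∀ x, g x ^ 2 ≤ 1 := fun x => by
    rw [sq_le_one_iff_abs_le_one, abs_le]; exact hg x
  calc prodExp μ (fun x => prodExp μ fun y => pairVal μ g a r x y ^ 2)
      ≤ prodExp μ (fun x => prodExp μ fun y => prodBasis μ a x ^ 2 * prodBasis μ a y ^ 2) := by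
        refine prodExp_mono hμ fun x => prodExp_mono hμ fun y => ?_
        rw [pairVal, prodBasis_mixPoint_of_le ha]
        calc _ = (g x ^ 2 * g (mixPoint r y x) ^ 2) *
              (prodBasis μ a x ^ 2 * prodBasis μ a y ^ 2) := by ring
          _ ≤ 1 * (prodBasis μ a x ^ 2 * prodBasis μ a y ^ 2) := by
              refine mul_le_mul_of_nonneg_right ?_ (by positivity)
              exact mul_le_one₀ (hg' _) (sq_nonneg _) (hg' _)
          _ = _ := one_mul _
    _ = 1 := by simp only [prodExp_const_mul, prodExp_basis_sq hμ, mul_one]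

theorem prodExp_single_sq_le (hμ : ∀ i, μ i ∈ Set.Ioo (-1 : ℝ) 1) {g : Cube n → ℝ}
    (hg : ∀ x, g x ∈ Set.Icc (-1 : ℝ) 1) (a : Finset (Fin n)) :
    prodExp μ (fun x => (g x * prodBasis μ a x) ^ 2) ≤ 1 := by
  rw [← prodExp_basis_sq hμ a]
  refine prodExp_mono hμ fun x => ?_
  rw [mul_pow]
  exact mul_le_of_le_one_left (sq_nonneg _) (by
    rw [sq_le_one_iff_abs_le_one, abs_le]; exact hg x)

/-- The basis function of `b` is the product of a part below `r`, a function of `z` alone, and a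
part from `r` on. Averaging over the latter first, Cauchy-Schwarz against the former, of norm 1,
gives the bound. -/
theorem sq_fourierCoeffProd_le (hμ : ∀ i, μ i ∈ Set.Ioo (-1 : ℝ) 1) (g : Cube n → ℝ)
    (b : Finset (Fin n)) (r : ℕ) :
    fourierCoeffProd μ g b ^ 2 ≤ upperWeight μ g (upper r b) r := by
  have hb : ∀ y z, prodBasis μ b (mixPoint r y z) =
      prodBasis μ (b.filter fun j => ¬ r ≤ j.1) z * prodBasis μ (upper r b) y := fun y z => by
    rw [← prodBasis_mixPoint_of_le (r := r) (a := upper r b) (by simp [upper]) y z,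
      ← prodBasis_mixPoint_of_lt (r := r) (a := b.filter fun j => ¬ r ≤ j.1) (by simp) y z, mul_comm]
    exact (Finset.prod_filter_mul_prod_filter_not _ _ _).symm
  have : fourierCoeffProd μ g b = prodExp μ fun z =>
      prodBasis μ (b.filter fun j => ¬ r ≤ j.1) z *
        prodExp μ fun y => g (mixPoint r y z) * prodBasis μ (upper r b) y := by
    rw [fourierCoeffProd, ← prodExp_resample μ r]
    refine congrArg _ (funext fun z => ?_)
    rw [← prodExp_const_mul]
    refine congrArg _ (funext fun y => ?_)
    rw [hb]; ring
  rw [this]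
  refine (sq_prodExp_mul_le hμ _ _).trans ?_
  rw [prodExp_basis_sq hμ, one_mul, upperWeight]

/-- For each fixed `z` this is Bessel's inequality for `y ↦ g (mixPoint r y z)`, which is bounded by
1; then one averages over `z`. -/
theorem sum_upperWeight_le (hμ : ∀ i, μ i ∈ Set.Ioo (-1 : ℝ) 1) {g : Cube n → ℝ}
    (hg : ∀ x, g x ∈ Set.Icc (-1 : ℝ) 1) (r : ℕ) : ∑ a, upperWeight μ g a r ≤ 1 := by
  simp only [upperWeight]
  rw [← prodExp_sum]
  calc prodExp μ (fun z => ∑ a, (prodExp μ fun y => g (mixPoint r y z) * prodBasis μ a y) ^ 2)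
      ≤ prodExp μ fun _ => 1 := by
        refine prodExp_mono hμ fun z => ?_
        refine (sum_fourierCoeffProd_sq_le hμ fun y => g (mixPoint r y z)).trans ?_
        rw [← prodExp_const μ 1]
        exact prodExp_mono hμ fun y => by
          rw [sq_le_one_iff_abs_le_one, abs_le]; exact hg _
    _ = 1 := prodExp_const μ 1

theorem upperWeight_nonneg (hμ : ∀ i, μ i ∈ Set.Ioo (-1 : ℝ) 1) (g : Cube n → ℝ)
    (a : Finset (Fin n)) (r : ℕ) : 0 ≤ upperWeight μ g a r :=
  prodExp_nonneg hμ fun _ => sq_nonneg _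

end Pairs

/-! ### The potential -/

theorem clip_eq_or (s : ℝ) : clip s = s ∨ (clip s = 1 ∧ 1 ≤ s) ∨ (clip s = -1 ∧ s ≤ -1) := by
  rcases le_total s (-1) with h | h
  · exact .inr (.inr ⟨by rw [clip, min_eq_right (by linarith), max_eq_left h], h⟩)
  · rcases le_total s 1 with h' | h'
    · exact .inl (by rw [clip, min_eq_right h', max_eq_right h])
    · exact .inr (.inl ⟨by rw [clip, min_eq_left h']; norm_num, h'⟩)

/-- The variational inequality of the nearest-point projection to [-1,1]. Both facts about `huber`
below follow from it by completing a square. -/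
theorem clip_proj (s : ℝ) {c : ℝ} (hc : c ∈ Set.Icc (-1 : ℝ) 1) :
    0 ≤ (s - clip s) * (clip s - c) := by
  obtain ⟨h1, h2⟩ := hc
  rcases clip_eq_or s with h | ⟨h, h'⟩ | ⟨h, h'⟩
  · rw [h]; simp
  · rw [h]; exact mul_nonneg (by linarith) (by linarith)
  · rw [h]; exact mul_nonneg_of_nonpos_of_nonpos (by linarith) (by linarith)

/-- The primitive of `clip` that vanishes at `0`. -/
noncomputable def huber (s : ℝ) : ℝ := s * clip s - clip s ^ 2 / 2

/-- Smoothness: the derivative clip of `huber` is 1-Lipschitz. Algebraically, the gap is the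
expression of `clip_proj` at `c = clip (s + h)` plus half the square of `clip s - clip (s + h) + h`.
-/
theorem huber_add_le (s h : ℝ) : huber (s + h) ≤ huber s + clip s * h + h ^ 2 / 2 := by
  unfold huber
  nlinarith [clip_proj s (clip_mem (s + h)), sq_nonneg (clip s - clip (s + h) + h)]

/-- The difference `huber s - c * s` equals the expression of `clip_proj` plus `(clip s - c)² / 2 -
c² / 2`. -/
theorem le_huber_sub (s : ℝ) {c : ℝ} (hc : c ∈ Set.Icc (-1 : ℝ) 1) : -(1 / 2) ≤ huber s - c * s := by
  have h : c ^ 2 ≤ 1 := by rw [sq_le_one_iff_abs_le_one, abs_le]; exact hc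
  unfold huber
  nlinarith [clip_proj s hc, sq_nonneg (clip s - c)]

/-- The potential of a function with values in the reals, in the approximation of `f`. -/
noncomputable def potential {n : ℕ} (μ : Fin n → ℝ) (f G : Cube n → ℝ) : ℝ :=
  prodExp μ fun x => huber (G x) - f x * G x

theorem potential_zero {n : ℕ} (μ : Fin n → ℝ) (f : Cube n → ℝ) :
    potential μ f (fun _ => 0) = 0 := by
  have : clip 0 = 0 := by rw [clip, min_eq_right (by norm_num), max_eq_right (by norm_num)]
  simp [potential, huber, this, prodExp]

theorem le_potential {n : ℕ} {μ : Fin n → ℝ} (hμ : ∀ i, μ i ∈ Set.Ioo (-1 : ℝ) 1)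
    {f : Cube n → ℝ} (hf : ∀ x, f x ∈ Set.Icc (-1 : ℝ) 1) (G : Cube n → ℝ) :
    -(1 / 2) ≤ potential μ f G := by
  rw [← prodExp_const μ (-(1 / 2))]
  exact prodExp_mono hμ fun x => le_huber_sub _ (hf x)

/-- The pointwise smoothness bound is averaged. Normalisation of the basis makes the quadratic term
`c² / 2`, whatever `a` and `μ` are. -/
theorem potential_add_le {n : ℕ} {μ : Fin n → ℝ} (hμ : ∀ i, μ i ∈ Set.Ioo (-1 : ℝ) 1)
    (f G : Cube n → ℝ) (c : ℝ) (a : Finset (Fin n)) :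
    potential μ f (fun x => G x + c * prodBasis μ a x) ≤ potential μ f G +
      c * (fourierCoeffProd μ (fun x => clip (G x)) a - fourierCoeffProd μ f a) + c ^ 2 / 2 := by
  have h : potential μ f (fun x => G x + c * prodBasis μ a x) ≤ prodExp μ fun x =>
      (huber (G x) - f x * G x) + c * (clip (G x) * prodBasis μ a x - f x * prodBasis μ a x) +
        c ^ 2 / 2 * prodBasis μ a x ^ 2 := by
    refine prodExp_mono hμ fun x => ?_
    have := huber_add_le (G x) (c * prodBasis μ a x)
    nlinarith
  rw [prodExp_add, prodExp_add, prodExp_const_mul, prodExp_const_mul, prodExp_basis_sq hμ,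
    mul_one, prodExp_sub μ fun x => clip (G x) * _] at h
  exact h

/-! ### Correctness of the search for good samples -/

open Classical in
/-- The number of groups `i < R` in which the mean of `F` deviates from `e` by more than `τ`. -/
noncomputable def devCount (R M : ℕ) (F : ℕ → ℝ) (e τ : ℝ) : ℕ :=
  ((Finset.range R).filter fun i => τ * M < |∑ k ∈ Finset.range M, F (i * M + k) - M * e|).card

/-- Allows the low test to be treated as a high test for the negated sequence. -/
theorem devCount_neg (R M : ℕ) (F : ℕ → ℝ) (e τ : ℝ) :
    devCount R M (-F) (-e) τ = devCount R M F e τ := by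
  classical
  have : ∀ x : ℝ, |-x - M * -e| = |x - M * e| := fun x => by rw [← abs_neg]; congr 1; ring
  simp only [devCount, Pi.neg_apply, Finset.sum_neg_distrib, this]

/-- A group that does not deviate has its mean within τ of `e`, hence above θ. Since most groups do
not deviate, most exceed the threshold. -/
theorem lt_countAbove {R M : ℕ} {F : ℕ → ℝ} {e τ θ : ℝ} (hM : 0 < M)
    (h : 2 * devCount R M F e τ < R) (he : θ + τ < e) : R < 2 * countAbove R M F (θ * M) := by
  classical
  have hle : R ≤ devCount R M F e τ + countAbove R M F (θ * M) := by
    conv_lhs => rw [← Finset.card_range R]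
    rw [devCount, countAbove]
    refine (Finset.card_le_card fun i hi => ?_).trans (Finset.card_union_le _ _)
    simp only [Finset.mem_union, Finset.mem_filter]
    refine (lt_or_ge (τ * M) _).imp (fun h => ⟨hi, h⟩) fun h => ⟨hi, ?_⟩
    have := (abs_le.1 h).1
    have : (0 : ℝ) < M := Nat.cast_pos.2 hM
    nlinarith
  omega

/-- If `e` were at most θ - τ, every group that exceeds the threshold would deviate, and these are
fewer than half. -/
theorem lt_of_lt_countAbove {R M : ℕ} {F : ℕ → ℝ} {e τ θ : ℝ} (hM : 0 < M)
    (h : 2 * devCount R M F e τ < R) (h' : R < 2 * countAbove R M F (θ * M)) : θ - τ < e := by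
  classical
  by_contra! he
  have : countAbove R M F (θ * M) ≤ devCount R M F e τ := by
    refine Finset.card_le_card fun i hi => ?_
    simp only [Finset.mem_filter] at hi ⊢
    refine ⟨hi.1, lt_of_lt_of_le ?_ (le_abs_self _)⟩
    have : (0 : ℝ) < M := Nat.cast_pos.2 hM
    nlinarith [hi.2]
  omega

/-- The samples estimate all relevant expectations well in more than half of the groups. -/
structure SearchParams.GoodSample {n : ℕ} (P : SearchParams n) : Prop where
  pair : ∀ c < P.maxCount, ∀ u : ℕ → Finset (Fin n) × Bool, ∀ r < n, ∀ a : Finset (Fin n),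
    (∀ j ∈ a, r ≤ j.1) → 2 * devCount P.groups P.groupSize
      (pairSeq P.mean (clippedSum P.mean P.gam c u) a r P.sample)
      (upperWeight P.mean (clippedSum P.mean P.gam c u) a r) (4 * (P.gam * P.gam)) < P.groups
  single : ∀ c < P.maxCount, ∀ u : ℕ → Finset (Fin n) × Bool, ∀ a : Finset (Fin n),
    2 * devCount P.groups P.groupSize
      (singleSeq P.mean (clippedSum P.mean P.gam c u) a P.sample)
      (fourierCoeffProd P.mean (clippedSum P.mean P.gam c u) a) P.gam < P.groups

/-- The conditions under which the search finds a good approximation of `f`. -/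
structure SearchParams.Sound {n : ℕ} (P : SearchParams n) (f : Cube n → ℝ)
    (val : Finset (Fin n) → ℝ) (q : ℕ → Finset (Fin n) × ℕ) : Prop where
  mean : ∀ i, P.mean i ∈ Set.Ioo (-1 : ℝ) 1
  bounded : ∀ x, f x ∈ Set.Icc (-1 : ℝ) 1
  gam : 0 < P.gam
  size : 0 < P.groupSize
  maxCount : 1 < P.maxCount * P.gam ^ 2
  maxTail : P.len + 1 + n * P.maxCount < P.maxTail
  approx : ∀ a : Finset (Fin n), a.card ≤ P.deg → |fourierCoeffProd P.mean f a - val a| ≤ P.gam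
  root : q P.len = (∅, n)
  leaf : ∀ i < P.len, (q i).2 = 0
  listed : ∀ a, val a ≠ 0 → ∃ i < P.len, (q i).1 = a
  lookup : ∀ a : Finset (Fin n), a.card ≤ P.deg → lookupVal q P.coeff a P.len = val a
  good : P.GoodSample

theorem lookupVal_congr {n : ℕ} {q q' : ℕ → Finset (Fin n) × ℕ} (V : ℕ → ℝ) (a : Finset (Fin n))
    {s : ℕ} (h : ∀ i < s, q i = q' i) : lookupVal q V a s = lookupVal q' V a s := by
  induction s with
  | zero => rfl
  | succ s ih => rw [lookupVal, lookupVal, ih fun i hi => h i (by omega), h s (by omega)]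

theorem mem_setBit {n : ℕ} {b : Bool} {a : Finset (Fin n)} {i : ℕ} {j : Fin n} :
    j ∈ setBit b a i ↔ if j.1 = i then b = true else j ∈ a := by simp [setBit]

/-- In the search tree a child determines its parent and its branch bit; this keeps the items of the
queue distinct. -/
theorem setBit_injective {n i : ℕ} (hi : i < n) {b b' : Bool} {a a' : Finset (Fin n)}
    (ha : ∀ j ∈ a, i < j.1) (ha' : ∀ j ∈ a', i < j.1) (h : setBit b a i = setBit b' a' i) :
    b = b' ∧ a = a' := by
  rw [Finset.ext_iff] at h
  refine ⟨?_, Finset.ext fun j => ?_⟩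
  · have := h ⟨i, hi⟩
    simp only [mem_setBit, if_true] at this
    cases b <;> cases b' <;> simp_all
  · have := h j
    simp only [mem_setBit] at this
    split_ifs at this with hj
    · exact iff_of_false (fun h => by have := ha j h; omega) (fun h => by have := ha' j h; omega)
    · exact this

/-- One step on the path from the root to `a`: the ancestor on the next level arises by deciding
coordinate `r - 1` as in `a`. -/
theorem upper_eq_setBit {n r : ℕ} (hr : 0 < r) (hn : r ≤ n) (a : Finset (Fin n)) :
    upper (r - 1) a = setBit (decide ((⟨r - 1, by omega⟩ : Fin n) ∈ a)) (upper r a) (r - 1) := by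
  ext j
  simp only [upper, Finset.mem_filter, mem_setBit, decide_eq_true_eq]
  split_ifs with hj
  · have : j = ⟨r - 1, by omega⟩ := Fin.ext hj
    rw [← this]; simp [hj]
  · exact and_congr_right fun _ => by omega

/-! ### Accuracy of the tests on good samples -/

namespace SearchState

variable {n : ℕ} {P : SearchParams n} {f : Cube n → ℝ} {val : Finset (Fin n) → ℝ}
  {q : ℕ → Finset (Fin n) × ℕ} {σ : SearchState n}

theorem fn_mem (P : SearchParams n) (σ : SearchState n) (x : Cube n) :
    σ.fn P x ∈ Set.Icc (-1 : ℝ) 1 := clip_mem _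

theorem pairTest_of_lt (hP : P.Sound f val q) (hc : σ.count < P.maxCount) {r : ℕ} (hr : r < n)
    {a : Finset (Fin n)} (ha : ∀ j ∈ a, r ≤ j.1)
    (h : 16 * P.gam ^ 2 < upperWeight P.mean (σ.fn P) a r) : σ.PairTest P a r :=
  lt_countAbove hP.size (hP.good.pair _ hc σ.terms r hr a ha)
    (lt_of_eq_of_lt (by ring) h)

theorem lt_of_pairTest (hP : P.Sound f val q) (hc : σ.count < P.maxCount) {r : ℕ} (hr : r < n)
    {a : Finset (Fin n)} (ha : ∀ j ∈ a, r ≤ j.1) (h : σ.PairTest P a r) :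
    8 * P.gam ^ 2 < upperWeight P.mean (σ.fn P) a r :=
  lt_of_eq_of_lt (by ring) (lt_of_lt_countAbove hP.size (hP.good.pair _ hc σ.terms r hr a ha) h)

theorem lt_of_highTest (hP : P.Sound f val q) (hc : σ.count < P.maxCount) {a : Finset (Fin n)}
    {v : ℝ} (h : σ.HighTest P a v) : v + 2 * P.gam < fourierCoeffProd P.mean (σ.fn P) a :=
  lt_of_eq_of_lt (by ring) (lt_of_lt_countAbove hP.size (hP.good.single _ hc σ.terms a) h)

theorem lt_of_lowTest (hP : P.Sound f val q) (hc : σ.count < P.maxCount) {a : Finset (Fin n)}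
    {v : ℝ} (h : σ.LowTest P a v) : fourierCoeffProd P.mean (σ.fn P) a < v - 2 * P.gam := by
  rw [LowTest, ← neg_mul] at h
  have := lt_of_lt_countAbove (e := -fourierCoeffProd P.mean (σ.fn P) a) (τ := P.gam) hP.size
    (by rw [devCount_neg]; exact hP.good.single _ hc σ.terms a) h
  linarith

theorem highTest_of_lt (hP : P.Sound f val q) (hc : σ.count < P.maxCount) {a : Finset (Fin n)}
    {v : ℝ} (h : v + 4 * P.gam < fourierCoeffProd P.mean (σ.fn P) a) : σ.HighTest P a v :=
  lt_countAbove hP.size (hP.good.single _ hc σ.terms a) (lt_of_eq_of_lt (by ring) h)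

theorem lowTest_of_lt (hP : P.Sound f val q) (hc : σ.count < P.maxCount) {a : Finset (Fin n)}
    {v : ℝ} (h : fourierCoeffProd P.mean (σ.fn P) a < v - 4 * P.gam) : σ.LowTest P a v := by
  rw [LowTest, ← neg_mul]
  exact lt_countAbove (e := -fourierCoeffProd P.mean (σ.fn P) a) (τ := P.gam) hP.size
    (by rw [devCount_neg]; exact hP.good.single _ hc σ.terms a) (by linarith)

/-! ### The invariant and the bounds that it implies -/

/-- The invariant of the search. The children `b ∈ B` of the first unprocessed item have been
treated already. -/
structure Inv (P : SearchParams n) (f : Cube n → ℝ) (val : Finset (Fin n) → ℝ)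
    (q : ℕ → Finset (Fin n) × ℕ) (B : Set Bool) (σ : SearchState n) : Prop where
  potential_le : potential P.mean f (fun x => P.gam * ∑ t ∈ Finset.range σ.count,
    boolSign (σ.terms t).2 * prodBasis P.mean (σ.terms t).1 x) ≤ -(σ.count * (P.gam ^ 2 / 2))
  le_tail : P.len + 1 ≤ σ.tail
  head_le : σ.head ≤ σ.tail
  init : ∀ i ≤ P.len, σ.queue i = q i
  le_dim : ∀ i, P.len ≤ i → i < σ.tail → (σ.queue i).2 ≤ n
  supp : ∀ i, P.len ≤ i → i < σ.tail → ∀ j ∈ (σ.queue i).1, (σ.queue i).2 ≤ j.1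
  parent : ∀ i, P.len < i → i < σ.tail → ∃ i', P.len ≤ i' ∧ i' < σ.tail ∧ 0 < (σ.queue i').2 ∧
    ∃ b, σ.queue i = (setBit b (σ.queue i').1 ((σ.queue i').2 - 1), (σ.queue i').2 - 1) ∧
      (i' < σ.head ∨ i' = σ.head ∧ b ∈ B)
  inj : ∀ i, P.len ≤ i → i < σ.tail → ∀ i', P.len ≤ i' → i' < σ.tail →
    σ.queue i = σ.queue i' → i = i'
  heavy : ∀ i, P.len < i → i < σ.tail →
    8 * P.gam ^ 2 < upperWeight P.mean (σ.fn P) (σ.queue i).1 (σ.queue i).2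
  complete : ∀ i, P.len ≤ i → i < σ.tail → 0 < (σ.queue i).2 → ∀ b,
    (i < σ.head ∨ i = σ.head ∧ b ∈ B) →
    σ.PairTest P (setBit b (σ.queue i).1 ((σ.queue i).2 - 1)) ((σ.queue i).2 - 1) →
    ∃ i', P.len ≤ i' ∧ i' < σ.tail ∧
      σ.queue i' = (setBit b (σ.queue i).1 ((σ.queue i).2 - 1), (σ.queue i).2 - 1)
  correct : ∀ i < σ.head, (σ.queue i).2 = 0 → (σ.queue i).1.card ≤ P.deg →
    ¬ σ.HighTest P (σ.queue i).1 (val (σ.queue i).1) ∧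
    ¬ σ.LowTest P (σ.queue i).1 (val (σ.queue i).1)

variable {B : Set Bool}

/-- Each term has lowered the potential by γ²/2, and the potential is at least -1/2, so `count * γ²
≤ 1 < maxCount * γ²`. -/
theorem Inv.count_lt (h : σ.Inv P f val q B) (hP : P.Sound f val q) : σ.count < P.maxCount := by
  have h1 := h.potential_le
  have h2 := le_potential hP.mean hP.bounded fun x => P.gam * ∑ t ∈ Finset.range σ.count,
    boolSign (σ.terms t).2 * prodBasis P.mean (σ.terms t).1 x
  have h3 := hP.maxCount
  have h4 : 0 < P.gam ^ 2 := pow_pos hP.gam 2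
  by_contra! h5
  have : (P.maxCount : ℝ) ≤ σ.count := Nat.cast_le.2 h5
  nlinarith

theorem Inv.rem_lt (h : σ.Inv P f val q B) {i : ℕ} (h1 : P.len < i) (h2 : i < σ.tail) :
    (σ.queue i).2 < n := by
  obtain ⟨i', hi', hi'', hpos, b, hb, -⟩ := h.parent i h1 h2
  have := h.le_dim i' hi' hi''
  rw [hb]
  simp only
  omega

/-- The items behind the root are distinct and lie on `n` levels, each of total weight at most 1,
while each item weighs more than γ². So there are at most `n * maxCount` of them, and the cap on the
queue never suppresses an item. -/
theorem Inv.tail_lt (h : σ.Inv P f val q B) (hP : P.Sound f val q) : σ.tail < P.maxTail := by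
  have h0 : 0 < P.gam ^ 2 := pow_pos hP.gam 2
  have h1 : ∑ i ∈ Finset.Ioo P.len σ.tail,
      upperWeight P.mean (σ.fn P) (σ.queue i).1 (σ.queue i).2 ≤ n := by
    have : ∑ i ∈ Finset.Ioo P.len σ.tail,
        upperWeight P.mean (σ.fn P) (σ.queue i).1 (σ.queue i).2 ≤
        ∑ p ∈ (Finset.univ : Finset (Finset (Fin n))) ×ˢ Finset.range n,
          upperWeight P.mean (σ.fn P) p.1 p.2 := by
      rw [← Finset.sum_image (s := Finset.Ioo P.len σ.tail) (g := σ.queue)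
        (f := fun p => upperWeight P.mean (σ.fn P) p.1 p.2)]
      · refine Finset.sum_le_sum_of_subset_of_nonneg (fun p hp => ?_) fun p _ _ =>
          upperWeight_nonneg hP.mean _ _ _
        obtain ⟨i, hi, rfl⟩ := Finset.mem_image.1 hp
        rw [Finset.mem_Ioo] at hi
        simpa using h.rem_lt hi.1 hi.2
      · intro i hi i' hi' he
        rw [Finset.coe_Ioo] at hi hi'
        exact h.inj i hi.1.le hi.2 i' hi'.1.le hi'.2 he
    refine this.trans ?_
    rw [Finset.sum_product_right]
    calc _ ≤ ∑ _r ∈ Finset.range n, (1 : ℝ) := Finset.sum_le_sum fun r _ =>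
          sum_upperWeight_le hP.mean (σ.fn_mem P) r
      _ = n := by simp
  have h2 : (Finset.Ioo P.len σ.tail).card * P.gam ^ 2 ≤ n := by
    refine le_trans ?_ h1
    rw [← nsmul_eq_mul]
    refine Finset.card_nsmul_le_sum _ _ _ fun i hi => ?_
    rw [Finset.mem_Ioo] at hi
    have := h.heavy i hi.1 hi.2
    linarith
  rw [Nat.card_Ioo] at h2
  have h3 : ((σ.tail - P.len - 1 : ℕ) : ℝ) ≤ (n * P.maxCount : ℕ) := by
    by_contra! h4
    push_cast at h4
    have h5 := hP.maxCount
    have h6 : (n : ℝ) ≤ n * (P.maxCount * P.gam ^ 2) :=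
      le_mul_of_one_le_right (Nat.cast_nonneg _) h5.le
    nlinarith
  have h4 := Nat.cast_le.1 h3
  have := hP.maxTail
  omega

end SearchState

/-! ### Preservation of the invariant and correctness of the result -/

namespace SearchState

variable {n : ℕ} {P : SearchParams n} {f : Cube n → ℝ} {val : Finset (Fin n) → ℝ}
  {q : ℕ → Finset (Fin n) × ℕ} {σ : SearchState n} {B : Set Bool}

theorem Inv.child_supp (h : σ.Inv P f val q B) {i : ℕ} (h1 : P.len ≤ i) (h2 : i < σ.tail)
    (hpos : 0 < (σ.queue i).2) (b : Bool) :
    ∀ j ∈ setBit b (σ.queue i).1 ((σ.queue i).2 - 1), (σ.queue i).2 - 1 ≤ j.1 := by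
  intro j hj
  rw [mem_setBit] at hj
  split_ifs at hj with hj'
  · omega
  · have := h.supp i h1 h2 j hj; omega

/-- A child of the first unprocessed item that has not been treated yet is not in the queue. -/
theorem Inv.child_ne (h : σ.Inv P f val q B) (hlen : P.len ≤ σ.head) (hlt : σ.head < σ.tail)
    (hpos : 0 < (σ.queue σ.head).2) {b : Bool} (hb : b ∉ B) {i : ℕ} (h1 : P.len ≤ i)
    (h2 : i < σ.tail) (hq : q P.len = (∅, n)) : σ.queue i ≠
      (setBit b (σ.queue σ.head).1 ((σ.queue σ.head).2 - 1), (σ.queue σ.head).2 - 1) := by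
  intro he
  have hdim := h.le_dim _ hlen hlt
  rcases h1.eq_or_lt with rfl | h1
  · rw [h.init _ le_rfl, hq, Prod.ext_iff] at he
    simp only at he
    omega
  · obtain ⟨i', hi', hi'', hpos', b', hb', hor⟩ := h.parent i h1 h2
    rw [hb', Prod.ext_iff] at he
    simp only at he
    have hr : (σ.queue i').2 = (σ.queue σ.head).2 := by omega
    rw [hr] at he
    have hs := h.supp _ hlen hlt
    have hs' := h.supp _ hi' hi''
    obtain ⟨hbb, haa⟩ := setBit_injective (i := (σ.queue σ.head).2 - 1) (by omega)
      (fun j hj => by have := hs' j hj; omega) (fun j hj => by have := hs j hj; omega) he.1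
    have := h.inj i' hi' hi'' _ hlen hlt (Prod.ext haa hr)
    subst this
    rcases hor with hor | ⟨-, hor⟩
    · exact lt_irrefl _ hor
    · exact hb (hbb ▸ hor)

theorem Inv.pushChild (h : σ.Inv P f val q B) (hP : P.Sound f val q) (hlt : σ.head < σ.tail)
    (hpos : 0 < (σ.queue σ.head).2) {b : Bool} (hb : b ∉ B) :
    (σ.pushChild P b).Inv P f val q (insert b B) := by
  -- Items before the root are listed indices and hence leaves; an item with undecided coordinates
  -- belongs to the tree.
  have hlen : P.len ≤ σ.head := by
    by_contra! hlt'
    rw [h.init _ hlt'.le, hP.leaf _ hlt'] at hpos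
    exact lt_irrefl _ hpos
  have hne := fun {i} h1 h2 => h.child_ne hlen hlt hpos hb (i := i) h1 h2 hP.root
  have hsupp := h.child_supp hlen hlt hpos b
  have hdim := h.le_dim _ hlen hlt
  have hrec : ∀ {i c}, (i < σ.head ∨ i = σ.head ∧ c ∈ insert b B) →
      (i < σ.head ∨ i = σ.head ∧ c ∈ B) ∨ i = σ.head ∧ c = b := by
    rintro i c (hi | ⟨rfl, rfl | hc⟩)
    exacts [.inl (.inl hi), .inr ⟨rfl, rfl⟩, .inl (.inr ⟨rfl, hc⟩)]
  have hrec' : ∀ {i c}, (i < σ.head ∨ i = σ.head ∧ c ∈ B) →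
      (i < σ.head ∨ i = σ.head ∧ c ∈ insert b B) :=
    fun h => h.imp_right fun h => ⟨h.1, Set.mem_insert_of_mem _ h.2⟩
  rw [SearchState.pushChild, push]
  split_ifs with htest
  · have hold : ∀ {i}, i < σ.tail → Function.update σ.queue σ.tail
        (setBit b (σ.queue σ.head).1 ((σ.queue σ.head).2 - 1), (σ.queue σ.head).2 - 1) i =
        σ.queue i := fun hi => Function.update_of_ne hi.ne _ _
    have hnew : Function.update σ.queue σ.tail
        (setBit b (σ.queue σ.head).1 ((σ.queue σ.head).2 - 1), (σ.queue σ.head).2 - 1) σ.tail =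
        (setBit b (σ.queue σ.head).1 ((σ.queue σ.head).2 - 1), (σ.queue σ.head).2 - 1) :=
      Function.update_self _ _ _
    generalize Function.update σ.queue σ.tail _ = q' at hold hnew
    have hcase : ∀ {i}, i < σ.tail + 1 → i < σ.tail ∨ i = σ.tail := fun hi =>
      Nat.lt_succ_iff_lt_or_eq.1 hi
    exact
    { potential_le := h.potential_le
      le_tail := h.le_tail.trans (Nat.le_succ _)
      head_le := h.head_le.trans (Nat.le_succ _)
      init := fun i hi => (hold (lt_of_lt_of_le (by omega) h.le_tail)).trans (h.init i hi)
      le_dim := fun i h1 h2 => by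
        rcases hcase h2 with h2 | rfl
        · simp only [hold h2]; exact h.le_dim i h1 h2
        · simp only [hnew]; omega
      supp := fun i h1 h2 => by
        rcases hcase h2 with h2 | rfl
        · simp only [hold h2]; exact h.supp i h1 h2
        · simp only [hnew]; exact hsupp
      parent := fun i h1 h2 => by
        rcases hcase h2 with h2 | rfl
        · obtain ⟨i', hi', hi'', hpos', b', hb', hor⟩ := h.parent i h1 h2
          refine ⟨i', hi', Nat.lt_succ_of_lt hi'', ?_, b', ?_, hrec' hor⟩
          · simp only [hold hi'']; exact hpos'
          · simp only [hold hi'', hold h2]; exact hb'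
        · refine ⟨σ.head, hlen, Nat.lt_succ_of_lt hlt, ?_, b, ?_, .inr ⟨rfl, Set.mem_insert _ _⟩⟩
          · simp only [hold hlt]; exact hpos
          · simp only [hold hlt]; exact hnew
      inj := fun i h1 h2 i' h1' h2' he => by
        simp only at he
        rcases hcase h2 with h2 | rfl <;> rcases hcase h2' with h2' | rfl
        · rw [hold h2, hold h2'] at he
          exact h.inj i h1 h2 i' h1' h2' he
        · rw [hold h2, hnew] at he
          exact absurd he (hne h1 h2)
        · rw [hold h2', hnew] at he
          exact absurd he.symm (hne h1' h2')
        · rfl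
      heavy := fun i h1 h2 => by
        rcases hcase h2 with h2 | rfl
        · simp only [hold h2]; exact h.heavy i h1 h2
        · simp only [hnew]
          exact lt_of_pairTest (σ := σ) hP (h.count_lt hP) (by omega) hsupp htest.1
      complete := fun i h1 h2 hpos' c hor ht => by
        rcases hcase h2 with h2 | rfl
        · simp only [hold h2] at hpos' ht ⊢
          rcases hrec hor with hor | ⟨rfl, rfl⟩
          · obtain ⟨i', hi', hi'', he⟩ := h.complete i h1 h2 hpos' c hor ht
            exact ⟨i', hi', Nat.lt_succ_of_lt hi'', (hold hi'').trans he⟩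
          · exact ⟨σ.tail, by have := h.le_tail; omega, Nat.lt_succ_self _, hnew⟩
        · exfalso
          rcases hor with hor | hor
          · exact absurd hor (not_lt.2 h.head_le)
          · exact hlt.ne' hor.1
      correct := fun i hi => by
        simp only [hold (hi.trans hlt)]; exact h.correct i hi }
  · exact
    { h with
      parent := fun i h1 h2 => by
        obtain ⟨i', hi', hi'', hpos', b', hb', hor⟩ := h.parent i h1 h2
        exact ⟨i', hi', hi'', hpos', b', hb', hrec' hor⟩
      complete := fun i h1 h2 hpos' c hor ht => by
        rcases hrec hor with hor | ⟨rfl, rfl⟩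
        · exact h.complete i h1 h2 hpos' c hor ht
        -- A child that passes the test could be missing only if the queue were full, which
        -- `tail_lt` excludes.
        · exact absurd ⟨ht, h.tail_lt hP⟩ htest }

theorem Inv.advance (h : σ.Inv P f val q B) (hlt : σ.head < σ.tail)
    (hB : 0 < (σ.queue σ.head).2 → ∀ b, b ∈ B)
    (hleaf : (σ.queue σ.head).2 = 0 → (σ.queue σ.head).1.card ≤ P.deg →
      ¬ σ.HighTest P (σ.queue σ.head).1 (val (σ.queue σ.head).1) ∧
      ¬ σ.LowTest P (σ.queue σ.head).1 (val (σ.queue σ.head).1)) :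
    σ.advance.Inv P f val q ∅ :=
  { h with
    head_le := hlt
    parent := fun i h1 h2 => by
      obtain ⟨i', hi', hi'', hpos', b', hb', hor⟩ := h.parent i h1 h2
      refine ⟨i', hi', hi'', hpos', b', hb', .inl ?_⟩
      simp only [SearchState.advance]
      omega
    complete := fun i h1 h2 hpos' c hor ht => by
      refine h.complete i h1 h2 hpos' c ?_ ht
      rcases hor with hor | hor
      · rcases Nat.lt_succ_iff_lt_or_eq.1 hor with hor | rfl
        · exact .inl hor
        · exact .inr ⟨rfl, hB hpos' c⟩
      · exact hor.2.elim
    correct := fun i hi => by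
      rcases Nat.lt_succ_iff_lt_or_eq.1 hi with hi | rfl
      · exact h.correct i hi
      · exact hleaf }

/-- The linear term of `potential_add_le` is at most -γ², the quadratic one is γ²/2, so the
potential drops by γ²/2. The queue shrinks to the list and the root, which makes the conditions on
processed items and on children vacuous. -/
theorem Inv.addTerm (h : σ.Inv P f val q B) (hP : P.Sound f val q) (a : Finset (Fin n)) (b : Bool)
    (hab : boolSign b * (fourierCoeffProd P.mean (σ.fn P) a - fourierCoeffProd P.mean f a) ≤
      -P.gam) : (σ.addTerm P a b).Inv P f val q ∅ := by
  have hle := h.le_tail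
  have hgam := hP.gam
  refine
  { potential_le := ?_
    le_tail := le_rfl
    head_le := Nat.zero_le _
    init := h.init
    le_dim := fun i h1 h2 => h.le_dim i h1 (lt_of_lt_of_le h2 hle)
    supp := fun i h1 h2 => h.supp i h1 (lt_of_lt_of_le h2 hle)
    parent := fun i h1 h2 => by simp only [SearchState.addTerm] at h2; omega
    inj := fun i h1 h2 i' h1' h2' he => by simp only [SearchState.addTerm] at h2 h2'; omega
    heavy := fun i h1 h2 => by simp only [SearchState.addTerm] at h2; omega
    complete := fun i h1 h2 hpos' c hor ht => by
      rcases hor with hor | hor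
      · exact absurd hor (Nat.not_lt_zero _)
      · exact hor.2.elim
    correct := fun i hi => absurd hi (Nat.not_lt_zero _) }
  have hsum : (fun x => P.gam * ∑ t ∈ Finset.range (σ.addTerm P a b).count,
      boolSign ((σ.addTerm P a b).terms t).2 *
        prodBasis P.mean ((σ.addTerm P a b).terms t).1 x) = fun x =>
      P.gam * ∑ t ∈ Finset.range σ.count, boolSign (σ.terms t).2 *
        prodBasis P.mean (σ.terms t).1 x + P.gam * boolSign b * prodBasis P.mean a x := by
    funext x
    simp only [SearchState.addTerm, Finset.sum_range_succ, Function.update_self]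
    rw [mul_add, mul_assoc]
    congr 2
    refine Finset.sum_congr rfl fun t ht => ?_
    rw [Function.update_of_ne (Finset.mem_range.1 ht).ne]
  rw [hsum]
  refine (potential_add_le hP.mean _ _ _ _).trans ?_
  have h1 := h.potential_le
  have h2 : (P.gam * boolSign b) ^ 2 = P.gam ^ 2 := by
    unfold boolSign; split_ifs <;> ring
  have h3 := mul_le_mul_of_nonneg_left hab hgam.le
  rw [h2, mul_assoc]
  change _ + P.gam * (boolSign b * (fourierCoeffProd P.mean (σ.fn P) a - _)) + _ ≤ _
  simp only [SearchState.addTerm]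
  push_cast
  nlinarith

theorem Inv.step (h : σ.Inv P f val q ∅) (hP : P.Sound f val q) (hσ : σ.Active P) :
    (σ.step P).Inv P f val q ∅ := by
  have hlt := hσ.1
  have hc := hσ.2
  unfold SearchState.step
  split_ifs with hpos
  · have h1 := h.pushChild hP hlt hpos (b := true) (by simp)
    have hlt1 : (σ.pushChild P true).head < (σ.pushChild P true).tail := by
      rw [SearchState.pushChild, push_head]; exact hlt.trans_le (le_push_tail _ _ _ _)
    have hq1 : (σ.pushChild P true).queue (σ.pushChild P true).head = σ.queue σ.head := by
      rw [SearchState.pushChild, push_head, push_queue_of_lt _ _ _ hlt]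
    have h2 := h1.pushChild hP hlt1 (by rw [hq1]; exact hpos) (b := false) (by simp)
    have hlt2 : ((σ.pushChild P true).pushChild P false).head <
        ((σ.pushChild P true).pushChild P false).tail := by
      rw [SearchState.pushChild, push_head]; exact hlt1.trans_le (le_push_tail _ _ _ _)
    have hq2 : ((σ.pushChild P true).pushChild P false).queue
        ((σ.pushChild P true).pushChild P false).head = σ.queue σ.head := by
      rw [SearchState.pushChild, push_head, push_queue_of_lt _ _ _ hlt1, hq1]
    refine h2.advance hlt2 (fun _ b => by cases b <;> simp) fun h0 => ?_
    rw [hq2] at h0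
    omega
  · have hlook : (σ.queue σ.head).1.card ≤ P.deg →
        lookupVal σ.queue P.coeff (σ.queue σ.head).1 P.len = val (σ.queue σ.head).1 := fun hd => by
      rw [← hP.lookup _ hd]
      exact lookupVal_congr _ _ fun i hi => h.init i hi.le
    simp only [stepLeaf]
    split_ifs with hH hL
    · rw [hlook hH.1] at hH
      refine h.addTerm hP _ _ ?_
      -- The coefficient of `fn` exceeds the given value by more than 2γ, and the given value is
      -- within γ of that of `f`; a true excess of more than γ remains.
      have h1 := lt_of_highTest hP hc hH.2
      have h2 := (abs_le.1 (hP.approx _ hH.1)).2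
      simp only [boolSign, Bool.false_eq_true, if_false]
      linarith
    · rw [hlook hL.1] at hL
      refine h.addTerm hP _ _ ?_
      have h1 := lt_of_lowTest hP hc hL.2
      have h2 := (abs_le.1 (hP.approx _ hL.1)).1
      simp only [boolSign, if_true]
      linarith
    · refine h.advance hlt (fun h0 => absurd h0 hpos) fun _ hd => ?_
      rw [hlook hd] at hH hL
      exact ⟨fun hh => hH ⟨hd, hh⟩, fun hh => hL ⟨hd, hh⟩⟩

theorem Inv.reaches {σ' : SearchState n} (h : σ.Inv P f val q ∅) (hP : P.Sound f val q)
    (hr : σ.Reaches P σ') : σ'.Inv P f val q ∅ := by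
  induction hr with
  | refl => exact h
  | tail _ hs ih => exact hs.2 ▸ ih.step hP hs.1

/-- When the queue has been processed, all low-degree coefficients are about right. -/
theorem Inv.abs_sub_le (h : σ.Inv P f val q ∅) (hP : P.Sound f val q) (hσ : ¬ σ.Active P)
    {a : Finset (Fin n)} (ha : a.card ≤ P.deg) :
    |fourierCoeffProd P.mean f a - fourierCoeffProd P.mean (σ.fn P) a| ≤ 5 * P.gam := by
  have hc := h.count_lt hP
  have hhead : σ.head = σ.tail := by
    refine le_antisymm h.head_le (not_lt.1 fun hlt => hσ ⟨hlt, hc⟩)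
  have happrox := abs_le.1 (hP.approx a ha)
  -- The remaining γ is the error of the given coefficient.
  suffices |fourierCoeffProd P.mean (σ.fn P) a - val a| ≤ 4 * P.gam by
    rw [abs_le] at this ⊢
    constructor <;> linarith
  have hleaf : ∀ i < σ.tail, σ.queue i = (a, 0) →
      |fourierCoeffProd P.mean (σ.fn P) a - val a| ≤ 4 * P.gam := by
    intro i hi he
    have := h.correct i (by omega) (by rw [he]) (by rw [he]; exact ha)
    rw [he] at this
    rw [abs_le]
    constructor
    · by_contra! hlt
      exact this.2 (lowTest_of_lt hP hc (by linarith))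
    · by_contra! hlt
      exact this.1 (highTest_of_lt hP hc (by linarith))
  by_cases hval : val a = 0
  swap
  · obtain ⟨i, hi, he⟩ := hP.listed a hval
    have := h.le_tail
    refine hleaf i (by omega) ?_
    rw [h.init i hi.le]
    exact Prod.ext he (hP.leaf i hi)
  -- For an unlisted index the given value is 0. A coefficient above 4γ makes every ancestor of `a`
  -- in the tree weigh more than 16γ², so each passes its test and `a` itself has been reached as a
  -- leaf.
  by_contra! hlarge
  rw [hval, sub_zero] at hlarge
  have hsq : 16 * P.gam ^ 2 < fourierCoeffProd P.mean (σ.fn P) a ^ 2 := by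
    rw [← sq_abs (fourierCoeffProd P.mean (σ.fn P) a)]
    have := pow_lt_pow_left₀ hlarge (by have := hP.gam; positivity) two_ne_zero
    linarith
  -- Descent from the root: after `k` levels the queue contains the ancestor of `a` with the
  -- coordinates from `n - k` on decided.
  have hfind : ∀ k ≤ n, ∃ i, P.len ≤ i ∧ i < σ.tail ∧ σ.queue i = (upper (n - k) a, n - k) := by
    intro k
    induction k with
    | zero =>
      refine fun _ => ⟨P.len, le_rfl, h.le_tail, ?_⟩
      rw [h.init _ le_rfl, hP.root]
      refine Prod.ext ?_ rfl
      ext j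
      simp [upper]
    | succ k ih =>
      intro hk
      obtain ⟨i, hi, hi', he⟩ := ih (by omega)
      have hset := upper_eq_setBit (r := n - k) (by omega) (by omega) a
      have := h.complete i hi hi' (by rw [he]; simp only; omega)
        (decide ((⟨n - k - 1, by omega⟩ : Fin n) ∈ a)) (.inl (by omega))
      rw [he] at this
      simp only [← hset] at this
      rw [show n - (k + 1) = n - k - 1 by omega]
      exact this (pairTest_of_lt hP hc (by omega) (by simp [upper])
        (hsq.trans_le (sq_fourierCoeffProd_le hP.mean _ _ _)))
  obtain ⟨i, hi, hi', he⟩ := hfind n le_rfl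
  rw [Nat.sub_self, show upper 0 a = a by simp [upper]] at he
  have := hleaf i hi' he
  rw [hval, sub_zero] at this
  linarith

theorem inv_of_start (hP : P.Sound f val q) (hc : σ.count = 0) (hh : σ.head = 0)
    (ht : σ.tail = P.len + 1) (hq : σ.queue = q) : σ.Inv P f val q ∅ where
  potential_le := by simp [hc, potential_zero]
  le_tail := ht.ge
  head_le := by omega
  init := fun i _ => by rw [hq]
  le_dim := fun i h1 h2 => by rw [show i = P.len by omega, hq, hP.root]
  supp := fun i h1 h2 => by rw [show i = P.len by omega, hq, hP.root]; simp
  parent := fun i h1 h2 => by omega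
  inj := fun i h1 h2 i' h1' h2' _ => by omega
  heavy := fun i h1 h2 => by omega
  complete := fun i h1 h2 hpos' c hor ht => by
    rcases hor with hor | hor
    · omega
    · exact hor.2.elim
  correct := fun i hi => by omega

end SearchState

/-! ### Product weights on finite types -/

section Weights

variable {ι α β : Type*} [Fintype α]

/-- The density of a product of weights. -/
noncomputable def piWeight [Fintype ι] (p : ι → α → ℝ) (x : ι → α) : ℝ := ∏ i, p i (x i)

/-- The total weight of a set. -/
noncomputable def weightOf (w : α → ℝ) (S : Set α) : ℝ := ∑ x, S.indicator w x

theorem weightOf_iUnion_le {w : α → ℝ} (hw : w ∈ stdSimplex ℝ α) [Fintype ι] (S : ι → Set α) :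
    weightOf w (⋃ i, S i) ≤ ∑ i, weightOf w (S i) := by
  simp only [weightOf]
  rw [Finset.sum_comm]
  refine Finset.sum_le_sum fun x _ => ?_
  by_cases hx : x ∈ ⋃ i, S i
  · rw [Set.indicator_of_mem hx]
    obtain ⟨i, hi⟩ := Set.mem_iUnion.1 hx
    refine le_trans ?_ (Finset.single_le_sum (f := fun i => (S i).indicator w x)
      (fun i _ => Set.indicator_nonneg (fun x _ => hw.1 x) x) (Finset.mem_univ i))
    rw [Set.indicator_of_mem hi]
  · rw [Set.indicator_of_notMem hx]
    exact Finset.sum_nonneg fun i _ => Set.indicator_nonneg (fun x _ => hw.1 x) x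

theorem weightOf_le_add (w w' : α → ℝ) (S : Set α) :
    weightOf w S ≤ weightOf w' S + ∑ x, |w x - w' x| := by
  rw [weightOf, weightOf, ← Finset.sum_add_distrib]
  refine Finset.sum_le_sum fun x _ => ?_
  by_cases hx : x ∈ S
  · rw [Set.indicator_of_mem hx, Set.indicator_of_mem hx]
    linarith [le_abs_self (w x - w' x)]
  · rw [Set.indicator_of_notMem hx, Set.indicator_of_notMem hx, zero_add]
    exact abs_nonneg _

theorem weightOf_mul_sq_le {w : α → ℝ} (hw : w ∈ stdSimplex ℝ α) (F : α → ℝ) {t : ℝ} (ht : 0 ≤ t) :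
    weightOf w {x | t < |F x|} * t ^ 2 ≤ ∑ x, w x * F x ^ 2 := by
  rw [weightOf, Finset.sum_mul]
  refine Finset.sum_le_sum fun x _ => ?_
  by_cases hx : x ∈ {x | t < |F x|}
  · rw [Set.indicator_of_mem hx, ← sq_abs (F x)]
    exact mul_le_mul_of_nonneg_left (pow_le_pow_left₀ ht (le_of_lt hx) 2) (hw.1 x)
  · rw [Set.indicator_of_notMem hx, zero_mul]
    exact mul_nonneg (hw.1 x) (sq_nonneg _)

theorem sum_piWeight_mul_prod [Fintype ι] [DecidableEq ι] (p f : ι → α → ℝ) :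
    ∑ x, piWeight p x * ∏ i, f i (x i) = ∏ i, ∑ s, p i s * f i s := by
  rw [Finset.prod_univ_sum, Fintype.piFinset_univ]
  simp only [piWeight, Finset.prod_mul_distrib]

theorem piWeight_mem [Fintype ι] [DecidableEq ι] {p : ι → α → ℝ}
    (h : ∀ i, p i ∈ stdSimplex ℝ α) : piWeight p ∈ stdSimplex ℝ (ι → α) := by
  refine ⟨fun x => Finset.prod_nonneg fun i _ => (h i).1 _, ?_⟩
  have := sum_piWeight_mul_prod p fun _ _ => 1
  simpa [(h _).2] using this

theorem sum_fin_cons {m : ℕ} (F : (Fin (m + 1) → α) → ℝ) :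
    ∑ x, F x = ∑ a, ∑ y : Fin m → α, F (Fin.cons a y) := by
  rw [← Fintype.sum_prod_type', ← (Fin.consEquiv fun _ => α).sum_comp]
  rfl

theorem piWeight_cons {α : Type*} {m : ℕ} (p : Fin (m + 1) → α → ℝ) (a : α) (y : Fin m → α) :
    piWeight p (Fin.cons a y) = p 0 a * piWeight (fun i => p i.succ) y := by
  simp [piWeight, Fin.prod_univ_succ]

/-- Product weights are close if the factors are. -/
theorem sum_abs_piWeight_sub_le {m : ℕ} {p q : Fin m → α → ℝ} (hp : ∀ i, p i ∈ stdSimplex ℝ α)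
    (hq : ∀ i, q i ∈ stdSimplex ℝ α) :
    ∑ x, |piWeight p x - piWeight q x| ≤ ∑ i, ∑ s, |p i s - q i s| := by
  induction m with
  | zero => simp [piWeight]
  | succ m ih =>
    rw [sum_fin_cons, Fin.sum_univ_succ]
    have hP := piWeight_mem fun i : Fin m => hp i.succ
    calc ∑ a, ∑ y, |piWeight p (Fin.cons a y) - piWeight q (Fin.cons a y)|
        ≤ ∑ a, ∑ y : Fin m → α, (|p 0 a - q 0 a| * piWeight (fun i => p i.succ) y +
          q 0 a * |piWeight (fun i => p i.succ) y - piWeight (fun i => q i.succ) y|) := by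
          refine Finset.sum_le_sum fun a _ => Finset.sum_le_sum fun y _ => ?_
          rw [piWeight_cons, piWeight_cons]
          set u := piWeight (fun i => p i.succ) y
          set v := piWeight (fun i => q i.succ) y
          -- Hybrid argument: the factors are exchanged one at a time, and the factors that are not
          -- being exchanged have total weight 1.
          rw [show p 0 a * u - q 0 a * v = (p 0 a - q 0 a) * u + q 0 a * (u - v) by ring]
          refine (abs_add_le _ _).trans_eq ?_
          rw [abs_mul, abs_mul, abs_of_nonneg (hP.1 y : 0 ≤ u), abs_of_nonneg ((hq 0).1 a)]
      _ ≤ _ := by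
          simp only [Finset.sum_add_distrib, ← Finset.mul_sum, ← Finset.sum_mul, hP.2, (hq 0).2,
            mul_one, one_mul]
          exact add_le_add_right (ih (fun i => hp i.succ) fun i => hq i.succ) _

/-- Mean and variance of a sum of independent centred variables. Both are proved together, because
the cross term in the square vanishes by the statement on the mean. -/
theorem sum_piWeight_sum {m : ℕ} {w c : α → ℝ} (hw : w ∈ stdSimplex ℝ α)
    (hc : ∑ a, w a * c a = 0) :
    ∑ x, piWeight (fun _ : Fin m => w) x * ∑ i, c (x i) = 0 ∧
      ∑ x, piWeight (fun _ : Fin m => w) x * (∑ i, c (x i)) ^ 2 = m * ∑ a, w a * c a ^ 2 := by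
  induction m with
  | zero => simp [piWeight]
  | succ m ih =>
    have hP := piWeight_mem fun _ : Fin m => hw
    simp only [sum_fin_cons, piWeight_cons, Fin.sum_univ_succ, Fin.cons_zero, Fin.cons_succ]
    constructor
    · have : ∀ (a : α) (y : Fin m → α), w a * piWeight (fun _ => w) y * (c a + ∑ i, c (y i)) =
          w a * c a * piWeight (fun _ => w) y +
            w a * (piWeight (fun _ => w) y * ∑ i, c (y i)) := fun a y => by ring
      simp only [this, Finset.sum_add_distrib, ← Finset.mul_sum, hP.2, ih.1, hc,
        mul_zero, mul_one, add_zero]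
    · have : ∀ (a : α) (y : Fin m → α), w a * piWeight (fun _ => w) y * (c a + ∑ i, c (y i)) ^ 2 =
          w a * c a ^ 2 * piWeight (fun _ => w) y +
            2 * (w a * c a) * (piWeight (fun _ => w) y * ∑ i, c (y i)) +
            w a * (piWeight (fun _ => w) y * (∑ i, c (y i)) ^ 2) := fun a y => by ring
      simp only [this, Finset.sum_add_distrib, ← Finset.mul_sum, ← Finset.sum_mul, hP.2, ih.1, ih.2,
        hw.2, mul_zero, mul_one, add_zero, one_mul]
      push_cast
      ring

/-- Chebyshev's inequality for the mean of independent samples. -/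
theorem weightOf_deviation_le {M : ℕ} {w h : α → ℝ} (hw : w ∈ stdSimplex ℝ α) {e τ : ℝ}
    (he : ∑ a, w a * h a = e) (hh : ∑ a, w a * h a ^ 2 ≤ 1) (hτ : 0 < τ) (hM : 16 ≤ M * τ ^ 2) :
    weightOf (piWeight fun _ : Fin M => w) {x | τ * M < |∑ i, h (x i) - M * e|} ≤ 1 / 16 := by
  have hc : ∑ a, w a * (h a - e) = 0 := by
    simp only [mul_sub, Finset.sum_sub_distrib, he, ← Finset.sum_mul, hw.2, one_mul, sub_self]
  -- The variance is the second moment minus e².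
  have hvar : ∑ a, w a * (h a - e) ^ 2 ≤ 1 := by
    have : ∀ a, w a * (h a - e) ^ 2 = w a * h a ^ 2 - 2 * e * (w a * h a) + w a * e ^ 2 :=
      fun a => by ring
    simp only [this, Finset.sum_add_distrib, Finset.sum_sub_distrib, ← Finset.mul_sum,
      ← Finset.sum_mul, he, hw.2]
    nlinarith [sq_nonneg e]
  have h1 := weightOf_mul_sq_le (piWeight_mem fun _ : Fin M => hw) (fun x => ∑ i, (h (x i) - e))
    (t := τ * M) (by positivity)
  rw [(sum_piWeight_sum hw hc).2] at h1
  simp only [Finset.sum_sub_distrib, Finset.sum_const, Finset.card_univ, Fintype.card_fin,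
    nsmul_eq_mul] at h1
  have hM' : (0 : ℝ) < M := by
    by_contra! h0
    nlinarith [sq_nonneg τ]
  have h2 : (M : ℝ) * ∑ a, w a * (h a - e) ^ 2 ≤ M := mul_le_of_le_one_right hM'.le hvar
  set p := weightOf (piWeight fun _ : Fin M => w) {x | τ * M < |∑ i, h (x i) - M * e|} with hp
  have h3 : p * (M * τ ^ 2) ≤ 1 := by
    refine le_of_mul_le_mul_left ?_ hM'
    calc (M : ℝ) * (p * (M * τ ^ 2)) = p * (τ * M) ^ 2 := by ring
      _ ≤ (M : ℝ) * 1 := by linarith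
  have hp0 : 0 ≤ p := Finset.sum_nonneg fun x _ =>
    Set.indicator_nonneg (fun x _ => (piWeight_mem fun _ : Fin M => hw).1 x) x
  nlinarith

open Classical in
/-- It is unlikely that half of many independent unlikely events happen. -/
theorem weightOf_majority_le {R : ℕ} {w : α → ℝ} (hw : w ∈ stdSimplex ℝ α) {S : Set α}
    (hS : weightOf w S ≤ 1 / 16) :
    weightOf (piWeight fun _ : Fin R => w)
      {x | R ≤ 2 * (Finset.univ.filter fun i => x i ∈ S).card} ≤ (1 / 2) ^ R := by
  -- Exponential moment: one trial has E[16^(indicator of S)] = 1 + 15 · P(S) ≤ 1 + 15/16 ≤ 2. On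
  -- the event in question the product over all trials is at least 16^(R/2) = 4^R, which gives the
  -- bound 2^R / 4^R.
  have h1 : ∑ a, w a * (if a ∈ S then (16 : ℝ) else 1) ≤ 2 := by
    have : ∀ a, w a * (if a ∈ S then (16 : ℝ) else 1) = w a + 15 * S.indicator w a := fun a => by
      by_cases ha : a ∈ S <;> simp [ha]; ring
    simp only [this, Finset.sum_add_distrib, ← Finset.mul_sum, hw.2]
    rw [weightOf] at hS
    linarith
  have h0 : 0 ≤ ∑ a, w a * (if a ∈ S then (16 : ℝ) else 1) :=
    Finset.sum_nonneg fun a _ => mul_nonneg (hw.1 a) (by split_ifs <;> norm_num)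
  have h2 := sum_piWeight_mul_prod (fun _ : Fin R => w) fun _ a => if a ∈ S then (16 : ℝ) else 1
  rw [Finset.prod_const, Finset.card_univ, Fintype.card_fin] at h2
  have hP := piWeight_mem fun _ : Fin R => hw
  have h3 : weightOf (piWeight fun _ : Fin R => w)
      {x | R ≤ 2 * (Finset.univ.filter fun i => x i ∈ S).card} * 4 ^ R ≤ 2 ^ R := by
    refine le_trans ?_ (h2.trans_le (pow_le_pow_left₀ h0 h1 R))
    rw [weightOf, Finset.sum_mul]
    refine Finset.sum_le_sum fun x _ => ?_
    rw [Finset.prod_ite, Finset.prod_const_one, mul_one, Finset.prod_const]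
    by_cases hx : x ∈ {x | R ≤ 2 * (Finset.univ.filter fun i => x i ∈ S).card}
    · rw [Set.indicator_of_mem hx]
      refine mul_le_mul_of_nonneg_left ?_ (hP.1 x)
      rw [show (16 : ℝ) = 4 ^ 2 by norm_num, ← pow_mul]
      exact pow_le_pow_right₀ (by norm_num) hx
    · rw [Set.indicator_of_notMem hx, zero_mul]
      exact mul_nonneg (hP.1 x) (by positivity)
  refine le_of_mul_le_mul_right ?_ (show (0 : ℝ) < 4 ^ R by positivity)
  rw [← mul_pow]
  norm_num
  exact h3

/-! ### Images of the uniform distribution -/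

open Classical in
/-- The distribution of `T a` for uniform `a`. -/
noncomputable def pushFreq (T : α → β) (b : β) : ℝ :=
  (Finset.univ.filter fun a => T a = b).card / Fintype.card α

theorem pushFreq_mem [Fintype β] [Nonempty α] (T : α → β) : pushFreq T ∈ stdSimplex ℝ β := by
  classical
  refine ⟨fun b => by unfold pushFreq; positivity, ?_⟩
  simp only [pushFreq]
  have h := Finset.card_eq_sum_card_fiberwise (s := Finset.univ) (t := Finset.univ) (f := T)
    (fun _ _ => Finset.mem_univ _)
  rw [← Finset.sum_div, ← Nat.cast_sum, ← h, Finset.card_univ]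
  exact div_self (Nat.cast_ne_zero.2 Fintype.card_ne_zero)

open Classical in
theorem weightOf_pushFreq [Fintype β] (T : α → β) (S : Set β) :
    weightOf (pushFreq T) S = (Finset.univ.filter fun a => T a ∈ S).card / Fintype.card α := by
  have h1 := Finset.card_eq_sum_card_fiberwise (s := Finset.univ.filter fun a => T a ∈ S)
    (t := Finset.univ) (f := T) (fun _ _ => Finset.mem_univ _)
  rw [h1, Nat.cast_sum, Finset.sum_div, weightOf]
  refine Finset.sum_congr rfl fun b _ => ?_
  rw [Finset.filter_filter]
  by_cases hb : b ∈ S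
  · rw [Set.indicator_of_mem hb, pushFreq]
    congr 3
    ext a
    simp only [Finset.mem_filter, Finset.mem_univ, true_and]
    exact ⟨fun h => ⟨h ▸ hb, h⟩, fun h => h.2⟩
  · rw [Set.indicator_of_notMem hb, Finset.filter_false_of_mem, Finset.card_empty, Nat.cast_zero,
      zero_div]
    rintro a - ⟨h, rfl⟩
    exact hb h

/-- Functions of disjoint blocks of fair coins are independent. -/
theorem pushFreq_pi [Fintype ι] [DecidableEq ι] (T : ι → α → β) :
    pushFreq (fun (x : ι → α) i => T i (x i)) = piWeight fun i => pushFreq (T i) := by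
  classical
  funext y
  simp only [pushFreq, piWeight, Finset.prod_div_distrib, Finset.prod_const, Finset.card_univ,
    Fintype.card_pi, Nat.cast_pow]
  congr 1
  rw [← Nat.cast_prod, ← Fintype.card_piFinset]
  congr 2
  ext x
  simp [funext_iff]

theorem pushFreq_comp_equiv {α' : Type*} [Fintype α'] (e : α' ≃ α) (T : α → β) :
    pushFreq (fun a => T (e a)) = pushFreq T := by
  classical
  funext b
  rw [pushFreq, pushFreq, Fintype.card_congr e]
  congr 2
  exact Finset.card_bij (fun a _ => e a) (by simp) (by simp) fun a ha => ⟨e.symm a, by simpa using ha⟩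

end Weights

/-! ### Rounding a uniform number -/

theorem binFrac_nonneg (β : ℕ → ℕ) (k : ℕ) : 0 ≤ binFrac β k := by
  induction k with
  | zero => exact le_rfl
  | succ k ih => rw [binFrac]; positivity

theorem binFrac_flipSeq_lt_one {k m : ℕ} (β : Fin m → Bool) : binFrac (flipSeq β) k < 1 := by
  induction k with
  | zero => exact one_pos
  | succ k ih =>
    have : (flipSeq β k : ℝ) ≤ 1 := by
      rw [flipSeq]
      split_ifs
      · exact_mod_cast Bool.toNat_le _
      · simp
    rw [binFrac]
    linarith

theorem binFrac_snoc {k : ℕ} (β : Fin k → Bool) (c : Bool) :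
    binFrac (flipSeq (Fin.snoc β c : Fin (k + 1) → Bool)) (k + 1) =
      (binFrac (flipSeq β) k + c.toNat) / 2 := by
  have h : ∀ b < k, flipSeq (Fin.snoc β c : Fin (k + 1) → Bool) b = flipSeq β b := fun b hb => by
    rw [flipSeq, flipSeq, dif_pos hb, dif_pos (by omega)]
    simp [Fin.snoc, hb]
  rw [binFrac, binFrac_congr h]
  simp [flipSeq, Fin.snoc]

-- Induction on the leading digit, which is the bit appended last. For `x ≤ 1/2` no fraction with
-- leading digit 1 counts, for `x ≥ 1/2` every one with leading digit 0 does; the other half is the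
-- same problem for `2x` or `2x - 1`, with the same absolute error.
open Classical in
theorem abs_card_binFrac_sub_le (k : ℕ) {x : ℝ} (hx : x ∈ Set.Icc (0 : ℝ) 1) :
    |(∑ β : Fin k → Bool, if binFrac (flipSeq β) k < x then (1 : ℝ) else 0) - 2 ^ k * x| ≤ 1 := by
  induction k generalizing x with
  | zero =>
    simp only [Finset.univ_unique, Finset.sum_singleton, binFrac, pow_zero, one_mul]
    by_cases h : 0 < x <;> simp only [h, if_true, if_false] <;> rw [abs_le] <;> constructor <;>
      linarith [hx.1, hx.2]
  | succ k ih =>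
    rw [← (Fin.snocEquiv fun _ => Bool).sum_comp, Fintype.sum_prod_type, Fintype.sum_bool]
    simp only [Fin.snocEquiv, Equiv.coe_fn_mk, binFrac_snoc, Bool.toNat_true, Bool.toNat_false,
      Nat.cast_one, Nat.cast_zero, add_zero]
    have e1 : ∀ β : Fin k → Bool, (binFrac (flipSeq β) k + 1) / 2 < x ↔
        binFrac (flipSeq β) k < 2 * x - 1 := fun β => by constructor <;> intro h <;> linarith
    have e2 : ∀ β : Fin k → Bool, binFrac (flipSeq β) k / 2 < x ↔
        binFrac (flipSeq β) k < 2 * x := fun β => by constructor <;> intro h <;> linarith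
    simp only [e1, e2]
    rcases le_total (2 * x) 1 with h | h
    · have : ∀ β : Fin k → Bool, ¬ binFrac (flipSeq β) k < 2 * x - 1 := fun β => by
        linarith [binFrac_nonneg (flipSeq β) k]
      simp only [this, if_false, Finset.sum_const_zero, zero_add, pow_succ, mul_assoc]
      exact ih ⟨by linarith [hx.1], h⟩
    · have : ∀ β : Fin k → Bool, binFrac (flipSeq β) k < 2 * x := fun β => by
        linarith [binFrac_flipSeq_lt_one (k := k) β]
      simp only [this, if_true]
      refine le_trans (le_of_eq ?_) (ih (x := 2 * x - 1) ⟨by linarith, by linarith [hx.2]⟩)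
      congr 1
      simp
      ring

theorem abs_pushFreq_roundSign_sub_le (k : ℕ) {x : ℝ} (hx : x ∈ Set.Ioo (-1 : ℝ) 1) (s : ℤˣ) :
    |pushFreq (fun β : Fin k → Bool => roundSign (binFrac (flipSeq β) k) x) s -
      if s = 1 then (1 + x) / 2 else (1 - x) / 2| ≤ (1 / 2) ^ k := by
  classical
  have h1 : |pushFreq (fun β : Fin k → Bool => roundSign (binFrac (flipSeq β) k) x) 1 -
      (1 + x) / 2| ≤ (1 / 2) ^ k := by
    have := abs_card_binFrac_sub_le k (x := (1 + x) / 2)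
      ⟨by linarith [hx.1], by linarith [hx.2]⟩
    rw [Finset.sum_boole] at this
    have e : ∀ β : Fin k → Bool, roundSign (binFrac (flipSeq β) k) x = 1 ↔
        binFrac (flipSeq β) k < (1 + x) / 2 := fun β => by
      rw [roundSign]; split_ifs with h <;> simp [h]
    simp only [pushFreq, e, Fintype.card_pi, Fintype.card_bool, Finset.prod_const,
      Finset.card_univ, Fintype.card_fin, Nat.cast_pow, Nat.cast_ofNat]
    have h2 : (0 : ℝ) < 2 ^ k := by positivity
    rw [div_sub' h2.ne', abs_div, abs_of_pos h2, div_le_iff₀ h2, ← mul_pow]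
    norm_num
    exact this
  have hsum := (pushFreq_mem fun β : Fin k → Bool => roundSign (binFrac (flipSeq β) k) x).2
  rw [sum_units_int] at hsum
  rcases Int.units_eq_one_or s with rfl | rfl
  · simpa using h1
  · rw [if_neg (by decide), ← abs_neg]
    convert h1 using 2
    linarith

/-! ### The samples are good with high probability -/

/-- Split a sequence into blocks. -/
def blockEquiv (a b : ℕ) (α : Type*) : (Fin (a * b) → α) ≃ (Fin a → Fin b → α) :=
  (finProdFinEquiv.symm.arrowCongr (Equiv.refl α)).trans (Equiv.curry _ _ _)

theorem blockEquiv_apply {a b : ℕ} {α : Type*} (ω : Fin (a * b) → α) (i : Fin a) (j : Fin b)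
    (h : i.1 * b + j < a * b) : blockEquiv a b α ω i j = ω ⟨i * b + j, h⟩ := by
  simp only [blockEquiv, Equiv.trans_apply, Equiv.arrowCongr_apply, Equiv.curry_apply,
    Function.comp_apply, Equiv.symm_symm, Function.curry_apply, Equiv.coe_refl, id]
  congr 1
  ext
  simp [finProdFinEquiv, mul_comm, add_comm]

theorem mul_add_lt_mul {a b i j : ℕ} (hi : i < a) (hj : j < b) : i * b + j < a * b :=
  calc i * b + j < i * b + b := by omega
    _ = (i + 1) * b := by ring
    _ ≤ a * b := Nat.mul_le_mul_right _ hi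

/-- Sort coin flips by group, pair, member of the pair, coordinate and digit. -/
theorem exists_flipEquiv (R M n k B : ℕ) (hB : B = R * M * 2 * n * k) :
    ∃ e : (Fin B → Bool) ≃ (Fin R → Fin M → Fin 2 → Fin n → Fin k → Bool),
      ∀ ω g l b j (t : Fin k), (e ω g l b j t).toNat =
        flipSeq ω ((((g * M + l) * 2 + b) * n + j) * k + t) := by
  subst hB
  refine ⟨(blockEquiv _ _ _).trans ((blockEquiv _ _ _).trans ((blockEquiv _ _ _).trans
    (blockEquiv _ _ _))), fun ω g l b j t => ?_⟩
  have h1 := mul_add_lt_mul g.2 l.2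
  have h2 := mul_add_lt_mul h1 b.2
  have h3 := mul_add_lt_mul h2 j.2
  have h4 := mul_add_lt_mul h3 t.2
  simp only [Equiv.trans_apply]
  rw [blockEquiv_apply _ _ _ h1, blockEquiv_apply _ _ _ h2, blockEquiv_apply _ _ _ h3,
    blockEquiv_apply _ _ _ h4, flipSeq, dif_pos h4]

section Samples

variable {n : ℕ}

/-- The density of independent samples, in `R` groups of `M` pairs. -/
noncomputable def sampleWeight (R M : ℕ) (p : Fin n → ℤˣ → ℝ) :
    (Fin R → Fin M → Fin 2 → Cube n) → ℝ :=
  piWeight fun _ => piWeight fun _ => piWeight fun _ => piWeight p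

theorem sampleWeight_mem {R M : ℕ} {p : Fin n → ℤˣ → ℝ} (hp : ∀ i, p i ∈ stdSimplex ℝ ℤˣ) :
    sampleWeight R M p ∈ stdSimplex ℝ (Fin R → Fin M → Fin 2 → Cube n) :=
  piWeight_mem fun _ => piWeight_mem fun _ => piWeight_mem fun _ => piWeight_mem hp

/-- There are `2 * (R * M) * n` independent signs, and each contributes an L¹ error of at most 2ε.
-/
theorem sum_abs_sampleWeight_sub_le {R M : ℕ} {p q : Fin n → ℤˣ → ℝ}
    (hp : ∀ i, p i ∈ stdSimplex ℝ ℤˣ) (hq : ∀ i, q i ∈ stdSimplex ℝ ℤˣ) {ε : ℝ}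
    (h : ∀ i s, |p i s - q i s| ≤ ε) :
    ∑ x, |sampleWeight R M p x - sampleWeight R M q x| ≤ 2 * (R * M) * n * (2 * ε) := by
  have h1 : ∑ x, |piWeight p x - piWeight q x| ≤ n * (2 * ε) := by
    refine (sum_abs_piWeight_sub_le hp hq).trans
      ((Finset.sum_le_sum fun i _ => ?_).trans_eq (?_ : ∑ i : Fin n, 2 * ε = _))
    · rw [sum_units_int]
      linarith [h i 1, h i (-1)]
    · simp
  have hp1 := piWeight_mem hp
  have hq1 := piWeight_mem hq
  have h2 := sum_abs_piWeight_sub_le (fun _ : Fin 2 => hp1) fun _ => hq1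
  have hp2 := piWeight_mem fun _ : Fin 2 => hp1
  have hq2 := piWeight_mem fun _ : Fin 2 => hq1
  have h3 := sum_abs_piWeight_sub_le (fun _ : Fin M => hp2) fun _ => hq2
  have hp3 := piWeight_mem fun _ : Fin M => hp2
  have hq3 := piWeight_mem fun _ : Fin M => hq2
  have h4 := sum_abs_piWeight_sub_le (fun _ : Fin R => hp3) fun _ => hq3
  simp only [Finset.sum_const, Finset.card_univ, Fintype.card_fin, nsmul_eq_mul] at h2 h3 h4
  push_cast at h2
  calc _ ≤ _ := h4
    _ ≤ R * (M * (2 * (n * (2 * ε)))) := by gcongr; exact h3.trans (by gcongr; exact h2.trans (by gcongr))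
    _ = _ := by ring

theorem coordWeight_mem {μ : Fin n → ℝ} (hμ : ∀ i, μ i ∈ Set.Ioo (-1 : ℝ) 1) (i : Fin n) :
    coordWeight μ i ∈ stdSimplex ℝ ℤˣ := by
  refine ⟨fun s => ?_, sum_coordWeight μ i⟩
  have := hμ i
  unfold coordWeight
  split_ifs <;> linarith [this.1, this.2]

theorem devCount_eq {R M : ℕ} {F : ℕ → ℝ} {e τ : ℝ} {f : Fin R → Fin M → ℝ}
    (h : ∀ g l, F (g.1 * M + l.1) = f g l) : devCount R M F e τ =
      (Finset.univ.filter fun g : Fin R => τ * M < |∑ l, f g l - M * e|).card := by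
  classical
  simp only [devCount, Finset.card_filter, Finset.sum_range, h]

/-- Few groups of samples deviate from the expectation. -/
theorem weightOf_devCount_le {R M : ℕ} {μ : Fin n → ℝ} (hμ : ∀ i, μ i ∈ Set.Ioo (-1 : ℝ) 1)
    (h : Cube n → Cube n → ℝ) {e τ : ℝ} (he : prodExp μ (fun x => prodExp μ (h x)) = e)
    (hh : prodExp μ (fun x => prodExp μ fun y => h x y ^ 2) ≤ 1) (hτ : 0 < τ)
    (hM : 16 ≤ M * τ ^ 2) :
    weightOf (sampleWeight R M (coordWeight μ)) {W | R ≤ 2 * (Finset.univ.filter fun g : Fin R =>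
      τ * M < |∑ l, h (W g l 0) (W g l 1) - M * e|).card} ≤ (1 / 2) ^ R := by
  have hp := piWeight_mem (coordWeight_mem hμ)
  have hp2 := piWeight_mem fun _ : Fin 2 => hp
  have hexp : ∀ F : Cube n → Cube n → ℝ,
      ∑ z : Fin 2 → Cube n, piWeight (fun _ => piWeight (coordWeight μ)) z * F (z 0) (z 1) =
        prodExp μ fun x => prodExp μ (F x) := fun F => by
    rw [← (finTwoArrowEquiv (Cube n)).symm.sum_comp, Fintype.sum_prod_type]
    refine Finset.sum_congr rfl fun x _ => ?_
    simp only [prodExp, Finset.mul_sum]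
    refine Finset.sum_congr rfl fun y _ => ?_
    simp only [piWeight, prodWeight, coordWeight, Fin.prod_univ_two, mul_assoc]
    rfl
  have h1 := weightOf_deviation_le (M := M) hp2 (h := fun z => h (z 0) (z 1)) ((hexp _).trans he)
    ((hexp fun x y => h x y ^ 2).trans_le hh) hτ hM
  refine le_of_eq_of_le ?_ (weightOf_majority_le (R := R) (piWeight_mem fun _ : Fin M => hp2) h1)
  simp only [sampleWeight, Set.mem_ofPred_eq]

/-- The sign sum with terms given up to `N`. -/
noncomputable def finSum {N : ℕ} (μ : Fin n → ℝ) (γ : ℝ) (c : ℕ)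
    (u : Fin N → Finset (Fin n) × Bool) : Cube n → ℝ :=
  clippedSum μ γ c fun t => if h : t < N then u ⟨t, h⟩ else (∅, true)

/-- Makes the set of possible approximations finite, as the union bound requires: only the first `c`
terms of the sequence matter. -/
theorem clippedSum_eq_finSum {N c : ℕ} (hc : c < N) (μ : Fin n → ℝ) (γ : ℝ)
    (u : ℕ → Finset (Fin n) × Bool) :
    clippedSum μ γ c u = finSum (N := N) μ γ c fun t => u t := by
  funext x
  simp only [finSum, clippedSum]
  congr 2
  refine Finset.sum_congr rfl fun t ht => ?_
  rw [dif_pos ((Finset.mem_range.1 ht).trans hc)]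

/-- The samples for which a test fails. The test is for the weight of the coefficients above an
index, or for a single coefficient. -/
noncomputable def badSamples (R M N : ℕ) (μ : Fin n → ℝ) (γ : ℝ) :
    (Fin N × (Fin N → Finset (Fin n) × Bool)) × Option (Fin n) × Finset (Fin n) →
      Set (Fin R → Fin M → Fin 2 → Cube n)
  | ((c, u), none, a) => {W | R ≤ 2 * (Finset.univ.filter fun g : Fin R =>
      γ * M < |∑ l, finSum μ γ c u (W g l 0) * prodBasis μ a (W g l 0) -
        M * fourierCoeffProd μ (finSum μ γ c u) a|).card}
  | ((c, u), some r, a) => {W | R ≤ 2 * (Finset.univ.filter fun g : Fin R =>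
      4 * (γ * γ) * M < |∑ l, pairVal μ (finSum μ γ c u) (upper r a) r (W g l 0) (W g l 1) -
        M * upperWeight μ (finSum μ γ c u) (upper r a) r|).card}

theorem weightOf_badSamples_le {R M N : ℕ} {μ : Fin n → ℝ} (hμ : ∀ i, μ i ∈ Set.Ioo (-1 : ℝ) 1)
    {γ : ℝ} (hγ : 0 < γ) (hM : 16 ≤ M * γ ^ 2) (hM' : 16 ≤ M * (4 * (γ * γ)) ^ 2)
    (b : (Fin N × (Fin N → Finset (Fin n) × Bool)) × Option (Fin n) × Finset (Fin n)) :
    weightOf (sampleWeight R M (coordWeight μ)) (badSamples R M N μ γ b) ≤ (1 / 2) ^ R := by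
  obtain ⟨⟨c, u⟩, r, a⟩ := b
  have hg : ∀ x, finSum μ γ c u x ∈ Set.Icc (-1 : ℝ) 1 := fun x => clip_mem _
  cases r with
  | none =>
    exact weightOf_devCount_le hμ (fun x _ => finSum μ γ c u x * prodBasis μ a x)
      (by simp only [prodExp_const]; rfl)
      (by simp only [prodExp_const]; exact prodExp_single_sq_le hμ hg a) hγ hM
  | some r =>
    have ha : ∀ j ∈ upper r a, r.1 ≤ j.1 := fun j hj => (Finset.mem_filter.1 hj).2
    exact weightOf_devCount_le hμ (pairVal μ (finSum μ γ c u) (upper r a) r)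
      (prodExp_pairVal _ ha) (prodExp_pairVal_sq_le hμ hg ha) (by positivity) hM'

/-- The bad events range over all sets through `upper r a`; a set that already lies above `r` equals
its own upper part. -/
theorem goodSample_of_notMem {P : SearchParams n}
    (W : Fin P.groups → Fin P.groupSize → Fin 2 → Cube n)
    (hW : ∀ g l b, P.sample ((g.1 * P.groupSize + l.1) * 2 + b.1) = W g l b)
    (h : W ∉ ⋃ b, badSamples P.groups P.groupSize P.maxCount P.mean P.gam b) : P.GoodSample := by
  simp only [Set.mem_iUnion, not_exists] at h
  have h0 : ∀ g l, P.sample (2 * (g.1 * P.groupSize + l.1)) = W g l 0 := fun g l => by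
    rw [← hW, mul_comm]; rfl
  have h1 : ∀ g l, P.sample (2 * (g.1 * P.groupSize + l.1) + 1) = W g l 1 := fun g l => by
    rw [← hW, mul_comm]; rfl
  constructor
  · intro c hc u r hr a ha
    have := h ((⟨c, hc⟩, fun t => u t), some ⟨r, hr⟩, a)
    simp only [badSamples, Set.mem_ofPred_eq, not_le] at this
    rw [show upper r a = a from Finset.filter_true_of_mem ha] at this
    rw [clippedSum_eq_finSum hc]
    rwa [devCount_eq (f := fun g l => pairVal P.mean (finSum P.mean P.gam c fun t => u t) a r
      (W g l 0) (W g l 1)) fun g l => by rw [pairSeq, h0, h1]]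
  · intro c hc u a
    have := h ((⟨c, hc⟩, fun t => u t), none, a)
    simp only [badSamples, Set.mem_ofPred_eq, not_le] at this
    rw [clippedSum_eq_finSum hc]
    rwa [devCount_eq (f := fun g l => finSum P.mean P.gam c (fun t => u t) (W g l 0) *
      prodBasis P.mean a (W g l 0)) fun g l => by rw [singleSeq, h0]]

theorem one_lt_numTerms_mul {γ : ℝ} (hγ : 0 < γ) : 1 < numTerms γ * γ ^ 2 := by
  have h : 1 / (γ * γ) < numTerms γ := by
    rw [numTerms, Nat.cast_add, Nat.cast_one]
    linarith [Nat.le_ceil (1 / (γ * γ))]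
  rw [div_lt_iff₀ (by positivity)] at h
  linarith

open Classical in
/-- Most outcomes of the coin flips yield good samples. -/
theorem card_not_goodSample_le {s : ℕ} (d : ℕ) {γ δ : ℝ} (hγ : 0 < γ) (hδ : 0 < δ) {μ : Fin n → ℝ}
    (hμ : ∀ i, μ i ∈ Set.Ioo (-1 : ℝ) 1) (v : Fin s → ℝ) :
    ((Finset.univ.filter fun ω => ¬ (searchParams d γ δ μ v ω).GoodSample).card : ℝ) /
      Fintype.card (Fin (numFlips n γ δ) → Bool) ≤ δ := by
  set R := numGroups n γ δ with hR
  set M := numPairs γ with hM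
  set N := numTerms γ with hN
  set k := numBits n γ δ with hk
  set L := logBound δ with hL
  obtain ⟨e, he⟩ := exists_flipEquiv R M n k (numFlips n γ δ)
    (by simp only [numFlips, numRows, hR, hM, hk]; ring)
  let T : (Fin R → Fin M → Fin 2 → Fin n → Fin k → Bool) → Fin R → Fin M → Fin 2 → Cube n :=
    fun β g l b j => roundSign (binFrac (flipSeq (β g l b j)) k) (μ j)
  have hT : pushFreq (fun ω => T (e ω)) = sampleWeight R M fun j =>
      pushFreq fun β : Fin k → Bool => roundSign (binFrac (flipSeq β) k) (μ j) := by
    rw [pushFreq_comp_equiv, sampleWeight]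
    simp only [← pushFreq_pi]
    rfl
  have hNγ := one_lt_numTerms_mul hγ
  rw [← hN] at hNγ
  have hN1 : (1 : ℝ) ≤ N := Nat.one_le_cast.2 (by rw [hN, numTerms]; omega)
  have hMc : (M : ℝ) = 16 * N * N := by rw [hM, numPairs]; push_cast; rfl
  -- The group size 16N² suffices for accuracy γ and for accuracy 4γ², because N ≥ 1 and Nγ² > 1.
  have hM1 : 16 ≤ M * γ ^ 2 := by
    calc (16 : ℝ) ≤ 16 * N * (N * γ ^ 2) := by nlinarith
      _ = M * γ ^ 2 := by rw [hMc]; ring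
  have hM2 : 16 ≤ M * (4 * (γ * γ)) ^ 2 := by
    calc (16 : ℝ) ≤ 256 * (N * γ ^ 2) ^ 2 := by nlinarith
      _ = M * (4 * (γ * γ)) ^ 2 := by rw [hMc]; ring
  set S := ⋃ b, badSamples R M N μ γ b with hS
  have h1 : ((Finset.univ.filter fun ω => ¬ (searchParams d γ δ μ v ω).GoodSample).card : ℝ) /
      Fintype.card (Fin (numFlips n γ δ) → Bool) ≤ weightOf (pushFreq fun ω => T (e ω)) S := by
    rw [weightOf_pushFreq]
    gcongr with ω
    intro hω
    by_contra hmem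
    refine hω (goodSample_of_notMem (P := searchParams d γ δ μ v ω) (T (e ω))
      (fun g l b => ?_) hmem)
    funext j
    simp only [searchParams, samplePoint, T]
    congr 1
    refine binFrac_congr fun t ht => ?_
    rw [flipSeq.eq_1 (e ω g l b j), dif_pos ht]
    exact (he ω g l b j ⟨t, ht⟩).symm
  have hp : ∀ j, pushFreq (fun β : Fin k → Bool => roundSign (binFrac (flipSeq β) k) (μ j)) ∈
    stdSimplex ℝ ℤˣ := fun j => pushFreq_mem _
  have h2 := weightOf_le_add (pushFreq fun ω => T (e ω)) (sampleWeight R M (coordWeight μ)) S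
  rw [hT] at h1 h2
  have h3 := sum_abs_sampleWeight_sub_le (R := R) (M := M) hp (coordWeight_mem hμ)
    (ε := (1 / 2) ^ k) fun i s => abs_pushFreq_roundSign_sub_le k (hμ i) s
  -- Union bound under the exact product distribution.
  have h4 : weightOf (sampleWeight R M (coordWeight μ)) S ≤ (1 / 2) ^ (L + 2) := by
    refine (weightOf_iUnion_le (sampleWeight_mem (coordWeight_mem hμ)) _).trans
      ((Finset.sum_le_sum fun b _ => weightOf_badSamples_le hμ hγ hM1 hM2 b).trans ?_)
    rw [Finset.sum_const, Finset.card_univ, nsmul_eq_mul]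
    have hcard : Fintype.card ((Fin N × (Fin N → Finset (Fin n) × Bool)) ×
        Option (Fin n) × Finset (Fin n)) ≤ 2 ^ ((n + 2) * N + 2 * n) := by
      simp only [Fintype.card_prod, Fintype.card_fin, Fintype.card_option, Fintype.card_finset,
        Fintype.card_bool, Fintype.card_pi, Finset.prod_const, Finset.card_univ]
      -- The factors count the number of terms, the signed indices, the kind of test with its level,
      -- and the tested set; both N and n + 1 are absorbed by powers of 2.
      calc N * (2 ^ n * 2) ^ N * ((n + 1) * 2 ^ n) ≤ 2 ^ N * (2 ^ n * 2) ^ N * (2 ^ n * 2 ^ n) := by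
            gcongr
            · exact Nat.lt_two_pow_self.le
            · exact Nat.lt_two_pow_self
        _ = _ := by
            rw [← pow_succ, ← pow_mul, ← pow_add, ← pow_add, ← pow_add]
            congr 1
            ring
    have hRe : R = (n + 2) * N + 2 * n + (L + 2) := by rw [hR, hN, hL, numGroups]; omega
    rw [hRe, pow_add _ _ (L + 2), ← mul_assoc]
    refine mul_le_of_le_one_left (by positivity) ?_
    rw [one_div, inv_pow, ← div_eq_mul_inv, div_le_one (by positivity)]
    exact_mod_cast hcard
  -- The `numRows * n` extra digits pay for the number of rounded coordinates, since x · 2^(-x) ≤ 1.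
  -- With h4 the total failure is at most 2^(-L)/4 + 2^(-L)/2 ≤ δ.
  have h5 : 2 * (R * M) * n * (2 * (1 / 2 : ℝ) ^ k) ≤ 2 * (1 / 2) ^ (L + 2) := by
    have hke : k = L + 2 + numRows n γ δ * n := rfl
    have hlt : ((numRows n γ δ * n : ℕ) : ℝ) ≤ 2 ^ (numRows n γ δ * n) := by
      exact_mod_cast Nat.lt_two_pow_self.le
    have : ((numRows n γ δ * n : ℕ) : ℝ) * (1 / 2) ^ (numRows n γ δ * n) ≤ 1 := by
      rw [one_div, inv_pow, ← div_eq_mul_inv, div_le_one (by positivity)]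
      exact hlt
    calc 2 * (R * M) * n * (2 * (1 / 2 : ℝ) ^ k) = ((numRows n γ δ * n : ℕ) : ℝ) *
          (1 / 2) ^ (numRows n γ δ * n) * (2 * (1 / 2) ^ (L + 2)) := by
          rw [hke, pow_add _ (L + 2), numRows]; push_cast; ring
      _ ≤ _ := mul_le_of_le_one_left (by positivity) this
  have h6 : 1 ≤ 2 ^ L * δ := not_lt.1 fun h => lt_irrefl _ ((lt_logBound hδ L).2 h)
  have h7 : (1 / 2 : ℝ) ^ L ≤ δ := by
    rw [one_div, inv_pow, inv_le_iff_one_le_mul₀ (by positivity), mul_comm]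
    exact h6
  have h8 : (1 / 2 : ℝ) ^ (L + 2) = (1 / 2) ^ L / 4 := by rw [pow_add]; norm_num; ring
  have h9 : (0 : ℝ) ≤ (1 / 2) ^ L := by positivity
  linarith

end Samples

/-! ### Polynomial bounds -/

/-- The quantity in which the running time is polynomial. -/
noncomputable def inputScale (n : ℕ) (γ δ : ℝ) : ℝ := 1 + n + 1 / γ + max 0 (Real.log (1 / δ))

/-- A polynomial bound for lists of length `s ≤ K / γ ^ 2`. -/
def PolyBound (K : ℝ) (F : ℕ → ℕ → ℝ → ℝ → ℕ) : Prop :=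
  ∃ C k : ℕ, ∀ (n s : ℕ) (γ δ : ℝ), 0 < γ → (s : ℝ) ≤ K / γ ^ 2 →
    (F n s γ δ : ℝ) ≤ C * inputScale n γ δ ^ k

theorem one_le_inputScale (n : ℕ) {γ : ℝ} (hγ : 0 < γ) (δ : ℝ) : 1 ≤ inputScale n γ δ := by
  have h1 : 0 ≤ 1 / γ := by positivity
  have h2 : (0 : ℝ) ≤ n := Nat.cast_nonneg n
  have h3 := le_max_left 0 (Real.log (1 / δ))
  unfold inputScale
  linarith

theorem one_div_le_inputScale (n : ℕ) (γ δ : ℝ) : 1 / γ ≤ inputScale n γ δ := by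
  have h2 : (0 : ℝ) ≤ n := Nat.cast_nonneg n
  have h3 := le_max_left 0 (Real.log (1 / δ))
  unfold inputScale
  linarith

namespace PolyBound

variable {K : ℝ} {F G : ℕ → ℕ → ℝ → ℝ → ℕ}

theorem const (c : ℕ) : PolyBound K fun _ _ _ _ => c := ⟨c, 0, fun n s γ δ _ _ => by simp⟩

theorem add (hF : PolyBound K F) (hG : PolyBound K G) :
    PolyBound K fun n s γ δ => F n s γ δ + G n s γ δ := by
  obtain ⟨C, k, hF⟩ := hF
  obtain ⟨D, l, hG⟩ := hG
  refine ⟨C + D, max k l, fun n s γ δ hγ hs => ?_⟩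
  have h1 := one_le_inputScale n hγ δ
  push_cast
  rw [add_mul]
  exact add_le_add
    ((hF n s γ δ hγ hs).trans (by gcongr; exact le_max_left _ _))
    ((hG n s γ δ hγ hs).trans (by gcongr; exact le_max_right _ _))

theorem mul (hF : PolyBound K F) (hG : PolyBound K G) :
    PolyBound K fun n s γ δ => F n s γ δ * G n s γ δ := by
  obtain ⟨C, k, hF⟩ := hF
  obtain ⟨D, l, hG⟩ := hG
  refine ⟨C * D, k + l, fun n s γ δ hγ hs => ?_⟩
  push_cast
  rw [pow_add, mul_mul_mul_comm]
  exact mul_le_mul (hF n s γ δ hγ hs) (hG n s γ δ hγ hs) (Nat.cast_nonneg _)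
    ((Nat.cast_nonneg _).trans (hF n s γ δ hγ hs))

theorem dim : PolyBound K fun n _ _ _ => n := by
  refine ⟨1, 1, fun n s γ δ hγ _ => ?_⟩
  have h1 : 0 ≤ 1 / γ := by positivity
  have h3 := le_max_left 0 (Real.log (1 / δ))
  simp only [inputScale, Nat.cast_one, one_mul, pow_one]
  linarith

/-- The place where the sparsity hypothesis enters: its constant affects only the polynomial, not
the program. -/
theorem len : PolyBound K fun _ s _ _ => s := by
  refine ⟨⌈|K|⌉₊, 2, fun n s γ δ hγ hs => hs.trans ?_⟩
  calc K / γ ^ 2 ≤ |K| * (1 / γ) ^ 2 := by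
        rw [one_div, inv_pow, ← div_eq_mul_inv]
        gcongr
        exact le_abs_self K
    _ ≤ _ := by
        gcongr
        · exact Nat.le_ceil _
        · exact one_div_le_inputScale n γ δ

theorem terms : PolyBound K fun _ _ γ _ => numTerms γ := by
  refine ⟨3, 2, fun n s γ δ hγ _ => ?_⟩
  have h1 := one_le_inputScale n hγ δ
  have h2 := Nat.ceil_lt_add_one (show 0 ≤ 1 / (γ * γ) by positivity)
  have h3 : 1 / (γ * γ) ≤ inputScale n γ δ ^ 2 := by
    rw [← pow_two, ← one_div_pow]
    exact pow_le_pow_left₀ (by positivity) (one_div_le_inputScale n γ δ) 2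
  simp only [numTerms, Nat.cast_add, Nat.cast_one, Nat.cast_ofNat]
  nlinarith

/-- The change of base costs less than a factor 2, because log 2 > 1/2. The maximum with 0 covers δ
> 1. -/
theorem log : PolyBound K fun _ _ _ δ => logBound δ := by
  refine ⟨3, 1, fun n s γ δ hγ _ => ?_⟩
  have h1 : Real.logb 2 (1 / δ) ≤ 2 * max 0 (Real.log (1 / δ)) := by
    have := Real.log_two_gt_d9
    rw [Real.logb, div_le_iff₀ (by linarith)]
    nlinarith [le_max_left 0 (Real.log (1 / δ)), le_max_right 0 (Real.log (1 / δ))]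
  have h2 := Nat.ceil_lt_add_one (show 0 ≤ 2 * max 0 (Real.log (1 / δ)) by positivity)
  have h3 : (logBound δ : ℝ) ≤ ⌈2 * max 0 (Real.log (1 / δ))⌉₊ :=
    Nat.cast_le.2 (Nat.ceil_le_ceil h1)
  have h4 : 0 ≤ 1 / γ := by positivity
  have h5 : (0 : ℝ) ≤ n := Nat.cast_nonneg n
  have h6 := le_max_left 0 (Real.log (1 / δ))
  simp only [inputScale, Nat.cast_ofNat, pow_one]
  linarith

theorem pairs : PolyBound K fun _ _ γ _ => numPairs γ := ((const 16).mul terms).mul terms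

theorem groups : PolyBound K fun n _ γ δ => numGroups n γ δ :=
  ((((dim.add (const 2)).mul terms).add ((const 2).mul dim)).add (const 2)).add log

theorem rows : PolyBound K fun n _ γ δ => numRows n γ δ := (const 2).mul (groups.mul pairs)

theorem bits : PolyBound K fun n _ γ δ => numBits n γ δ :=
  (log.add (const 2)).add (rows.mul dim)

theorem flips : PolyBound K fun n _ γ δ => numFlips n γ δ := (rows.mul dim).mul bits

theorem queue : PolyBound K fun n s γ _ => queueBound n s γ :=
  (len.add (const 2)).add (dim.mul terms)

theorem eval : PolyBound K fun n _ γ _ => numTerms γ * (n * 5 + 10) + 12 :=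
  (terms.mul ((dim.mul (const 5)).add (const 10))).add (const 12)

theorem test : PolyBound K fun n _ γ δ =>
    testTime n (numTerms γ) (numPairs γ) (numGroups n γ δ) := by
  unfold testTime groupTime pairTime
  exact (groups.mul ((((pairs.mul (((((const 2).mul (terms.mul ((dim.mul (const 5)).add
    (const 10)))).add ((const 19).mul dim)).add (const 62)).add (const 3))).add
    (const 22))).add (const 3))).add (const 11)

theorem leaf : PolyBound K fun n s γ δ =>
    leafTime n s (numTerms γ) (numPairs γ) (numGroups n γ δ) := by
  unfold leafTime lookupTime
  have h : PolyBound K fun n s _ _ => n * 6 + 3 + (s * (n * 6 + 9 + 3) + 3) + 5 :=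
    (((dim.mul (const 6)).add (const 3)).add ((len.mul (((dim.mul (const 6)).add
      (const 9)).add (const 3))).add (const 3))).add (const 5)
  exact ((h.add test).add ((const 8).mul dim)).add (const 32)

theorem step : PolyBound K fun n s γ δ =>
    stepTime n s (numTerms γ) (numPairs γ) (numGroups n γ δ) := by
  unfold stepTime childTime
  exact ((((const 2).mul (((dim.mul (const 5)).add test).add (const 20))).add (const 3)).add
    leaf).add (const 1)

theorem setup : PolyBound K setupTime := by
  have h : ∀ {F : ℕ → ℕ → ℝ → ℝ → ℕ}, PolyBound K F → PolyBound K fun n s γ δ => 2 * F n s γ δ :=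
    fun hF => (const 2).mul hF
  exact ((((((((h terms).add (h pairs)).add ((const 4).mul log)).add (h groups)).add (h rows)).add
    (h bits)).add (h flips)).add (h queue)).add (const 60)

theorem search : PolyBound K searchTime := by
  have h : PolyBound K fun n _ γ δ => sampleTime n (numBits n γ δ) (numRows n γ δ) :=
    (rows.mul (((dim.mul (((bits.mul (const 6)).add (const 9)).add (const 3))).add
      (const 3)).add (const 3))).add (const 5)
  exact (h.add ((((terms.mul (queue.add (const 1))).add queue).mul (step.add (const 1))).add
    (const 1))).add (const 5)

theorem approx : PolyBound K approxTime :=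
  ((setup.add (((const 4).mul flips).add (const 3))).add search).add (const 2)

end PolyBound

/-! ### The algorithm -/

theorem lookupVal_eq {n : ℕ} {q : ℕ → Finset (Fin n) × ℕ} {V : ℕ → ℝ} {a : Finset (Fin n)} {x : ℝ}
    {s : ℕ} (h : ∀ i < s, (q i).1 = a → V i = x) (h0 : (∀ i < s, (q i).1 ≠ a) → x = 0) :
    lookupVal q V a s = x := by
  induction s with
  | zero => exact (h0 fun i hi => absurd hi (Nat.not_lt_zero i)).symm
  | succ s ih =>
    rw [lookupVal]
    split_ifs with hs
    · exact h s (by omega) hs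
    · refine ih (fun i hi => h i (by omega)) fun h' => h0 fun i hi => ?_
      rcases Nat.lt_succ_iff_lt_or_eq.1 hi with hi | rfl
      exacts [h' i hi, hs]

namespace SearchState

variable {n : ℕ} {P : SearchParams n} {σ : SearchState n}

/-- Holds for all coin outcomes, good or not, because the search stops at the cap; it bounds the
time of evaluating the result. -/
theorem Reaches.count_le {σ' : SearchState n} (h : σ.Reaches P σ') (hσ : σ.count ≤ P.maxCount) :
    σ'.count ≤ P.maxCount := by
  induction h with
  | refl => exact hσ
  | @tail τ τ' _ hs ih =>
    have hlt := hs.1.2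
    rw [hs.2, step]
    split_ifs
    · simpa only [stepInner, advance, pushChild, push_count] using ih
    · simp only [stepLeaf, addTerm, advance]
      split_ifs
      exacts [hlt, hlt, ih]

theorem Holds.represents {m : Mem} (h : σ.Holds P m) {T : ℕ}
    (hT : σ.count * (n * 5 + 10) + 12 ≤ T) : Represents evalProg T m (σ.fn P) := by
  intro x c hc
  have hE : m.EqOff [] [3] (m.loadPoint x) :=
    ⟨fun _ _ => rfl, fun r hr => by
      funext i j
      have : r ≠ 3 := fun h => hr (by simp [h])
      simp [Mem.loadPoint, this]⟩
  have hx : (m.loadPoint x).HasPoint x := fun j => by simp [Mem.loadPoint]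
  obtain ⟨m', hm', hrun⟩ := (runs_evalProg (h.test.params.congr hE (by simp) (by simp)) hx
    (h.test.sum.congr hE (by simp) (by simp))).run_eq
  rw [hrun T hT, PMF.support_pure, Set.mem_singleton_iff] at hc
  subst hc
  exact ⟨rfl, hm'.2⟩

end SearchState

/-- The given vector is extended by 0 beyond degree `d`. Since the list enumerates exactly the
nonzero entries, looking up an index of degree at most `d` returns its entry, with default 0, in
whatever order the list is. -/
theorem sound_searchParams {n s d : ℕ} {μ : Fin n → ℝ} {f : Cube n → ℝ} {γ δ : ℝ}
    {v : LowDeg n d → ℝ} (enum : Fin s ≃ {a : LowDeg n d // v a ≠ 0})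
    (hμ : ∀ i, μ i ∈ Set.Ioo (-1 : ℝ) 1) (hf : ∀ x, f x = -1 ∨ f x = 1) (hγ : 0 < γ)
    (hv : ∀ a : LowDeg n d, |fourierCoeffProd μ f a - v a| ≤ γ)
    {ω : Fin (numFlips n γ δ) → Bool}
    (hω : (searchParams d γ δ μ (fun j => v (enum j).1) ω).GoodSample) :
    (searchParams d γ δ μ (fun j => v (enum j).1) ω).Sound f
      (fun a => if h : a.card ≤ d then v ⟨a, h⟩ else 0)
      (initState fun j => (enum j).1.1).queue where
  mean := hμ
  bounded := fun x => by rcases hf x with h | h <;> rw [h] <;> norm_num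
  gam := hγ
  size := by simp [searchParams, numPairs, numTerms]
  maxCount := one_lt_numTerms_mul hγ
  maxTail := by simp only [searchParams, queueBound]; omega
  approx := fun a ha => by
    simp only [searchParams] at ha
    simp only [ha, dif_pos]
    exact hv ⟨a, ha⟩
  root := by simp [searchParams, initState]
  leaf := fun i (hi : i < s) => by simp [initState, hi.ne]
  listed := fun a ha => by
    split_ifs at ha with h
    · refine ⟨enum.symm ⟨⟨a, h⟩, ha⟩, (enum.symm ⟨⟨a, h⟩, ha⟩).2, ?_⟩
      simp [initState]
    · exact absurd rfl ha
  lookup := fun a ha => by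
    simp only [searchParams] at ha
    simp only [ha, dif_pos]
    refine lookupVal_eq (fun i (hi : i < s) h => ?_) fun h => ?_
    · simp only [initState, hi, dif_pos] at h
      simp only [searchParams, hi, dif_pos]
      exact congrArg v (Subtype.ext h)
    · by_contra hne
      refine h (enum.symm ⟨⟨a, ha⟩, hne⟩) (enum.symm ⟨⟨a, ha⟩, hne⟩).2 ?_
      simp [initState]
  good := hω

theorem mainTheorem9 :
    ∃ A E : Prog, ∀ K : ℝ, ∃ C k : ℕ,
      ∀ (n d : ℕ) (μ : Fin n → ℝ) (f : Cube n → ℝ) (γ δ : ℝ) (v : LowDeg n d → ℝ)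
        (enum : Fin (sparsity v) ≃ {a : LowDeg n d // v a ≠ 0}),
        (∀ i, μ i ∈ Set.Ioo (-1 : ℝ) 1) →
        (∀ x, f x = -1 ∨ f x = 1) →
        0 < γ → 0 < δ →
        (∀ a : LowDeg n d, |fourierCoeffProd μ f a - v a| ≤ γ) →
        (sparsity v : ℝ) ≤ K / γ ^ 2 →
        ∃ T : ℕ, (T : ℝ) ≤ C * (1 + n + 1 / γ + max 0 (Real.log (1 / δ))) ^ k ∧
          (∀ c ∈ (Cfg.run T ([A], inputMem d γ δ μ
              (fun j => (enum j).1.1) (fun j => v (enum j).1))).support,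
            c.1 = [] ∧ ∃ g : Cube n → ℝ, Represents E T c.2 g ∧ ∀ x, g x ∈ Set.Icc (-1 : ℝ) 1) ∧
          ENNReal.ofReal (1 - δ) ≤
            (Cfg.run T ([A], inputMem d γ δ μ
              (fun j => (enum j).1.1) (fun j => v (enum j).1))).toOuterMeasure
              {c | ∃ g : Cube n → ℝ, Represents E T c.2 g ∧
                (∀ x, g x ∈ Set.Icc (-1 : ℝ) 1) ∧
                ∀ a : LowDeg n d, |fourierCoeffProd μ f a - fourierCoeffProd μ g a| ≤ 5 * γ} := by
  classical
  refine ⟨approxProg, evalProg, fun K => ?_⟩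
  -- A single `T` serves the construction and the evaluation, so it is the sum of the two bounds.
  obtain ⟨C, k, hCk⟩ := (PolyBound.approx (K := K)).add PolyBound.eval
  refine ⟨C, k, fun n d μ f γ δ v enum hμ hf hγ hδ hv hs => ?_⟩
  obtain ⟨G, hG, hrun⟩ := run_approxProg d γ δ hδ μ (fun j => (enum j).1.1) fun j => v (enum j).1
  choose σ hreach hdone hholds using hG
  have hcount : ∀ ω, (σ ω).count ≤ numTerms γ := fun ω => (hreach ω).count_le (Nat.zero_le _)
  refine ⟨_, hCk n _ γ δ hγ hs, ?_⟩
  set T := approxTime n (sparsity v) γ δ + (numTerms γ * (n * 5 + 10) + 12) with hT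
  have hrep : ∀ ω, Represents evalProg T (G ω)
      ((σ ω).fn (searchParams d γ δ μ (fun j => v (enum j).1) ω)) := fun ω =>
    (hholds ω).represents (by
      have := Nat.mul_le_mul_right (n * 5 + 10) (hcount ω)
      omega)
  rw [hrun T (by omega)]
  refine ⟨fun c hc => ?_, ?_⟩
  · obtain ⟨ω, -, rfl⟩ := (PMF.mem_support_map_iff _ _ _).1 hc
    exact ⟨rfl, _, hrep ω, SearchState.fn_mem _ _⟩
  · have hbad := card_not_goodSample_le d hγ hδ hμ fun j => v (enum j).1
    set good := Finset.univ.filter fun ω =>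
      (searchParams d γ δ μ (fun j => v (enum j).1) ω).GoodSample with hgood
    rw [← Finset.compl_filter, Finset.card_compl, Nat.cast_sub (Finset.card_le_univ _), sub_div,
      div_self (Nat.cast_ne_zero.2 Fintype.card_ne_zero)] at hbad
    rw [PMF.toOuterMeasure_map_apply]
    -- Every good outcome lies in the preimage of the success event, so the share of good outcomes
    -- bounds its probability from below.
    refine le_trans ?_ (MeasureTheory.OuterMeasure.mono _ (show (good : Set _) ⊆ _ from ?_))
    · refine le_trans ?_ (PMF.toOuterMeasure_uniformOfFintype_apply _).ge
      refine (ENNReal.ofReal_le_ofReal (show 1 - δ ≤ good.card / Fintype.card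
        (Fin (numFlips n γ δ) → Bool) by linarith)).trans_eq ?_
      rw [ENNReal.ofReal_div_of_pos (Nat.cast_pos.2 Fintype.card_pos), ENNReal.ofReal_natCast,
        ENNReal.ofReal_natCast]
      simp
    · intro ω hω
      have hP := sound_searchParams enum hμ hf hγ hv (Finset.mem_filter.1 hω).2
      exact ⟨_, hrep ω, SearchState.fn_mem _ _, fun a =>
        (((SearchState.inv_of_start hP rfl rfl rfl rfl).reaches hP (hreach ω)).abs_sub_le hP
          (hdone ω) a.2)⟩
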